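/- Let $N\ge 0$, let $J=\begin{pmatrix}0&-1\\1&0\end{pmatrix}$, and let $\mathfrak g=\mathfrak g^J_N$ be the complexified Lie algebra of the real Jacobi group of rank $N$: the complex vector space of triples $(M,X,\kappa)$ with $M\in\mathfrak{sl}_2(\mathbb C)$, $X\in M_{N,2}(\mathbb C)$ and $\kappa\in M_N^T(\mathbb C)$ (complex symmetric $N\times N$ matrices), with the bracket $$[(M_1,X_1,\kappa_1),(M_2,X_2,\kappa_2)]=\bigl([M_1,M_2],\,X_1M_2-X_2M_1,\,X_2JX_1^T-X_1JX_2^T\bigr).$$ Let $\epsilon_{rs}$ denote elementary matrices, let $E=\epsilon_{12}$, $F=\epsilon_{21}$, $H=\epsilon_{11}-\epsilon_{22}$ be the standard basis of $\mathfrak{sl}_2$, let $e_r=\epsilon_{r2}$ and $f_r=\epsilon_{r1}$ in $M_{N,2}(\mathbb C)$, let $Z_{rs}=\frac12(\epsilon_{rs}+\epsilon_{sr})$ in $M_N^T(\mathbb C)$, and set $\tilde H=i(F-E)$ and $\tilde Z_{rs}=\frac i2Z_{rs}$. Let $\mathfrak k=\{(M,0,\kappa):M\in\mathfrak o_2(\mathbb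 C),\ \kappa\in M_N^T(\mathbb C)\}$, the complexified Lie algebra of the isotropy group; it is abelian and is spanned by $\tilde H$ and the $\tilde Z_{rs}$. For $k\in\mathbb C$ and $L\in M_N^T(\mathbb C)$ let $\pi_{k,L}$ be the one-dimensional representation of $\mathfrak k$ with $\pi_{k,L}(\tilde H)=-k$ and $\pi_{k,L}(\tilde Z_{rs})=\pi L_{rs}$, which corresponds to the scalar slash action of weight $k$ and index $L$. Let $\mathfrak U(\mathfrak g)$ be the universal enveloping algebra, with center $\mathfrak Z(\mathfrak g)$; let $\mathfrak U(\mathfrak g)^{\mathfrak k}$ be the subalgebra of invariants under the adjoint action of $\mathfrak k$; let $\mathcal I_{k,L}$ be the left ideal of $\mathfrak U(\mathfrak g)$ generated by all $Y+\pi_{k,L}(Y)$, $Y\in\mathfrak k$; and let $(\mathcal I_{k,L})^{\mathfrak k}=\mathcal I_{k,L}\cap\mathfrak U(\mathfrak g)^{\mathfrak k}$, a two-sided ideal of $\mathfrak U(\mathfrak g)^{\mathfrak k}$. The invariant differential operator algebra of the slash action is, in Helgason's algebraic description, $$\mathbb D_{k,L}=\mathfrak U(\mathfrak g)^{\mathfrak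 k}\big/(\mathcal I_{k,L})^{\mathfrak k}.$$ Let $Z$ be the symmetric matrix with entries $Z_{rs}$, and let $e$, $f$ be the column vectors with entries $e_r$, $f_r$. In the localization $\mathfrak U(\mathfrak g)[\det(Z)^{-1}]$ put $$\nu(H)=H-\tfrac14(f^TZ^{-1}e+e^TZ^{-1}f),\quad \nu(E)=E-\tfrac14e^TZ^{-1}e,\quad \nu(F)=F+\tfrac14f^TZ^{-1}f,$$ and $\nu(\Omega_{\mathfrak{sl}_2})=\nu(H)^2+2\nu(H)+4\nu(F)\nu(E)$. The Casimir element $\Omega_N=\det(Z)\bigl(\nu(\Omega_{\mathfrak{sl}_2})-\frac14N(N+4)\bigr)$ lies in $\mathfrak U(\mathfrak g)$. **Theorem.** Let $k\in\mathbb C$ and let $L\in M_N^T(\mathbb C)$ be invertible. Then $\Omega_N\in\mathfrak Z(\mathfrak g)$; the center of $\mathbb D_{k,L}$ is exactly the image of $\mathfrak Z(\mathfrak g)$ under the natural homomorphism $\mathfrak Z(\mathfrak g)\to\mathbb D_{k,L}$; and this center is the polynomial algebra in one variable $\mathbb C\bigl[\Omega_N+(\mathcal I_{k,L})^{\mathfrak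 k}\bigr]$, that is, it is generated as a $\mathbb C$-algebra by the Casimir operator $\Omega_N+(\mathcal I_{k,L})^{\mathfrak k}$, which is algebraically independent over $\mathbb C$. -/

import Mathlib

open Matrix

namespace Jacobi

/-! ## The complexified Jacobi Lie algebra of rank `N` -/

/-- The matrix `J`. -/
def J : Matrix (Fin 2) (Fin 2) ℂ := !![0, -1; 1, 0]

/-- The space of complex symmetric `N × N` matrices. -/
def symMat (N : ℕ) : Submodule ℂ (Matrix (Fin N) (Fin N) ℂ) where
  carrier := {A | A.IsSymm}
  add_mem' := fun ha hb => Matrix.IsSymm.add ha hb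
  zero_mem' := Matrix.isSymm_zero
  smul_mem' := fun c _ ha => Matrix.IsSymm.smul ha c

/-- The complexified Jacobi Lie algebra of rank `N`, as a vector space: its elements are the
triples `(M, X, κ)` with `M ∈ sl₂(ℂ)`, `X` a complex `N × 2` matrix and `κ` a complex symmetric
`N × N` matrix. -/
def Alg (N : ℕ) : Type :=
  LieAlgebra.SpecialLinear.sl (Fin 2) ℂ × Matrix (Fin N) (Fin 2) ℂ × symMat N

noncomputable instance (N : ℕ) : AddCommGroup (Alg N) :=
  inferInstanceAs (AddCommGroup
    (LieAlgebra.SpecialLinear.sl (Fin 2) ℂ × Matrix (Fin N) (Fin 2) ℂ × symMat N))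

noncomputable instance (N : ℕ) : Module ℂ (Alg N) :=
  inferInstanceAs (Module ℂ
    (LieAlgebra.SpecialLinear.sl (Fin 2) ℂ × Matrix (Fin N) (Fin 2) ℂ × symMat N))

variable {N : ℕ}

/-- The component `M` of `(M, X, κ)`. -/
def Alg.M (x : Alg N) : Matrix (Fin 2) (Fin 2) ℂ := x.1.1

/-- The component `X` of `(M, X, κ)`. -/
def Alg.X (x : Alg N) : Matrix (Fin N) (Fin 2) ℂ := x.2.1

/-- The component `κ` of `(M, X, κ)`. -/
def Alg.κ (x : Alg N) : Matrix (Fin N) (Fin N) ℂ := x.2.2.1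

theorem trace_M (x : Alg N) : x.M.trace = 0 :=
  (LinearMap.mem_ker (f := Matrix.traceLinearMap (Fin 2) ℂ ℂ)).1 x.1.2

theorem symm_κ (x : Alg N) : x.κ.IsSymm := x.2.2.2

/-- The triple `(M, X, κ)`. -/
def mk (M : Matrix (Fin 2) (Fin 2) ℂ) (hM : M.trace = 0) (X : Matrix (Fin N) (Fin 2) ℂ)
    (κ : Matrix (Fin N) (Fin N) ℂ) (hκ : κ.IsSymm) : Alg N :=
  (⟨M, (LinearMap.mem_ker (f := Matrix.traceLinearMap (Fin 2) ℂ ℂ)).2 hM⟩, X, ⟨κ, hκ⟩)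

theorem alg_ext {x y : Alg N} (hM : x.M = y.M) (hX : x.X = y.X) (hκ : x.κ = y.κ) : x = y :=
  Prod.ext (Subtype.ext hM) (Prod.ext hX (Subtype.ext hκ))

@[simp] theorem mk_M (M : Matrix (Fin 2) (Fin 2) ℂ) (hM X) (κ : Matrix (Fin N) (Fin N) ℂ) (hκ) :
    (mk M hM X κ hκ).M = M := rfl
@[simp] theorem mk_X (M : Matrix (Fin 2) (Fin 2) ℂ) (hM X) (κ : Matrix (Fin N) (Fin N) ℂ) (hκ) :
    (mk M hM X κ hκ).X = X := rfl
@[simp] theorem mk_κ (M : Matrix (Fin 2) (Fin 2) ℂ) (hM X) (κ : Matrix (Fin N) (Fin N) ℂ) (hκ) :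
    (mk M hM X κ hκ).κ = κ := rfl
@[simp] theorem zero_M : (0 : Alg N).M = 0 := rfl
@[simp] theorem zero_X : (0 : Alg N).X = 0 := rfl
@[simp] theorem zero_κ : (0 : Alg N).κ = 0 := rfl
@[simp] theorem add_M (x y : Alg N) : (x + y).M = x.M + y.M := rfl
@[simp] theorem add_X (x y : Alg N) : (x + y).X = x.X + y.X := rfl
@[simp] theorem add_κ (x y : Alg N) : (x + y).κ = x.κ + y.κ := rfl
@[simp] theorem smul_M (c : ℂ) (x : Alg N) : (c • x).M = c • x.M := rfl
@[simp] theorem smul_X (c : ℂ) (x : Alg N) : (c • x).X = c • x.X := rfl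
@[simp] theorem smul_κ (c : ℂ) (x : Alg N) : (c • x).κ = c • x.κ := rfl

@[simp] theorem neg_M (x : Alg N) : (-x).M = -x.M := rfl
@[simp] theorem neg_X (x : Alg N) : (-x).X = -x.X := rfl
@[simp] theorem neg_κ (x : Alg N) : (-x).κ = -x.κ := rfl
@[simp] theorem sub_M (x y : Alg N) : (x - y).M = x.M - y.M := rfl
@[simp] theorem sub_X (x y : Alg N) : (x - y).X = x.X - y.X := rfl
@[simp] theorem sub_κ (x y : Alg N) : (x - y).κ = x.κ - y.κ := rfl

theorem M_11 (x : Alg N) : x.M 1 1 = -x.M 0 0 := by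
  have h := trace_M x
  rw [Matrix.trace_fin_two] at h
  linear_combination h

theorem trace_commutator (A B : Matrix (Fin 2) (Fin 2) ℂ) : (A * B - B * A).trace = 0 := by
  rw [Matrix.trace_sub, Matrix.trace_mul_comm, sub_self]

theorem symm_cocycle (X Y : Matrix (Fin N) (Fin 2) ℂ) : (Y * J * Xᵀ - X * J * Yᵀ).IsSymm := by
  ext i j
  simp [J, Matrix.mul_apply, Fin.sum_univ_two]
  ring

/-- The bracket of the Jacobi Lie algebra. -/
noncomputable instance : Bracket (Alg N) (Alg N) where
  bracket x y := mk (x.M * y.M - y.M * x.M) (trace_commutator _ _) (x.X * y.M - y.X * x.M)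
    (y.X * J * x.Xᵀ - x.X * J * y.Xᵀ) (symm_cocycle _ _)

@[simp] theorem lie_M (x y : Alg N) : ⁅x, y⁆.M = x.M * y.M - y.M * x.M := rfl
@[simp] theorem lie_X (x y : Alg N) : ⁅x, y⁆.X = x.X * y.M - y.X * x.M := rfl
@[simp] theorem lie_κ (x y : Alg N) : ⁅x, y⁆.κ = y.X * J * x.Xᵀ - x.X * J * y.Xᵀ := rfl

noncomputable instance : LieRing (Alg N) where
  add_lie x y z := by
    apply alg_ext
    · simp [add_mul, mul_add]; abel
    · simp [Matrix.add_mul, Matrix.mul_add]; abel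
    · simp [Matrix.add_mul, Matrix.mul_add]; abel
  lie_add x y z := by
    apply alg_ext
    · simp [add_mul, mul_add]; abel
    · simp [Matrix.add_mul, Matrix.mul_add]; abel
    · simp [Matrix.add_mul, Matrix.mul_add]; abel
  lie_self x := by
    apply alg_ext <;> simp
  leibniz_lie x y z := by
    apply alg_ext
    · simp; noncomm_ring
    · simp [Matrix.sub_mul, Matrix.mul_sub, Matrix.mul_assoc]; abel
    · ext i j
      simp [J, Matrix.mul_apply, Fin.sum_univ_two, M_11]
      ring

noncomputable instance : LieAlgebra ℂ (Alg N) where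
  lie_smul c x y := by
    apply alg_ext <;> simp [smul_sub]

/-! ## Basis elements -/

variable (N) in
/-- `E ∈ sl₂`. -/
noncomputable def E : Alg N := mk !![0, 1; 0, 0] (by simp [Matrix.trace_fin_two]) 0 0 (by simp)

variable (N) in
/-- `F ∈ sl₂`. -/
noncomputable def F : Alg N := mk !![0, 0; 1, 0] (by simp [Matrix.trace_fin_two]) 0 0 (by simp)

variable (N) in
/-- `H ∈ sl₂`. -/
noncomputable def H : Alg N := mk !![1, 0; 0, -1] (by simp [Matrix.trace_fin_two]) 0 0 (by simp)

/-- `e_r`, the elementary `N × 2` matrix with entry `1` in row `r` and the second column. -/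
noncomputable def e (r : Fin N) : Alg N := mk 0 (by simp) (Matrix.single r 1 1) 0 (by simp)

/-- `f_r`, the elementary `N × 2` matrix with entry `1` in row `r` and the first column. -/
noncomputable def f (r : Fin N) : Alg N := mk 0 (by simp) (Matrix.single r 0 1) 0 (by simp)

theorem symm_Z (r s : Fin N) :
    ((1 / 2 : ℂ) • (Matrix.single r s (1 : ℂ) + Matrix.single s r 1)).IsSymm := by
  simp [Matrix.IsSymm, add_comm]

/-- `Z_{rs}`, half the sum of the elementary `N × N` matrices at `(r, s)` and `(s, r)`. -/
noncomputable def Z (r s : Fin N) : Alg N :=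
  mk 0 (by simp) 0 ((1 / 2 : ℂ) • (Matrix.single r s (1 : ℂ) + Matrix.single s r 1)) (symm_Z r s)

attribute [local instance] LieRing.ofAssociativeRing

/-! ## The isotropy subalgebra and its one-dimensional representations -/

variable (N) in
/-- The complexified isotropy subalgebra: the triples `(M, 0, κ)` with `M ∈ o₂(ℂ)`, that is, with
`M` skew-symmetric. -/
noncomputable def isotropy : LieSubalgebra ℂ (Alg N) where
  carrier := {x | x.Mᵀ = -x.M ∧ x.X = 0}
  add_mem' := by
    rintro x y ⟨h1, h2⟩ ⟨h3, h4⟩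
    exact ⟨by simp [h1, h3, add_comm], by simp [h2, h4]⟩
  zero_mem' := ⟨by simp, by simp⟩
  smul_mem' := by
    rintro c x ⟨h1, h2⟩
    exact ⟨by simp [h1], by simp [h2]⟩
  lie_mem' := by
    rintro x y ⟨h1, h2⟩ ⟨h3, h4⟩
    exact ⟨by simp [h1, h3], by simp [h2, h4]⟩

/-- `H̃ = i(F - E)`. -/
noncomputable def tildeH : isotropy N :=
  ⟨Complex.I • (F N - E N), by
    refine ⟨?_, by simp [E, F]⟩
    ext i j
    fin_cases i <;> fin_cases j <;> simp [E, F]⟩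

/-- `Z̃_{rs} = (i/2) Z_{rs}`. -/
noncomputable def tildeZ (r s : Fin N) : isotropy N :=
  ⟨(Complex.I / 2) • Z r s, ⟨by simp [Z], by simp [Z]⟩⟩

/-- The one-dimensional representation `π_{k,L}` of the isotropy subalgebra attached to the scalar
slash action of weight `k` and index `L`. The lemmas `slashRep_tildeH` and `slashRep_tildeZ` below
show that it is the one with `π_{k,L}(H̃) = -k` and `π_{k,L}(Z̃_{rs}) = π L_{rs}`. -/
noncomputable def slashRep (k : ℂ) (L : Matrix (Fin N) (Fin N) ℂ) : isotropy N →ₗ⁅ℂ⁆ ℂ where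
  toFun y := Complex.I * k * y.1.M 1 0 - 2 * Real.pi * Complex.I * (y.1.κ * L).trace
  map_add' x y := by simp [Matrix.add_mul]; ring
  map_smul' c x := by simp; ring
  map_lie' := by
    rintro ⟨x, hx1, hx2⟩ ⟨y, hy1, hy2⟩
    have h (z : Alg N) (hz : z.Mᵀ = -z.M) : z.M 0 0 = 0 := by
      have := congrFun (congrFun hz 0) 0
      simp only [Matrix.transpose_apply, Matrix.neg_apply] at this
      linear_combination this / 2
    simp [hx2, hy2, Matrix.mul_apply, Fin.sum_univ_two, M_11, h x hx1, h y hy1,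
      LieRing.of_associative_ring_bracket, mul_comm]

theorem slashRep_tildeH (k : ℂ) (L : Matrix (Fin N) (Fin N) ℂ) : slashRep k L tildeH = -k := by
  simp only [slashRep, tildeH, LieHom.coe_mk]
  simp [E, F]
  linear_combination k * Complex.I_mul_I

theorem slashRep_tildeZ (k : ℂ) {L : Matrix (Fin N) (Fin N) ℂ} (hL : L.IsSymm) (r s : Fin N) :
    slashRep k L (tildeZ r s) = Real.pi * L r s := by
  simp only [slashRep, tildeZ, LieHom.coe_mk]
  simp [Z, Matrix.add_mul, Matrix.trace_single_mul, hL.apply r s]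
  linear_combination - Real.pi * L r s * Complex.I_mul_I

/-! ## The algebra of invariant differential operators -/

variable (N) in
/-- The universal enveloping algebra of the Jacobi Lie algebra. -/
abbrev U : Type := UniversalEnvelopingAlgebra ℂ (Alg N)

/-- The inclusion of the Jacobi Lie algebra in its enveloping algebra. -/
noncomputable abbrev ι : Alg N →ₗ⁅ℂ⁆ U N := UniversalEnvelopingAlgebra.ι ℂ

variable (N) in
/-- The algebra of invariants in the enveloping algebra under the adjoint action of the isotropy
subalgebra, `Y ↦ (u ↦ Yu - uY)`, that is, the commutant of the isotropy subalgebra. -/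
noncomputable def invariants : Subalgebra ℂ (U N) :=
  Subalgebra.centralizer ℂ {u | ∃ Y : isotropy N, u = ι Y.1}

/-- The left ideal of the enveloping algebra generated by all `Y + π_{k,L}(Y)`, with `Y` in the
isotropy subalgebra (`Ideal` means left ideal over a noncommutative ring). -/
noncomputable def slashIdeal (k : ℂ) (L : Matrix (Fin N) (Fin N) ℂ) : Ideal (U N) :=
  Ideal.span {u | ∃ Y : isotropy N, u = ι Y.1 + algebraMap ℂ (U N) (slashRep k L Y)}

/-- The intersection of `slashIdeal k L` with the algebra of invariants. -/
noncomputable def invIdeal (k : ℂ) (L : Matrix (Fin N) (Fin N) ℂ) : Ideal (invariants N) :=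
  (slashIdeal k L).comap (invariants N).val

theorem mul_mem_slashIdeal (k : ℂ) (L : Matrix (Fin N) (Fin N) ℂ) {a b : U N}
    (ha : a ∈ slashIdeal k L) (hb : b ∈ invariants N) : a * b ∈ slashIdeal k L := by
  rw [slashIdeal] at ha
  induction ha using Submodule.span_induction with
  | mem x hx =>
    obtain ⟨Y, rfl⟩ := hx
    have h1 : ι Y.1 * b = b * ι Y.1 := (Subalgebra.mem_centralizer_iff ℂ).1 hb _ ⟨Y, rfl⟩
    have h2 : (ι Y.1 + algebraMap ℂ (U N) (slashRep k L Y)) * b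
        = b * (ι Y.1 + algebraMap ℂ (U N) (slashRep k L Y)) := by
      rw [add_mul, mul_add, h1, Algebra.commutes]
    rw [h2]
    exact Ideal.mul_mem_left _ _ (Ideal.subset_span ⟨Y, rfl⟩)
  | zero => rw [zero_mul]; exact Ideal.zero_mem _
  | add x y _ _ hx hy => rw [add_mul]; exact Ideal.add_mem _ hx hy
  | smul c x _ hx => rw [smul_eq_mul, mul_assoc]; exact Ideal.mul_mem_left _ _ hx

instance (k : ℂ) (L : Matrix (Fin N) (Fin N) ℂ) : (invIdeal k L).IsTwoSided :=
  ⟨fun {_} b ha => mul_mem_slashIdeal k L ha b.2⟩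

/-- The algebra of differential operators invariant under the slash action of weight `k` and
index `L`, in Helgason's algebraic description: the isotropy invariants of the enveloping algebra
modulo the two-sided ideal of those invariants that lie in `slashIdeal k L`. -/
abbrev IDO (k : ℂ) (L : Matrix (Fin N) (Fin N) ℂ) : Type := invariants N ⧸ invIdeal k L

/-- The natural homomorphism from the center of the enveloping algebra to the algebra of invariant
differential operators. -/
noncomputable def centerToIDO (k : ℂ) (L : Matrix (Fin N) (Fin N) ℂ) :
    Subalgebra.center ℂ (U N) →ₐ[ℂ] IDO k L :=
  (Ideal.Quotient.mkₐ ℂ (invIdeal k L)).comp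
    (Subalgebra.inclusion (Subalgebra.center_le_centralizer ℂ _))

/-! ## The Casimir element -/

theorem ι_mul (x y : Alg N) : ι x * ι y = ι y * ι x + ι ⁅x, y⁆ := by
  rw [LieHom.map_lie, LieRing.of_associative_ring_bracket]
  abel

theorem ι_mem_center {z : Alg N} (hz : ∀ x : Alg N, ⁅z, x⁆ = 0) :
    ι z ∈ Subalgebra.center ℂ (U N) := by
  have key : (⊤ : Subalgebra ℂ (U N)) ≤ Subalgebra.centralizer ℂ {ι z} := by
    let C := Subalgebra.centralizer ℂ ({ι z} : Set (U N))
    let g : Alg N →ₗ⁅ℂ⁆ C :=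
      { toFun := fun x => ⟨ι x, (Subalgebra.mem_centralizer_iff ℂ).2 (by
          rintro _ rfl
          rw [ι_mul, hz, map_zero, add_zero])⟩
        map_add' := fun x y => Subtype.ext (by simp)
        map_smul' := fun c x => Subtype.ext (by simp)
        map_lie' := fun {x y} => Subtype.ext (by
          simp [LieRing.of_associative_ring_bracket]) }
    have h : C.val.comp (UniversalEnvelopingAlgebra.lift ℂ g) = AlgHom.id ℂ (U N) := by
      apply UniversalEnvelopingAlgebra.hom_ext
      ext x
      change C.val (UniversalEnvelopingAlgebra.lift ℂ g (UniversalEnvelopingAlgebra.ι ℂ x)) = ι x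
      rw [UniversalEnvelopingAlgebra.lift_ι_apply]
      rfl
    intro u _
    have := congrArg (fun p : U N →ₐ[ℂ] U N => p u) h
    simp only [AlgHom.comp_apply, AlgHom.id_apply] at this
    rw [← this]
    exact (UniversalEnvelopingAlgebra.lift ℂ g u).2
  rw [Subalgebra.mem_center_iff]
  intro b
  exact ((Subalgebra.mem_centralizer_iff ℂ).1 (key (Algebra.mem_top (x := b))) _ rfl).symm

theorem Z_lie (r s : Fin N) (x : Alg N) : ⁅Z r s, x⁆ = 0 := by
  apply alg_ext <;> simp [Z]

variable (N) in
/-- The matrix `Z = (Z_{rs})`, with entries in the (commutative) center of the enveloping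
algebra. -/
noncomputable def matZ : Matrix (Fin N) (Fin N) (Subalgebra.center ℂ (U N)) :=
  Matrix.of fun r s => ⟨ι (Z r s), ι_mem_center (Z_lie r s)⟩

/-- The polynomial `m_{rust}` in the entries of `Z` such that `m_{rust} / det Z` is the
`2 × 2` minor of the inverse of `Z` with rows `r`, `u` and columns `s`, `t`. -/
noncomputable def minor (r u s t : Fin N) : Subalgebra.center ℂ (U N) :=
  if s = t then 0
  else (((matZ N).updateRow s (Pi.single r 1)).updateRow t (Pi.single u 1)).det


/-! Brackets of the basis elements. -/

theorem H_lie_e (r : Fin N) : ⁅H N, e r⁆ = e r := by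
  apply alg_ext
  · simp [H, e]
  · ext i j
    fin_cases j <;> simp [H, e, Matrix.single_apply, Matrix.mul_apply, Fin.sum_univ_two]
    split_ifs <;> simp
  · simp [H, e]

theorem H_lie_f (r : Fin N) : ⁅H N, f r⁆ = - f r := by
  apply alg_ext
  · simp [H, f]
  · ext i j
    fin_cases j <;> simp [H, f, Matrix.single_apply, Matrix.mul_apply, Fin.sum_univ_two]
  · simp [H, f]

theorem e_lie_f (r s : Fin N) : ⁅e r, f s⁆ = (-2 : ℂ) • Z r s := by
  apply alg_ext
  · simp [e, f, Z]
  · simp [e, f, Z]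
  · ext i j
    simp [e, f, Z, J, Matrix.single_apply]
    split_ifs <;> norm_num

section CasimirDef

variable (N)

/-- `det Z`, as an element of the enveloping algebra. -/
noncomputable def detZ : U N := ((matZ N).det : Subalgebra.center ℂ (U N))

/-- The entries of the adjugate matrix of `Z`, as elements of the enveloping algebra. -/
noncomputable def adjZ (r s : Fin N) : U N := ((matZ N).adjugate r s : Subalgebra.center ℂ (U N))

/-- The Casimir element `Ω_N = det Z · (ν(Ω_{sl₂}) - N(N + 4)/4)` of the enveloping algebra of the
Jacobi Lie algebra, with the denominators cleared. The theorem `casimir_spec` below shows that it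
is indeed the element given by this formula. -/
noncomputable def casimir : U N :=
  detZ N * (ι (H N) * ι (H N) + ((N : ℂ) + 2) • ι (H N) + (4 : ℂ) • (ι (F N) * ι (E N)))
    - ι (H N) * (∑ r, ∑ s, adjZ N r s * (ι (f r) * ι (e s)))
    - ι (F N) * (∑ r, ∑ s, adjZ N r s * (ι (e r) * ι (e s)))
    + (∑ r, ∑ s, adjZ N r s * (ι (f r) * ι (f s))) * ι (E N)
    - (((N : ℂ) + 3) / 2) • (∑ r, ∑ s, adjZ N r s * (ι (f r) * ι (e s)))
    + (1 / 4 : ℂ) • (∑ r, ∑ s, ∑ t, ∑ u,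
        (minor r u s t : U N) * (ι (f r) * ι (f t) * (ι (e s) * ι (e u))))

end CasimirDef

/-! ### The Casimir element in the localization at `det Z` -/

theorem commute_pow_detZ (s : Submonoid.powers (detZ N)) (u : U N) : (s : U N) * u = u * s := by
  obtain ⟨_, n, rfl⟩ := s
  have h := Subalgebra.mem_center_iff.1 (((matZ N).det ^ n).2) u
  simpa [detZ] using h.symm

/-- Since `det Z` is central, its powers form an Ore set. -/
noncomputable instance : OreLocalization.OreSet (Submonoid.powers (detZ N)) where
  ore_right_cancel u v s h := ⟨s, by rw [commute_pow_detZ, commute_pow_detZ, h]⟩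
  oreNum u _ := u
  oreDenom _ s := s
  ore_eq u s := commute_pow_detZ s u

variable (N) in
/-- The localization of the enveloping algebra at `det Z`. -/
abbrev Loc : Type := OreLocalization (Submonoid.powers (detZ N)) (U N)

/-- The natural homomorphism from the enveloping algebra to its localization. -/
noncomputable abbrev toLoc : U N →+* Loc N := OreLocalization.numeratorRingHom

variable (N) in
/-- The inverse of `det Z` in the localization. -/
noncomputable def detZInv : Loc N :=
  OreLocalization.oreDiv 1 (⟨detZ N, Submonoid.mem_powers _⟩ : Submonoid.powers (detZ N))

/-- The entries of the inverse of the matrix `Z`, over the localization. -/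
noncomputable def invZ (r s : Fin N) : Loc N := toLoc (adjZ N r s) * detZInv N

variable (N) in
/-- `ν(H) = H - (fᵀ Z⁻¹ e + eᵀ Z⁻¹ f) / 4`. -/
noncomputable def νH : Loc N :=
  toLoc (ι (H N)) - (1 / 4 : ℂ) •
    ((∑ r, ∑ s, toLoc (ι (f r)) * invZ r s * toLoc (ι (e s))) +
      (∑ r, ∑ s, toLoc (ι (e r)) * invZ r s * toLoc (ι (f s))))

variable (N) in
/-- `ν(E) = E - (eᵀ Z⁻¹ e) / 4`. -/
noncomputable def νE : Loc N :=
  toLoc (ι (E N)) - (1 / 4 : ℂ) • (∑ r, ∑ s, toLoc (ι (e r)) * invZ r s * toLoc (ι (e s)))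

variable (N) in
/-- `ν(F) = F + (fᵀ Z⁻¹ f) / 4`. -/
noncomputable def νF : Loc N :=
  toLoc (ι (F N)) + (1 / 4 : ℂ) • (∑ r, ∑ s, toLoc (ι (f r)) * invZ r s * toLoc (ι (f s)))

variable (N) in
/-- `ν(Ω_{sl₂})`, where `Ω_{sl₂} = H² + 2H + 4FE` is the Casimir element of `sl₂`. -/
noncomputable def νΩ : Loc N := νH N ^ 2 + (2 : ℂ) • νH N + (4 : ℂ) • (νF N * νE N)

/-- The Casimir computation in an arbitrary algebra. -/
theorem casimir_abstract {R : Type*} [Ring R] [Algebra ℂ R] (H E F : R) (e f : Fin N → R)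
    (Z W : Fin N → Fin N → R)
    (hZ : ∀ r s x, Z r s * x = x * Z r s) (hW : ∀ r s x, W r s * x = x * W r s)
    (hWZ : ∀ r t, ∑ s, W r s * Z s t = if r = t then 1 else 0)
    (hZW : ∀ r t, ∑ s, Z r s * W s t = if r = t then 1 else 0)
    (hWs : ∀ r s, W r s = W s r)
    (hHe : ∀ r, H * e r = e r * H + e r) (hHf : ∀ r, H * f r = f r * H - f r)
    (hef : ∀ r s, e r * f s = f s * e r - (2 : ℂ) • Z r s) :
    (H - (1 / 4 : ℂ) • ((∑ r, ∑ s, f r * W r s * e s) + (∑ r, ∑ s, e r * W r s * f s))) ^ 2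
      + (2 : ℂ) • (H - (1 / 4 : ℂ) •
        ((∑ r, ∑ s, f r * W r s * e s) + (∑ r, ∑ s, e r * W r s * f s)))
      + (4 : ℂ) • ((F + (1 / 4 : ℂ) • (∑ r, ∑ s, f r * W r s * f s)) *
        (E - (1 / 4 : ℂ) • (∑ r, ∑ s, e r * W r s * e s)))
      - ((N : ℂ) * (N + 4) / 4) • (1 : R)
    = (H * H + ((N : ℂ) + 2) • H + (4 : ℂ) • (F * E))
      - H * (∑ r, ∑ s, W r s * (f r * e s))
      - F * (∑ r, ∑ s, W r s * (e r * e s))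
      + (∑ r, ∑ s, W r s * (f r * f s)) * E
      - (((N : ℂ) + 3) / 2) • (∑ r, ∑ s, W r s * (f r * e s))
      + (1 / 4 : ℂ) • (∑ r, ∑ s, ∑ t, ∑ u,
        (W r s * W u t - W u s * W r t) * (f r * f t * (e s * e u))) := by
  have norm1 (x y : Fin N → R) : ∑ r, ∑ s, x r * W r s * y s = ∑ r, ∑ s, W r s * (x r * y s) := by
    simp only [← hW, mul_assoc]
  have sumWZ : ∑ r, ∑ s, W r s * Z r s = (N : ℂ) • (1 : R) := by
    have h : ∀ r, ∑ s, W r s * Z r s = 1 := by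
      intro r
      have := hZW r r
      simp only [if_true] at this
      rw [← this]
      exact Finset.sum_congr rfl fun s _ => by rw [hZ r s, hWs r s]
    simp [h, Nat.cast_smul_eq_nsmul]
  have hswap : ∑ r, ∑ s, W r s * (e r * f s)
      = ∑ r, ∑ s, W r s * (f r * e s) - (2 * (N : ℂ)) • (1 : R) := by
    rw [mul_smul, ← sumWZ, Finset.smul_sum, Finset.sum_comm (f := fun r s => W r s * (f r * e s)),
      ← Finset.sum_sub_distrib]
    refine Finset.sum_congr rfl fun r _ => ?_
    rw [Finset.smul_sum, ← Finset.sum_sub_distrib]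
    refine Finset.sum_congr rfl fun s _ => ?_
    rw [hef, mul_sub, mul_smul_comm, hWs s r]
  have hHfe (r s : Fin N) : H * (f r * e s) = f r * e s * H := by
    rw [← mul_assoc, hHf, sub_mul, mul_assoc, hHe]
    noncomm_ring
  have hHc : H * (∑ r, ∑ s, W r s * (f r * e s)) = (∑ r, ∑ s, W r s * (f r * e s)) * H := by
    simp only [Finset.mul_sum, Finset.sum_mul]
    refine Finset.sum_congr rfl fun r _ => Finset.sum_congr rfl fun s _ => ?_
    rw [← mul_assoc, ← hW, mul_assoc, hHfe, ← mul_assoc (W r s)]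
  have hcc : (∑ r, ∑ s, W r s * (f r * e s)) * (∑ r, ∑ s, W r s * (f r * e s))
      = (∑ r, ∑ s, ∑ t, ∑ u, W r s * W u t * (f r * f t * (e s * e u)))
        - (2 : ℂ) • (∑ r, ∑ s, W r s * (f r * e s)) := by
    have h1 : (∑ r, ∑ s, W r s * (f r * e s)) * (∑ t, ∑ u, W t u * (f t * e u))
        = ∑ r, ∑ s, ∑ t, ∑ u, (W r s * W u t * (f r * f t * (e s * e u))
          - (2 : ℂ) • (W r s * Z s t * (W t u * (f r * e u)))) := by
      simp only [Finset.sum_mul]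
      refine Finset.sum_congr rfl fun r _ => Finset.sum_congr rfl fun s _ => ?_
      simp only [Finset.mul_sum]
      refine Finset.sum_congr rfl fun t _ => Finset.sum_congr rfl fun u _ => ?_
      rw [hWs u t]
      calc W r s * (f r * e s) * (W t u * (f t * e u))
          = W r s * (W t u * (f r * (e s * f t) * e u)) := by
            rw [mul_assoc, ← mul_assoc (f r * e s), ← hW t u (f r * e s)]
            simp only [mul_assoc]
        _ = W r s * (W t u * (f r * (f t * e s) * e u))
            - (2 : ℂ) • (W r s * (W t u * (f r * Z s t * e u))) := by
            rw [hef]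
            simp only [mul_sub, sub_mul, mul_smul_comm, smul_mul_assoc]
        _ = _ := by
            rw [← hZ s t (f r)]
            have h3 : W t u * (Z s t * f r * e u) = Z s t * (W t u * (f r * e u)) := by
              rw [mul_assoc, ← mul_assoc, hW t u, mul_assoc]
            rw [h3]
            simp only [mul_assoc]
    rw [h1]
    simp only [Finset.sum_sub_distrib, ← Finset.smul_sum]
    congr 2
    refine Finset.sum_congr rfl fun r _ => ?_
    rw [Finset.sum_comm]
    simp only [← Finset.mul_sum, ← Finset.sum_mul, hWZ]
    simp
  have hba : (∑ r, ∑ s, W r s * (f r * f s)) * (∑ r, ∑ s, W r s * (e r * e s))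
      = ∑ r, ∑ s, ∑ t, ∑ u, W u s * W r t * (f r * f t * (e s * e u)) := by
    simp only [Finset.sum_mul]
    refine Finset.sum_congr rfl fun r _ => ?_
    conv_rhs => rw [Finset.sum_comm]
    refine Finset.sum_congr rfl fun t _ => ?_
    simp only [Finset.mul_sum]
    refine Finset.sum_congr rfl fun s _ => Finset.sum_congr rfl fun u _ => ?_
    rw [hWs u s, mul_assoc, ← mul_assoc (f r * f t), ← hW s u (f r * f t), hW s u (W r t)]
    simp only [mul_assoc]
  simp only [norm1, hswap, sub_mul, Finset.sum_sub_distrib]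
  rw [← hba]
  set c := ∑ r, ∑ s, W r s * (f r * e s)
  set a := ∑ r, ∑ s, W r s * (e r * e s)
  set b := ∑ r, ∑ s, W r s * (f r * f s)
  have hq : ∑ r, ∑ s, ∑ t, ∑ u, W r s * W u t * (f r * f t * (e s * e u))
      = c * c + (2 : ℂ) • c := by rw [hcc]; abel
  rw [hq, pow_two]
  simp only [mul_sub, sub_mul, mul_add, add_mul, mul_smul_comm, smul_mul_assoc, smul_add, smul_sub,
    mul_one, one_mul, ← hHc]
  module

theorem Z_comm (r s : Fin N) : Z r s = Z s r := by
  apply alg_ext <;> simp [Z, add_comm]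

theorem symm_matZ : (matZ N).IsSymm := by
  ext r s
  simp only [matZ, Matrix.transpose_apply, Matrix.of_apply, Z_comm s r]

/-- The `2 × 2` minors of the adjugate matrix. -/
theorem det_mul_minor_aux {R : Type*} [CommRing R] (A : Matrix (Fin N) (Fin N) R)
    (r u s t : Fin N) (hst : s ≠ t) :
    A.det * ((A.updateRow s (Pi.single r 1)).updateRow t (Pi.single u 1)).det
      = A.adjugate r s * A.adjugate u t - A.adjugate u s * A.adjugate r t := by
  set B := A.updateRow s (Pi.single r 1) with hBdef
  have hBs : B.adjugate u s = A.adjugate u s := by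
    rw [Matrix.adjugate_apply, Matrix.adjugate_apply, Matrix.updateRow_idem]
  have hB : B.det = A.adjugate r s := (Matrix.adjugate_apply A r s).symm
  have hrow (j : Fin N) : ∑ i, B.adjugate u i * B i j = A.adjugate r s * (1 : Matrix _ _ R) u j := by
    rw [← hB]
    have := congrFun (congrFun (Matrix.adjugate_mul B) u) j
    simpa [Matrix.mul_apply] using this
  have hBA (i j : Fin N) : B i j = A i j + (if i = s then (1 : Matrix _ _ R) r j - A s j else 0) := by
    rw [hBdef, Matrix.updateRow_apply]
    split_ifs with h
    · subst h
      simp [Matrix.one_apply, Pi.single_apply, eq_comm]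
    · simp
  have hrow2 (j : Fin N) : ∑ i, B.adjugate u i * A i j = A.adjugate r s * (1 : Matrix _ _ R) u j
      - A.adjugate u s * (1 : Matrix _ _ R) r j + A.adjugate u s * A s j := by
    rw [← hrow, ← hBs]
    simp only [hBA, mul_add, Finset.sum_add_distrib, mul_ite, mul_zero, Finset.sum_ite_eq',
      Finset.mem_univ, if_true]
    ring
  have hAA (i : Fin N) : ∑ j, A i j * A.adjugate j t = A.det * (1 : Matrix _ _ R) i t := by
    have := congrFun (congrFun (Matrix.mul_adjugate A) i) t
    simpa [Matrix.mul_apply] using this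
  have h1 : ∑ j, (∑ i, B.adjugate u i * A i j) * A.adjugate j t = A.det * B.adjugate u t := by
    simp only [Finset.sum_mul, mul_assoc]
    rw [Finset.sum_comm]
    simp only [← Finset.mul_sum, hAA]
    simp [Matrix.one_apply, mul_comm]
  have h2 : ∑ j, A.adjugate u s * A s j * A.adjugate j t = 0 := by
    simp only [mul_assoc, ← Finset.mul_sum, hAA]
    simp [hst]
  rw [← Matrix.adjugate_apply, ← h1]
  simp only [hrow2, add_mul, sub_mul, Finset.sum_add_distrib, Finset.sum_sub_distrib, h2]
  simp [Matrix.one_apply]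

theorem det_mul_minor (r u s t : Fin N) :
    (matZ N).det * minor r u s t
      = (matZ N).adjugate r s * (matZ N).adjugate u t
        - (matZ N).adjugate u s * (matZ N).adjugate r t := by
  rw [minor]
  split_ifs with hst
  · subst hst
    rw [mul_zero, mul_comm, sub_self]
  · exact det_mul_minor_aux _ r u s t hst

theorem detZ_mem_center : detZ N ∈ Subalgebra.center ℂ (U N) := (matZ N).det.2

theorem toLoc_detZ_mul_detZInv : toLoc (detZ N) * detZInv N = 1 :=
  OreLocalization.mul_inv (⟨detZ N, Submonoid.mem_powers _⟩ : Submonoid.powers (detZ N)) 1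

theorem detZInv_mul_toLoc_detZ : detZInv N * toLoc (detZ N) = 1 :=
  OreLocalization.mul_inv 1 (⟨detZ N, Submonoid.mem_powers _⟩ : Submonoid.powers (detZ N))

theorem toLoc_smul (c : ℂ) (u : U N) : toLoc (c • u) = c • toLoc u := by
  rw [Algebra.smul_def, Algebra.smul_def, map_mul]
  rfl

theorem toLoc_commute {z : U N} (hz : z ∈ Subalgebra.center ℂ (U N)) (x : Loc N) :
    toLoc z * x = x * toLoc z := by
  induction x using OreLocalization.ind with | _ u s
  change OreLocalization.oreDiv z 1 * _ = _ * OreLocalization.oreDiv z 1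
  rw [OreLocalization.mul_div_one, OreLocalization.oreDiv_mul_char z u 1 s z s
    (Subalgebra.mem_center_iff.1 hz _), mul_one, Subalgebra.mem_center_iff.1 hz u]

theorem detZInv_commute (x : Loc N) : detZInv N * x = x * detZInv N := by
  calc detZInv N * x = detZInv N * x * (toLoc (detZ N) * detZInv N) := by
        rw [toLoc_detZ_mul_detZInv, mul_one]
    _ = detZInv N * (x * toLoc (detZ N)) * detZInv N := by simp only [mul_assoc]
    _ = (detZInv N * toLoc (detZ N)) * x * detZInv N := by
        rw [← toLoc_commute detZ_mem_center]; simp only [mul_assoc]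
    _ = x * detZInv N := by rw [detZInv_mul_toLoc_detZ, one_mul]

theorem invZ_commute (r s : Fin N) (x : Loc N) : invZ r s * x = x * invZ r s := by
  have h : adjZ N r s ∈ Subalgebra.center ℂ (U N) := ((matZ N).adjugate r s).2
  rw [invZ, mul_assoc, detZInv_commute, ← mul_assoc, toLoc_commute h, mul_assoc]

theorem detZ_mul_invZ (r s : Fin N) : toLoc (detZ N) * invZ r s = toLoc (adjZ N r s) := by
  rw [← invZ_commute, invZ, mul_assoc, detZInv_mul_toLoc_detZ, mul_one]

theorem detZ_mul_minor (r u s t : Fin N) :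
    toLoc (detZ N) * (invZ r s * invZ u t - invZ u s * invZ r t) = toLoc (minor r u s t : U N) := by
  have h' : toLoc (detZ N) * toLoc (minor r u s t : U N)
      = toLoc (adjZ N r s) * toLoc (adjZ N u t) - toLoc (adjZ N u s) * toLoc (adjZ N r t) := by
    rw [← map_mul, ← map_mul, ← map_mul, ← map_sub]
    exact congrArg (fun z : Subalgebra.center ℂ (U N) => toLoc (z : U N)) (det_mul_minor r u s t)
  have key (p q x y : Fin N) : toLoc (detZ N) * (toLoc (detZ N) * (invZ p q * invZ x y))
      = toLoc (adjZ N p q) * toLoc (adjZ N x y) := by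
    rw [← detZ_mul_invZ p q, ← detZ_mul_invZ x y, mul_assoc (toLoc (detZ N)) (invZ p q),
      ← mul_assoc (invZ p q), invZ_commute p q (toLoc (detZ N)), mul_assoc (toLoc (detZ N))]
  have hc : toLoc (detZ N) * (toLoc (detZ N) * (invZ r s * invZ u t - invZ u s * invZ r t))
      = toLoc (detZ N) * toLoc (minor r u s t : U N) := by
    rw [h', mul_sub, mul_sub, key, key]
  have := congrArg (fun x => detZInv N * x) hc
  simpa only [← mul_assoc, detZInv_mul_toLoc_detZ, one_mul] using this

theorem adjZ_mul_Z (r t : Fin N) :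
    ∑ s, adjZ N r s * ι (Z s t) = if r = t then detZ N else 0 := by
  have h := congrArg (Subtype.val : Subalgebra.center ℂ (U N) → U N)
    (congrFun (congrFun (Matrix.adjugate_mul (matZ N)) r) t)
  rw [Matrix.mul_apply] at h
  simp only [AddSubmonoidClass.coe_finsetSum] at h
  refine Eq.trans h ?_
  rw [Matrix.smul_apply, Matrix.one_apply]
  split_ifs <;> simp [detZ]

theorem invZ_mul_Z (r t : Fin N) :
    ∑ s, invZ r s * toLoc (ι (Z s t)) = if r = t then 1 else 0 := by
  have h (s : Fin N) : invZ r s * toLoc (ι (Z s t))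
      = detZInv N * toLoc (adjZ N r s * ι (Z s t)) := by
    rw [invZ, ← detZInv_commute, map_mul, mul_assoc]
  simp only [h, ← Finset.mul_sum, ← map_sum, adjZ_mul_Z]
  split_ifs
  · exact detZInv_mul_toLoc_detZ
  · rw [map_zero, mul_zero]

theorem invZ_symm (r s : Fin N) : invZ r s = (invZ s r : Loc N) := by
  have h : (matZ N).adjugate.IsSymm := by
    rw [Matrix.IsSymm, Matrix.adjugate_transpose, symm_matZ.eq]
  rw [invZ, invZ, adjZ, adjZ, h.apply]

/-- The Casimir element satisfies `Ω_N = det Z · (ν(Ω_{sl₂}) - N(N + 4)/4)`. -/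
theorem casimir_spec :
    toLoc (casimir N) =
      toLoc (detZ N) * (νΩ N - algebraMap ℂ (Loc N) ((N : ℂ) * (N + 4) / 4)) := by
  have lie (x y : Alg N) : toLoc (ι x) * toLoc (ι y) = toLoc (ι y) * toLoc (ι x) + toLoc (ι ⁅x, y⁆) := by
    rw [← map_mul, ι_mul, map_add, map_mul]
  have hZ (r s : Fin N) (x : Loc N) : toLoc (ι (Z r s)) * x = x * toLoc (ι (Z r s)) :=
    toLoc_commute (ι_mem_center (Z_lie r s)) x
  have key := casimir_abstract (toLoc (ι (H N))) (toLoc (ι (E N))) (toLoc (ι (F N)))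
    (fun r => toLoc (ι (e r))) (fun r => toLoc (ι (f r))) (fun r s => toLoc (ι (Z r s)))
    (fun r s => (invZ r s : Loc N)) hZ invZ_commute invZ_mul_Z
    (fun r t => by
      have h := invZ_mul_Z t r
      simp only [eq_comm (a := t)] at h
      rw [← h]
      exact Finset.sum_congr rfl fun s _ => by rw [hZ, invZ_symm s t, Z_comm r s])
    invZ_symm
    (fun r => by rw [lie, H_lie_e])
    (fun r => by rw [lie, H_lie_f, map_neg, map_neg, sub_eq_add_neg])
    (fun r s => by
      rw [lie, e_lie_f, map_smul, toLoc_smul, neg_smul, sub_eq_add_neg])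
  rw [Algebra.algebraMap_eq_smul_one, νΩ, νH, νE, νF, key]
  have dW (r s : Fin N) (x : Loc N) :
      toLoc (detZ N) * (invZ r s * x) = toLoc (adjZ N r s) * x := by
    rw [← mul_assoc, detZ_mul_invZ]
  have dm (r u s t : Fin N) (x : Loc N) :
      toLoc (detZ N) * ((invZ r s * invZ u t - invZ u s * invZ r t) * x)
        = toLoc (minor r u s t : U N) * x := by
    rw [← mul_assoc, detZ_mul_minor]
  have dx (x y : Loc N) : toLoc (detZ N) * (x * y) = x * (toLoc (detZ N) * y) := by
    rw [← mul_assoc, toLoc_commute detZ_mem_center, mul_assoc]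
  simp only [casimir, map_add, map_sub, map_mul, map_sum, toLoc_smul]
  simp only [mul_add (toLoc (detZ N)), mul_sub (toLoc (detZ N)),
    mul_smul_comm _ (toLoc (detZ N))]
  rw [dx (toLoc (ι (H N))) (∑ r, ∑ s, _), dx (toLoc (ι (F N))) (∑ r, ∑ s, _),
    ← mul_assoc (toLoc (detZ N)) (∑ r, ∑ s, _) (toLoc (ι (E N)))]
  simp only [Finset.mul_sum _ _ (toLoc (detZ N)), dW, dm]

end Jacobi

/-! Centrality of the Casimir element is a direct commutator computation. It is enough to test
`e_r`, `E` and `F`: they generate `f_r` and `H` by brackets, and the `Z_{rs}` are central. What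
makes the terms cancel is the contraction of a row or column of `Z` with the adjugate, or with the
`2 × 2` minors of the inverse (`sum_mul_minorOf`, `sum_minorOf_mul`). These contractions are
polynomial identities in the matrix entries, so they are proved on a generic matrix, where the
determinant can be cancelled.

For the centre of the quotient, note that modulo the slash ideal `Z` acts by the invertible scalar
matrix `c = 2πiL` (`indexMat`). Once `Z` is specialized to an invertible `c`, the Heisenberg part
becomes a Weyl algebra containing its own metaplectic `sl₂`-triple. Subtracting that triple leaves
an `sl₂` that commutes with the Weyl algebra (`JacobiRel.splitRel`). A Cayley transform adapted to
`H̃` gives a triple `(h, p, m)` and operators `y_r`, `D_r` with `H̃ = h + ∑ y_r D_r + N/2`, and the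
Casimir element becomes `det c` times the `sl₂` Casimir operator minus `N(N+4)/4` (`hom_casimir`).

The cyclic module of the enveloping algebra modulo the slash ideal is then compared with an explicit
model of weighted shifts on the lattice `ℤ^{1+N}`. The coefficients are polynomials in `X none`, the
`sl₂` Casimir operator, and `X (some r)`, the value of `y_r D_r` at the origin. The cyclic module is
spanned by ordered words in raising or lowering operators, one for each lattice point, applied to
coefficient operators (`hom_mem_iSup_wordSpace`). In the model each word carries the vacuum to a
nonzero multiple of the delta at its lattice point (`exists_word_vac`). Spanning on one side and
independence on the other show that the slash ideal is exactly the annihilator of the vacuum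
(`IsModelHom.mem_slashIdeal`), without a Poincaré–Birkhoff–Witt theorem.

Let `z` be an invariant that is central modulo the ideal. Commuting with the `y_r D_r` and with `H̃`
confines `z · vac` to the origin, so `z · vac = q · vac` for a polynomial `q`. Commuting with the
invariants `p D_r²` and using the translation symmetry of the model (`hom_modShift`), `q` is
unchanged by `X (some r) ↦ X (some r) - 2`, hence does not involve `X (some r)`. So `q` is a
polynomial in the `sl₂` Casimir operator, that is, in the value of the Casimir element. This value
is a nonconstant affine function of `X none`, which gives algebraic independence. -/

namespace Jacobi

variable {N : ℕ}

attribute [local instance] LieRing.ofAssociativeRing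

/-! ## Identities for the `2 × 2` minors of an inverse matrix -/

/-- The polynomial in the entries of `A` that is `det A` times the `2 × 2` minor of `A⁻¹` with rows
`r`, `u` and columns `s`, `t`. -/
def minorOf {C : Type*} [CommRing C] (A : Matrix (Fin N) (Fin N) C) (r u s t : Fin N) : C :=
  if s = t then 0 else ((A.updateRow s (Pi.single r 1)).updateRow t (Pi.single u 1)).det

theorem det_mul_minorOf {C : Type*} [CommRing C] (A : Matrix (Fin N) (Fin N) C) (r u s t : Fin N) :
    A.det * minorOf A r u s t
      = A.adjugate r s * A.adjugate u t - A.adjugate u s * A.adjugate r t := by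
  rw [minorOf]
  split_ifs with hst
  · subst hst
    rw [mul_zero, mul_comm, sub_self]
  · exact det_mul_minor_aux _ r u s t hst

theorem map_minorOf {C C' : Type*} [CommRing C] [CommRing C'] (g : C →+* C')
    (A : Matrix (Fin N) (Fin N) C) (r u s t : Fin N) :
    g (minorOf A r u s t) = minorOf (A.map g) r u s t := by
  rw [minorOf, minorOf]
  split_ifs with hst
  · exact map_zero g
  · rw [RingHom.map_det, RingHom.mapMatrix_apply, Matrix.map_updateRow, Matrix.map_updateRow]
    congr 2
    · congr 1
      funext j
      simp only [Function.comp, Pi.single_apply]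
      split_ifs <;> simp
    · funext j
      simp only [Function.comp, Pi.single_apply]
      split_ifs <;> simp

theorem map_adjugate_apply {C C' : Type*} [CommRing C] [CommRing C'] (g : C →+* C')
    (A : Matrix (Fin N) (Fin N) C) (r s : Fin N) :
    g (A.adjugate r s) = (A.map g).adjugate r s := by
  have := congrFun (congrFun (RingHom.map_adjugate g A) r) s
  simpa using this

/-- A polynomial identity between the entries of a matrix and its `minorOf` and adjugate entries can
be checked on the generic matrix, where the determinant may be cancelled. -/
theorem generic_matrix_induction {C : Type*} [CommRing C] (A : Matrix (Fin N) (Fin N) C)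
    (P : ∀ {C : Type} [CommRing C], Matrix (Fin N) (Fin N) C → C)
    (P' : Matrix (Fin N) (Fin N) C → C)
    (hP : ∀ g : MvPolynomial (Fin N × Fin N) ℤ →+* C, ∀ B, g (P B) = P' (B.map g))
    (h : ∀ B : Matrix (Fin N) (Fin N) (MvPolynomial (Fin N × Fin N) ℤ), B.det * P B = 0) :
    P' A = 0 := by
  have h0 : P (Matrix.mvPolynomialX (Fin N) (Fin N) ℤ) = 0 :=
    (mul_eq_zero.1 (h _)).resolve_left (Matrix.det_mvPolynomialX_ne_zero (Fin N) ℤ)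
  have hA : (Matrix.mvPolynomialX (Fin N) (Fin N) ℤ).map
      (MvPolynomial.eval₂Hom (Int.castRingHom C) fun p => A p.1 p.2) = A := by
    ext i j
    simp [Matrix.mvPolynomialX_apply]
  have h1 := hP (MvPolynomial.eval₂Hom (Int.castRingHom C) fun p => A p.1 p.2)
    (Matrix.mvPolynomialX (Fin N) (Fin N) ℤ)
  rw [h0, map_zero, hA] at h1
  exact h1.symm

section

variable {C : Type*} [CommRing C] (A : Matrix (Fin N) (Fin N) C)

theorem minorOf_swap_rows (r u s t : Fin N) : minorOf A u r s t = -minorOf A r u s t := by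
  have := generic_matrix_induction A (fun B => minorOf B u r s t + minorOf B r u s t)
    (fun B => minorOf B u r s t + minorOf B r u s t)
    (fun g B => by rw [map_add, map_minorOf, map_minorOf])
    (fun B => by rw [mul_add, det_mul_minorOf, det_mul_minorOf]; ring)
  linear_combination this

theorem minorOf_swap_cols (r u s t : Fin N) : minorOf A r u t s = -minorOf A r u s t := by
  have := generic_matrix_induction A (fun B => minorOf B r u t s + minorOf B r u s t)
    (fun B => minorOf B r u t s + minorOf B r u s t)
    (fun g B => by rw [map_add, map_minorOf, map_minorOf])
    (fun B => by rw [mul_add, det_mul_minorOf, det_mul_minorOf]; ring)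
  linear_combination this

theorem sum_mul_adjugate (p s : Fin N) :
    ∑ r, A p r * A.adjugate r s = if p = s then A.det else 0 := by
  have := congrFun (congrFun (Matrix.mul_adjugate A) p) s
  simpa [Matrix.mul_apply, Matrix.one_apply] using this

theorem sum_adjugate_mul (r p : Fin N) :
    ∑ s, A.adjugate r s * A s p = if r = p then A.det else 0 := by
  have := congrFun (congrFun (Matrix.adjugate_mul A) r) p
  simpa [Matrix.mul_apply, Matrix.one_apply] using this

/-- Multiplied by `det A`, the minor is a `2 × 2` determinant of adjugate entries, and contracting
row `p` of `A` with each adjugate turns it into a Kronecker delta times `det A`. The determinant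
cancels on the generic matrix. This is the contraction that occurs when `e_p` is moved past an `f_r`
in the quartic term. -/
theorem sum_mul_minorOf (p u s t : Fin N) :
    ∑ r, A p r * minorOf A r u s t
      = (if p = s then A.adjugate u t else 0) - if p = t then A.adjugate u s else 0 := by
  rw [← sub_eq_zero]
  refine generic_matrix_induction A (fun B => ∑ r, B p r * minorOf B r u s t
      - ((if p = s then B.adjugate u t else 0) - if p = t then B.adjugate u s else 0))
    (fun B => ∑ r, B p r * minorOf B r u s t
      - ((if p = s then B.adjugate u t else 0) - if p = t then B.adjugate u s else 0))
    (fun g B => ?_) (fun B => ?_)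
  · simp only [map_sub, map_sum, map_mul, map_minorOf, Matrix.map_apply, apply_ite g, map_zero,
      map_adjugate_apply]
  · have h1 := sum_mul_adjugate B p s
    have h2 := sum_mul_adjugate B p t
    have h3 : B.det * ∑ r, B p r * minorOf B r u s t
        = (∑ r, B p r * B.adjugate r s) * B.adjugate u t
          - B.adjugate u s * ∑ r, B p r * B.adjugate r t := by
      rw [Finset.mul_sum, Finset.mul_sum, Finset.sum_mul, ← Finset.sum_sub_distrib]
      refine Finset.sum_congr rfl fun r _ => ?_
      linear_combination B p r * det_mul_minorOf B r u s t
    rw [mul_sub, h3, h1, h2]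
    split_ifs <;> ring

/-- The column counterpart of `sum_mul_minorOf`, by the same cancellation. -/
theorem sum_minorOf_mul (r u s p : Fin N) :
    ∑ t, minorOf A r u s t * A t p
      = (if u = p then A.adjugate r s else 0) - if r = p then A.adjugate u s else 0 := by
  rw [← sub_eq_zero]
  refine generic_matrix_induction A (fun B => ∑ t, minorOf B r u s t * B t p
      - ((if u = p then B.adjugate r s else 0) - if r = p then B.adjugate u s else 0))
    (fun B => ∑ t, minorOf B r u s t * B t p
      - ((if u = p then B.adjugate r s else 0) - if r = p then B.adjugate u s else 0))
    (fun g B => ?_) (fun B => ?_)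
  · simp only [map_sub, map_sum, map_mul, map_minorOf, Matrix.map_apply, apply_ite g, map_zero,
      map_adjugate_apply]
  · have h1 := sum_adjugate_mul B u p
    have h2 := sum_adjugate_mul B r p
    have h3 : B.det * ∑ t, minorOf B r u s t * B t p
        = B.adjugate r s * (∑ t, B.adjugate u t * B t p)
          - B.adjugate u s * ∑ t, B.adjugate r t * B t p := by
      rw [Finset.mul_sum, Finset.mul_sum, Finset.mul_sum, ← Finset.sum_sub_distrib]
      refine Finset.sum_congr rfl fun t _ => ?_
      linear_combination B t p * det_mul_minorOf B r u s t
    rw [mul_sub, h3, h1, h2]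
    split_ifs <;> ring

end

/-! ## Centrality of the Casimir element -/

/-- The defining relations of the enveloping algebra of the Jacobi Lie algebra, in an algebra over
a commutative ring containing the images of the `Z_{rs}`, which form the matrix `A`. -/
structure JacobiRel {C R : Type*} [CommRing C] [Ring R] [Algebra C R]
    (A : Matrix (Fin N) (Fin N) C) (H E F : R) (e f : Fin N → R) : Prop where
  H_E : H * E = E * H + (2 : C) • E
  H_F : H * F = F * H - (2 : C) • F
  E_F : E * F = F * E + H
  H_e r : H * e r = e r * H + e r
  H_f r : H * f r = f r * H - f r
  E_e r : E * e r = e r * E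
  E_f r : E * f r = f r * E - e r
  F_e r : F * e r = e r * F - f r
  F_f r : F * f r = f r * F
  e_e r s : e r * e s = e s * e r
  f_f r s : f r * f s = f s * f r
  e_f r s : e r * f s = f s * e r - (2 * A r s) • (1 : R)

section Forms

variable {C R : Type*} [CommRing C] [Ring R] [Algebra C R] (A : Matrix (Fin N) (Fin N) C)

/-- The sum `∑ A_{rs} x_r y_s`. -/
def quad (x y : Fin N → R) : R := ∑ r, ∑ s, A r s • (x r * y s)

/-- The quartic sum that occurs in the Casimir element. -/
def quartic (e f : Fin N → R) : R :=
  ∑ r, ∑ s, ∑ t, ∑ u, minorOf A r u s t • (f r * f t * (e s * e u))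

/-- Four times the Casimir element. -/
def fourCasimir (H E F : R) (e f : Fin N → R) : R :=
  (4 * A.det) • (H * H + ((N : C) + 2) • H + (4 : C) • (F * E))
    - (4 : C) • (H * quad A.adjugate f e) - (4 : C) • (F * quad A.adjugate e e)
    + (4 : C) • (quad A.adjugate f f * E) - (2 * ((N : C) + 3)) • quad A.adjugate f e
    + quartic A e f

variable {A} {H E F : R} {e f : Fin N → R}

theorem quad_swap (hA : A.IsSymm) (x y : Fin N → R) :
    quad A x y = ∑ r, ∑ s, A r s • (x s * y r) := by
  rw [quad, Finset.sum_comm]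
  exact Finset.sum_congr rfl fun r _ => Finset.sum_congr rfl fun s _ => by rw [hA.apply]

theorem sum_delta (x : C) (g : Fin N → R) (p : Fin N) :
    ∑ s, (if p = s then x else 0) • g s = x • g p := by
  simp

namespace JacobiRel

theorem adjugate_symm (hA : A.IsSymm) : A.adjugate.IsSymm := by
  rw [Matrix.IsSymm, Matrix.adjugate_transpose, hA.eq]

/-- Moving `e_p` past `f_r` produces `-2 A_{pr}`, and the product of `A` with its adjugate collapses
the double sum to one term. -/
theorem e_mul_quad_fe (h : JacobiRel A H E F e f) (p : Fin N) :
    e p * quad A.adjugate f e = quad A.adjugate f e * e p - (2 * A.det) • e p := by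
  have h1 : ∀ r s, A.adjugate r s • (e p * (f r * e s))
      = A.adjugate r s • (f r * e s * e p) - (2 : C) • (A p r * A.adjugate r s) • e s := by
    intro r s
    rw [← mul_assoc, h.e_f, sub_mul, mul_assoc, h.e_e p s, smul_mul_assoc, one_mul, mul_assoc]
    module
  simp only [quad, Finset.mul_sum, Finset.sum_mul, mul_smul_comm, smul_mul_assoc, h1,
    Finset.sum_sub_distrib, ← Finset.smul_sum]
  rw [Finset.sum_comm (f := fun r s => (A p r * A.adjugate r s) • e s)]
  simp only [← Finset.sum_smul, sum_mul_adjugate, sum_delta]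
  module

theorem e_mul_quad_ee (h : JacobiRel A H E F e f) (p : Fin N) :
    e p * quad A.adjugate e e = quad A.adjugate e e * e p := by
  simp only [quad, Finset.mul_sum, Finset.sum_mul, mul_smul_comm, smul_mul_assoc]
  refine Finset.sum_congr rfl fun r _ => Finset.sum_congr rfl fun s _ => ?_
  rw [← mul_assoc, h.e_e p r, mul_assoc, h.e_e p s, mul_assoc]

theorem e_mul_quad_ff (h : JacobiRel A H E F e f) (hA : A.IsSymm) (p : Fin N) :
    e p * quad A.adjugate f f = quad A.adjugate f f * e p - (4 * A.det) • f p := by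
  have h1 : ∀ r s, A.adjugate r s • (e p * (f r * f s))
      = A.adjugate r s • (f r * f s * e p) - (2 : C) • (A p r * A.adjugate r s) • f s
        - (2 : C) • (A p s * A.adjugate s r) • f r := by
    intro r s
    rw [← mul_assoc, h.e_f, sub_mul, mul_assoc, h.e_f p s, mul_sub, smul_mul_assoc, one_mul,
      mul_assoc, mul_smul_comm, mul_one, (adjugate_symm hA).apply r s]
    module
  simp only [quad, Finset.mul_sum, Finset.sum_mul, mul_smul_comm, smul_mul_assoc, h1,
    Finset.sum_sub_distrib, ← Finset.smul_sum]
  rw [Finset.sum_comm (f := fun r s => (A p r * A.adjugate r s) • f s)]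
  simp only [← Finset.sum_smul, sum_mul_adjugate, sum_delta]
  module

/-- `e_p` contracts either with `f_r` or with `f_t`. The first contraction removes a row index of
the minor, the second a column index, and both leave the same difference of quadratic expressions,
which explains the factor `4 = 2 + 2`. -/
theorem e_mul_quartic (h : JacobiRel A H E F e f) (hA : A.IsSymm) (p : Fin N) :
    e p * quartic A e f = quartic A e f * e p - (4 : C) • (quad A.adjugate f e * e p)
      + (4 : C) • (f p * quad A.adjugate e e) := by
  have h1 : ∀ r s t u, minorOf A r u s t • (e p * (f r * f t * (e s * e u)))
      = minorOf A r u s t • (f r * f t * (e s * e u) * e p)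
        - (2 : C) • (A p r * minorOf A r u s t) • (f t * (e s * e u))
        - (2 : C) • (minorOf A r u s t * A t p) • (f r * (e s * e u)) := by
    intro r s t u
    have : e p * (f r * f t * (e s * e u)) = f r * f t * (e s * e u) * e p
        - (2 * A p r) • (f t * (e s * e u)) - (2 * A t p) • (f r * (e s * e u)) := by
      rw [← mul_assoc (e p) (f r * f t), ← mul_assoc (e p) (f r), h.e_f, sub_mul, sub_mul, mul_assoc (f r),
        h.e_f p t, mul_sub, sub_mul, smul_mul_assoc, one_mul, smul_mul_assoc, mul_smul_comm, mul_one, smul_mul_assoc,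
        hA.apply]
      have : f r * (f t * e p) * (e s * e u) = f r * f t * (e s * e u) * e p := by
        simp only [mul_assoc]
        rw [h.e_e u p, ← mul_assoc (e p), h.e_e p s, mul_assoc]
      rw [this]
      abel
    rw [this]
    module
  have h2 : ∑ r, ∑ s, ∑ t, ∑ u, (A p r * minorOf A r u s t) • (f t * (e s * e u))
      = quad A.adjugate f e * e p - f p * quad A.adjugate e e := by
    calc _ = ∑ s, ∑ t, ∑ u, (∑ r, A p r * minorOf A r u s t) • (f t * (e s * e u)) := by
          rw [Finset.sum_comm]
          refine Finset.sum_congr rfl fun s _ => ?_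
          rw [Finset.sum_comm]
          refine Finset.sum_congr rfl fun t _ => ?_
          rw [Finset.sum_comm]
          simp only [Finset.sum_smul]
      _ = ∑ t, ∑ u, A.adjugate u t • (f t * (e p * e u))
          - ∑ s, ∑ u, A.adjugate u s • (f p * (e s * e u)) := by
          simp only [sum_mul_minorOf, sub_smul, Finset.sum_sub_distrib]
          congr 1
          · simp [ite_smul, Finset.sum_ite_irrel]
          · simp [ite_smul, Finset.sum_ite_irrel]
      _ = _ := by
          simp only [quad, Finset.mul_sum, Finset.sum_mul, mul_smul_comm, smul_mul_assoc]
          congr 1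
          · refine Finset.sum_congr rfl fun r _ => Finset.sum_congr rfl fun s _ => ?_
            rw [h.e_e p s, mul_assoc, (adjugate_symm hA).apply]
          · refine Finset.sum_congr rfl fun r _ => Finset.sum_congr rfl fun s _ => ?_
            rw [(adjugate_symm hA).apply]
  have h3 : ∑ r, ∑ s, ∑ t, ∑ u, (minorOf A r u s t * A t p) • (f r * (e s * e u))
      = quad A.adjugate f e * e p - f p * quad A.adjugate e e := by
    calc _ = ∑ r, ∑ s, ∑ u, (∑ t, minorOf A r u s t * A t p) • (f r * (e s * e u)) := by
          refine Finset.sum_congr rfl fun r _ => Finset.sum_congr rfl fun s _ => ?_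
          rw [Finset.sum_comm]
          simp only [Finset.sum_smul]
      _ = ∑ r, ∑ s, A.adjugate r s • (f r * (e s * e p))
          - ∑ s, ∑ u, A.adjugate u s • (f p * (e s * e u)) := by
          simp only [sum_minorOf_mul, sub_smul, Finset.sum_sub_distrib]
          congr 1
          · simp [ite_smul]
          · simp [ite_smul, Finset.sum_ite_irrel]
      _ = _ := by
          simp only [quad, Finset.mul_sum, Finset.sum_mul, mul_smul_comm, smul_mul_assoc]
          congr 1
          · refine Finset.sum_congr rfl fun r _ => Finset.sum_congr rfl fun s _ => ?_
            rw [mul_assoc]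
          · refine Finset.sum_congr rfl fun r _ => Finset.sum_congr rfl fun s _ => ?_
            rw [(adjugate_symm hA).apply]
  have h4 : e p * quartic A e f = quartic A e f * e p
      - (2 : C) • (∑ r, ∑ s, ∑ t, ∑ u, (A p r * minorOf A r u s t) • (f t * (e s * e u)))
      - (2 : C) • (∑ r, ∑ s, ∑ t, ∑ u, (minorOf A r u s t * A t p) • (f r * (e s * e u))) := by
    simp only [quartic, Finset.mul_sum, Finset.sum_mul, mul_smul_comm, smul_mul_assoc, h1,
      Finset.sum_sub_distrib, ← Finset.smul_sum]
  rw [h4, h2, h3]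
  module

/-- The contributions of the types `H e_p`, `f_p E`, (quadratic in `f e`)` · e_p`, `f_p ·
`(quadratic in `e e`) and `e_p` cancel separately. The last type ties together the coefficients `N +
2` and `2(N + 3)`. -/
theorem e_commute_fourCasimir (h : JacobiRel A H E F e f) (hA : A.IsSymm) (p : Fin N) :
    e p * fourCasimir A H E F e f = fourCasimir A H E F e f * e p := by
  have hH : e p * H = H * e p - e p := by rw [h.H_e]; abel
  have hF : e p * F = F * e p + f p := by rw [h.F_e]; abel
  have hE : e p * E = E * e p := (h.E_e p).symm
  have hbE : e p * (quad A.adjugate f f * E)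
      = quad A.adjugate f f * E * e p - (4 * A.det) • (f p * E) := by
    rw [← mul_assoc, h.e_mul_quad_ff hA, sub_mul, mul_assoc, hE, smul_mul_assoc, mul_assoc]
  have hHc : e p * (H * quad A.adjugate f e) = H * quad A.adjugate f e * e p
      - (2 * A.det) • (H * e p) - quad A.adjugate f e * e p + (2 * A.det) • e p := by
    rw [← mul_assoc, hH, sub_mul, mul_assoc, h.e_mul_quad_fe, mul_sub, mul_smul_comm, mul_assoc]
    module
  have hFa : e p * (F * quad A.adjugate e e) = F * quad A.adjugate e e * e p
      + f p * quad A.adjugate e e := by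
    rw [← mul_assoc, hF, add_mul, mul_assoc, h.e_mul_quad_ee, mul_assoc]
  have hFE : e p * (F * E) = F * E * e p + f p * E := by
    rw [← mul_assoc, hF, add_mul, mul_assoc, hE, mul_assoc]
  have hHH : e p * (H * H) = H * H * e p - (2 : C) • (H * e p) + e p := by
    rw [← mul_assoc, hH, sub_mul, mul_assoc, hH, mul_sub, mul_assoc]
    module
  simp only [fourCasimir, mul_add, mul_sub, add_mul, sub_mul, mul_smul_comm, smul_mul_assoc,
    hbE, hHc, hFa, hFE, hHH, hH, h.e_mul_quad_fe, h.e_mul_quartic hA]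
  module

theorem E_mul_quad_ee (h : JacobiRel A H E F e f) (a : Matrix (Fin N) (Fin N) C) :
    E * quad a e e = quad a e e * E := by
  simp only [quad, Finset.mul_sum, Finset.sum_mul, mul_smul_comm, smul_mul_assoc]
  refine Finset.sum_congr rfl fun r _ => Finset.sum_congr rfl fun s _ => ?_
  rw [← mul_assoc, h.E_e, mul_assoc, h.E_e, mul_assoc]

theorem E_mul_quad_fe (h : JacobiRel A H E F e f) (a : Matrix (Fin N) (Fin N) C) :
    E * quad a f e = quad a f e * E - quad a e e := by
  simp only [quad, Finset.mul_sum, Finset.sum_mul, mul_smul_comm, smul_mul_assoc,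
    ← Finset.sum_sub_distrib]
  refine Finset.sum_congr rfl fun r _ => Finset.sum_congr rfl fun s _ => ?_
  rw [← mul_assoc, h.E_f, sub_mul, mul_assoc, h.E_e, mul_assoc, smul_sub]

/-- Normal ordering costs the trace of `a` against `2A`. For `a = adj A` this trace is `2N det A`,
the source of the `N`-dependence in the Casimir element. -/
theorem quad_ef (h : JacobiRel A H E F e f) {a : Matrix (Fin N) (Fin N) C} (ha : a.IsSymm) :
    quad a e f = quad a f e - (2 * ∑ r, ∑ s, a r s * A r s) • (1 : R) := by
  rw [quad_swap ha f e]
  simp only [quad, Finset.mul_sum, Finset.sum_smul, ← Finset.sum_sub_distrib]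
  refine Finset.sum_congr rfl fun r _ => Finset.sum_congr rfl fun s _ => ?_
  rw [h.e_f]
  module

theorem E_mul_quad_ff (h : JacobiRel A H E F e f) {a : Matrix (Fin N) (Fin N) C} (ha : a.IsSymm) :
    E * quad a f f = quad a f f * E - (2 : C) • quad a f e
      + (2 * ∑ r, ∑ s, a r s * A r s) • (1 : R) := by
  have : E * quad a f f = quad a f f * E - quad a e f - quad a f e := by
    simp only [quad, Finset.mul_sum, Finset.sum_mul, mul_smul_comm, smul_mul_assoc,
      ← Finset.sum_sub_distrib]
    refine Finset.sum_congr rfl fun r _ => Finset.sum_congr rfl fun s _ => ?_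
    rw [← mul_assoc, h.E_f, sub_mul, mul_assoc, h.E_f, mul_sub, mul_assoc]
    module
  rw [this, h.quad_ef ha]
  module

theorem F_mul_quad_ff (h : JacobiRel A H E F e f) (a : Matrix (Fin N) (Fin N) C) :
    F * quad a f f = quad a f f * F := by
  simp only [quad, Finset.mul_sum, Finset.sum_mul, mul_smul_comm, smul_mul_assoc]
  refine Finset.sum_congr rfl fun r _ => Finset.sum_congr rfl fun s _ => ?_
  rw [← mul_assoc, h.F_f, mul_assoc, h.F_f, mul_assoc]

theorem F_mul_quad_fe (h : JacobiRel A H E F e f) (a : Matrix (Fin N) (Fin N) C) :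
    F * quad a f e = quad a f e * F - quad a f f := by
  simp only [quad, Finset.mul_sum, Finset.sum_mul, mul_smul_comm, smul_mul_assoc,
    ← Finset.sum_sub_distrib]
  refine Finset.sum_congr rfl fun r _ => Finset.sum_congr rfl fun s _ => ?_
  rw [← mul_assoc, h.F_f, mul_assoc, h.F_e, mul_sub, mul_assoc, smul_sub]

theorem F_mul_quad_ee (h : JacobiRel A H E F e f) {a : Matrix (Fin N) (Fin N) C} (ha : a.IsSymm) :
    F * quad a e e = quad a e e * F - (2 : C) • quad a f e
      + (2 * ∑ r, ∑ s, a r s * A r s) • (1 : R) := by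
  have : F * quad a e e = quad a e e * F - quad a e f - quad a f e := by
    simp only [quad, Finset.mul_sum, Finset.sum_mul, mul_smul_comm, smul_mul_assoc,
      ← Finset.sum_sub_distrib]
    refine Finset.sum_congr rfl fun r _ => Finset.sum_congr rfl fun s _ => ?_
    rw [← mul_assoc, h.F_e, sub_mul, mul_assoc, h.F_e, mul_sub, mul_assoc]
    module
  rw [this, h.quad_ef ha]
  module

theorem H_mul_quad_ff (h : JacobiRel A H E F e f) (a : Matrix (Fin N) (Fin N) C) :
    H * quad a f f = quad a f f * H - (2 : C) • quad a f f := by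
  simp only [quad, Finset.mul_sum, Finset.sum_mul, mul_smul_comm, smul_mul_assoc,
    ← Finset.sum_sub_distrib, Finset.smul_sum]
  refine Finset.sum_congr rfl fun r _ => Finset.sum_congr rfl fun s _ => ?_
  rw [← mul_assoc, h.H_f, sub_mul, mul_assoc, h.H_f, mul_sub, mul_assoc]
  module

theorem sum_adjugate_mul_self (hA : A.IsSymm) :
    ∑ r, ∑ s, A.adjugate r s * A r s = N * A.det := by
  have : ∀ r, ∑ s, A.adjugate r s * A r s = A.det := by
    intro r
    have := sum_adjugate_mul A r r
    rw [if_pos rfl] at this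
    rw [← this]
    exact Finset.sum_congr rfl fun s _ => by rw [hA.apply]
  simp [this]

/-- A sum that is antisymmetric under the exchange of two indices vanishes (in any characteristic,
since the diagonal terms vanish as well). -/
theorem sum_minorOf_rows_zero (s t : Fin N) (g : Fin N → Fin N → R) (hg : ∀ r u, g r u = g u r) :
    ∑ r, ∑ u, minorOf A r u s t • g r u = 0 := by
  have hd : ∀ r, minorOf A r r s t = 0 := by
    intro r
    rw [minorOf]
    split_ifs with hst
    · rfl
    · refine Matrix.det_zero_of_row_eq hst ?_
      rw [Matrix.updateRow_self, Matrix.updateRow_ne hst, Matrix.updateRow_self]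
  rw [← Finset.sum_product']
  refine Finset.sum_involution (fun p _ => (p.2, p.1)) ?_ ?_ ?_ ?_
  · rintro ⟨r, u⟩ _
    simp only
    rw [minorOf_swap_rows, hg]
    module
  · rintro ⟨r, u⟩ _ hne heq
    simp only [Prod.mk.injEq] at heq
    apply hne
    simp only
    rw [heq.1, hd, zero_smul]
  · intros; simp
  · intros; rfl

theorem sum_minorOf_cols_zero (r u : Fin N) (g : Fin N → Fin N → R) (hg : ∀ s t, g s t = g t s) :
    ∑ s, ∑ t, minorOf A r u s t • g s t = 0 := by
  rw [← Finset.sum_product']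
  refine Finset.sum_involution (fun p _ => (p.2, p.1)) ?_ ?_ ?_ ?_
  · rintro ⟨s, t⟩ _
    simp only
    rw [minorOf_swap_cols, hg]
    module
  · rintro ⟨s, t⟩ _ hne heq
    simp only [Prod.mk.injEq] at heq
    apply hne
    simp only [minorOf]
    rw [if_pos heq.2, zero_smul]
  · intros; simp
  · intros; rfl

/-- `E` acts as the derivation `f ↦ -e`, `e ↦ 0`. The terms with three `e`s are symmetric in two
indices in which the minor is antisymmetric, so only the reordering term survives. -/
theorem E_mul_quartic (h : JacobiRel A H E F e f) (hA : A.IsSymm) :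
    E * quartic A e f = quartic A e f * E + (2 * (1 - (N : C))) • quad A.adjugate e e := by
  have h1 : ∀ r s t u, minorOf A r u s t • (E * (f r * f t * (e s * e u)))
      = minorOf A r u s t • (f r * f t * (e s * e u) * E)
        - minorOf A r u s t • (f t * (e r * (e s * e u)))
        - minorOf A r u s t • (f r * (e t * (e s * e u)))
        + (2 : C) • (minorOf A r u s t * A t r) • (e s * e u) := by
    intro r s t u
    have : E * (f r * f t * (e s * e u)) = f r * f t * (e s * e u) * E
        - f t * (e r * (e s * e u)) - f r * (e t * (e s * e u)) + (2 * A t r) • (e s * e u) := by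
      have hE : E * (e s * e u) = e s * e u * E := by
        rw [← mul_assoc, h.E_e, mul_assoc, h.E_e, mul_assoc]
      rw [← mul_assoc E (f r * f t), ← mul_assoc E (f r), h.E_f, sub_mul, sub_mul,
        mul_assoc (f r), h.E_f, h.e_f r t, mul_sub, sub_mul, sub_mul, smul_mul_assoc, one_mul,
        hA.apply r t, ← mul_assoc (f r) (f t), mul_assoc (f r * f t), hE]
      simp only [mul_assoc]
      abel
    rw [this]
    module
  have h2 : ∑ r, ∑ s, ∑ t, ∑ u, minorOf A r u s t • (f t * (e r * (e s * e u))) = 0 := by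
    rw [Finset.sum_comm]
    refine Finset.sum_eq_zero fun s _ => ?_
    rw [Finset.sum_comm]
    refine Finset.sum_eq_zero fun t _ => ?_
    refine sum_minorOf_rows_zero s t (fun r u => f t * (e r * (e s * e u))) fun r u => ?_
    rw [h.e_e s u, ← mul_assoc (e r), h.e_e r u, mul_assoc, h.e_e r s]
  have h3 : ∑ r, ∑ s, ∑ t, ∑ u, minorOf A r u s t • (f r * (e t * (e s * e u))) = 0 := by
    refine Finset.sum_eq_zero fun r _ => ?_
    rw [Finset.sum_congr rfl fun s _ => Finset.sum_comm, Finset.sum_comm]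
    refine Finset.sum_eq_zero fun u _ => ?_
    refine sum_minorOf_cols_zero r u (fun s t => f r * (e t * (e s * e u))) fun s t => ?_
    rw [← mul_assoc (e t), h.e_e t s, mul_assoc]
  -- The contraction over `t` gives `δ_{ur} adj_{rs} - adj_{us}`. Summing over `r` leaves `adj_{us}
  -- - N adj_{us}`, hence the factor `1 - N`.
  have h4 : ∑ r, ∑ s, ∑ t, ∑ u, (minorOf A r u s t * A t r) • (e s * e u)
      = (1 - (N : C)) • quad A.adjugate e e := by
    calc _ = ∑ r, ∑ s, ∑ u, (∑ t, minorOf A r u s t * A t r) • (e s * e u) := by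
          refine Finset.sum_congr rfl fun r _ => Finset.sum_congr rfl fun s _ => ?_
          rw [Finset.sum_comm]
          simp only [Finset.sum_smul]
      _ = ∑ s, ∑ u, (A.adjugate u s - N * A.adjugate u s) • (e s * e u) := by
          rw [Finset.sum_comm]
          refine Finset.sum_congr rfl fun s _ => ?_
          rw [Finset.sum_comm]
          refine Finset.sum_congr rfl fun u _ => ?_
          rw [← Finset.sum_smul]
          simp only [sum_minorOf_mul, Finset.sum_sub_distrib]
          simp
      _ = _ := by
          rw [quad, Finset.smul_sum]
          refine Finset.sum_congr rfl fun s _ => ?_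
          rw [Finset.smul_sum]
          refine Finset.sum_congr rfl fun u _ => ?_
          rw [(adjugate_symm hA).apply s u]
          module
  have h5 : E * quartic A e f = quartic A e f * E
      - (∑ r, ∑ s, ∑ t, ∑ u, minorOf A r u s t • (f t * (e r * (e s * e u))))
      - (∑ r, ∑ s, ∑ t, ∑ u, minorOf A r u s t • (f r * (e t * (e s * e u))))
      + (2 : C) • (∑ r, ∑ s, ∑ t, ∑ u, (minorOf A r u s t * A t r) • (e s * e u)) := by
    simp only [quartic, Finset.mul_sum, Finset.sum_mul, mul_smul_comm, smul_mul_assoc, h1,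
      Finset.sum_sub_distrib, Finset.sum_add_distrib, ← Finset.smul_sum]
  rw [h5, h2, h3, h4]
  module

theorem F_mul_quartic (h : JacobiRel A H E F e f) :
    F * quartic A e f = quartic A e f * F + (2 * (1 - (N : C))) • quad A.adjugate f f := by
  have h1 : ∀ r s t u, minorOf A r u s t • (F * (f r * f t * (e s * e u)))
      = minorOf A r u s t • (f r * f t * (e s * e u) * F)
        - minorOf A r u s t • (f r * f t * (f s * e u))
        - minorOf A r u s t • (f r * f t * (f u * e s))
        - (2 : C) • (minorOf A r u t s * A s u) • (f r * f t) := by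
    intro r s t u
    have : F * (f r * f t * (e s * e u)) = f r * f t * (e s * e u) * F
        - f r * f t * (f s * e u) - f r * f t * (f u * e s) + (2 * A s u) • (f r * f t) := by
      have hF : F * (f r * f t) = f r * f t * F := by
        rw [← mul_assoc, h.F_f, mul_assoc, h.F_f, mul_assoc]
      have he : F * (e s * e u) = e s * e u * F - f s * e u - f u * e s + (2 * A s u) • 1 := by
        rw [← mul_assoc, h.F_e, sub_mul, mul_assoc, h.F_e, mul_sub, h.e_f]
        simp only [mul_assoc]
        abel
      rw [← mul_assoc F, hF, mul_assoc (f r * f t), he]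
      simp only [mul_add, mul_sub, mul_smul_comm, mul_one, mul_assoc]
    -- The columns are exchanged so that the contracted index `s` is in last position, as
    -- `sum_minorOf_mul` requires; this accounts for the sign.
    rw [this, minorOf_swap_cols A r u s t]
    module
  have h2 : ∑ r, ∑ s, ∑ t, ∑ u, minorOf A r u s t • (f r * f t * (f s * e u)) = 0 := by
    refine Finset.sum_eq_zero fun r _ => ?_
    rw [Finset.sum_congr rfl fun s _ => Finset.sum_comm, Finset.sum_comm]
    refine Finset.sum_eq_zero fun u _ => ?_
    refine sum_minorOf_cols_zero r u (fun s t => f r * f t * (f s * e u)) fun s t => ?_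
    rw [mul_assoc, mul_assoc, ← mul_assoc (f t), h.f_f t s, mul_assoc (f s)]
  have h3 : ∑ r, ∑ s, ∑ t, ∑ u, minorOf A r u s t • (f r * f t * (f u * e s)) = 0 := by
    rw [Finset.sum_comm]
    refine Finset.sum_eq_zero fun s _ => ?_
    rw [Finset.sum_comm]
    refine Finset.sum_eq_zero fun t _ => ?_
    refine sum_minorOf_rows_zero s t (fun r u => f r * f t * (f u * e s)) fun r u => ?_
    rw [h.f_f r t, mul_assoc, ← mul_assoc (f r), h.f_f r u, mul_assoc (f u), ← mul_assoc (f t),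
      h.f_f t u, mul_assoc (f u), ← mul_assoc (f u)  (f t)]
  have h4 : ∑ r, ∑ s, ∑ t, ∑ u, (minorOf A r u t s * A s u) • (f r * f t)
      = ((N : C) - 1) • quad A.adjugate f f := by
    calc _ = ∑ r, ∑ t, ∑ u, (∑ s, minorOf A r u t s * A s u) • (f r * f t) := by
          refine Finset.sum_congr rfl fun r _ => ?_
          rw [Finset.sum_comm]
          refine Finset.sum_congr rfl fun t _ => ?_
          rw [Finset.sum_comm]
          simp only [Finset.sum_smul]
      _ = ∑ r, ∑ t, (N * A.adjugate r t - A.adjugate r t) • (f r * f t) := by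
          refine Finset.sum_congr rfl fun r _ => Finset.sum_congr rfl fun t _ => ?_
          rw [← Finset.sum_smul]
          simp only [sum_minorOf_mul, Finset.sum_sub_distrib]
          simp
      _ = _ := by
          rw [quad, Finset.smul_sum]
          refine Finset.sum_congr rfl fun s _ => ?_
          rw [Finset.smul_sum]
          refine Finset.sum_congr rfl fun u _ => ?_
          module
  have h5 : F * quartic A e f = quartic A e f * F
      - (∑ r, ∑ s, ∑ t, ∑ u, minorOf A r u s t • (f r * f t * (f s * e u)))
      - (∑ r, ∑ s, ∑ t, ∑ u, minorOf A r u s t • (f r * f t * (f u * e s)))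
      - (2 : C) • (∑ r, ∑ s, ∑ t, ∑ u, (minorOf A r u t s * A s u) • (f r * f t)) := by
    simp only [quartic, Finset.mul_sum, Finset.sum_mul, mul_smul_comm, smul_mul_assoc, h1,
      Finset.sum_sub_distrib, ← Finset.smul_sum]
  rw [h5, h2, h3, h4]
  module

theorem E_commute_fourCasimir (h : JacobiRel A H E F e f) (hA : A.IsSymm) :
    E * fourCasimir A H E F e f = fourCasimir A H E F e f * E := by
  have hH : E * H = H * E - (2 : C) • E := by rw [h.H_E]; abel
  have hff := h.E_mul_quad_ff (adjugate_symm hA)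
  rw [sum_adjugate_mul_self hA] at hff
  have hbE : E * (quad A.adjugate f f * E) = quad A.adjugate f f * E * E
      - (2 : C) • (quad A.adjugate f e * E) + (2 * (N * A.det)) • E := by
    rw [← mul_assoc, hff, add_mul, sub_mul, smul_mul_assoc, smul_mul_assoc, one_mul]
  have hHc : E * (H * quad A.adjugate f e) = H * quad A.adjugate f e * E
      - H * quad A.adjugate e e - (2 : C) • (quad A.adjugate f e * E)
      + (2 : C) • quad A.adjugate e e := by
    rw [← mul_assoc, hH, sub_mul, mul_assoc, smul_mul_assoc, h.E_mul_quad_fe, mul_sub, mul_assoc]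
    module
  have hFa : E * (F * quad A.adjugate e e) = F * quad A.adjugate e e * E
      + H * quad A.adjugate e e := by
    rw [← mul_assoc, h.E_F, add_mul, mul_assoc, h.E_mul_quad_ee, mul_assoc]
  have hFE : E * (F * E) = F * E * E + H * E := by rw [← mul_assoc, h.E_F, add_mul]
  have hHH : E * (H * H) = H * H * E - (4 : C) • (H * E) + (4 : C) • E := by
    rw [← mul_assoc, hH, sub_mul, mul_assoc, smul_mul_assoc, hH, mul_sub, mul_smul_comm, mul_assoc]
    module
  simp only [fourCasimir, mul_add, mul_sub, add_mul, sub_mul, mul_smul_comm, smul_mul_assoc,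
    hbE, hHc, hFa, hFE, hHH, hH, h.E_mul_quad_fe, h.E_mul_quartic hA]
  module

theorem F_commute_fourCasimir (h : JacobiRel A H E F e f) (hA : A.IsSymm) :
    F * fourCasimir A H E F e f = fourCasimir A H E F e f * F := by
  have hH : F * H = H * F + (2 : C) • F := by rw [h.H_F]; abel
  have hE : F * E = E * F - H := by rw [h.E_F]; abel
  have hEF : E * F = F * E + H := h.E_F
  have hee := h.F_mul_quad_ee (adjugate_symm hA)
  rw [sum_adjugate_mul_self hA] at hee
  have hbE : F * (quad A.adjugate f f * E) = quad A.adjugate f f * E * F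
      - H * quad A.adjugate f f - (2 : C) • quad A.adjugate f f := by
    rw [← mul_assoc, h.F_mul_quad_ff, mul_assoc, hE, mul_sub, h.H_mul_quad_ff, mul_assoc]
    abel
  have hHc : F * (H * quad A.adjugate f e) = H * quad A.adjugate f e * F
      - H * quad A.adjugate f f + (2 : C) • (F * quad A.adjugate f e) := by
    rw [← mul_assoc, hH, add_mul, mul_assoc, smul_mul_assoc, h.F_mul_quad_fe, mul_sub, mul_assoc]
  have hFa : F * (F * quad A.adjugate e e) = F * quad A.adjugate e e * F
      - (2 : C) • (F * quad A.adjugate f e) + (2 * (N * A.det)) • F := by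
    conv_lhs => rw [hee]
    rw [mul_add, mul_sub, mul_smul_comm, mul_smul_comm, mul_one, mul_assoc]
  have hFE : F * (F * E) = F * E * F - H * F - (2 : C) • F := by
    rw [mul_assoc F E F, hEF, mul_add, hH]
    module
  have hHH : F * (H * H) = H * H * F + (4 : C) • (H * F) + (4 : C) • F := by
    rw [← mul_assoc, hH, add_mul, mul_assoc, smul_mul_assoc, hH, mul_add, mul_smul_comm, mul_assoc]
    module
  simp only [fourCasimir, mul_add, mul_sub, add_mul, sub_mul, mul_smul_comm, smul_mul_assoc,
    hbE, hHc, hFa, hFE, hHH, hH, h.F_mul_quad_fe, h.F_mul_quartic]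
  module

end JacobiRel

end Forms

/-! ## Generators of the enveloping algebra -/

@[simp] theorem sum_M {α : Type*} (s : Finset α) (g : α → Alg N) :
    (∑ i ∈ s, g i).M = ∑ i ∈ s, (g i).M :=
  map_sum (⟨⟨Alg.M, rfl⟩, fun _ _ => rfl⟩ : Alg N →+ _) g s

@[simp] theorem sum_X {α : Type*} (s : Finset α) (g : α → Alg N) :
    (∑ i ∈ s, g i).X = ∑ i ∈ s, (g i).X :=
  map_sum (⟨⟨Alg.X, rfl⟩, fun _ _ => rfl⟩ : Alg N →+ _) g s

@[simp] theorem sum_κ {α : Type*} (s : Finset α) (g : α → Alg N) :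
    (∑ i ∈ s, g i).κ = ∑ i ∈ s, (g i).κ :=
  map_sum (⟨⟨Alg.κ, rfl⟩, fun _ _ => rfl⟩ : Alg N →+ _) g s

theorem symm_matrix_eq_sum (A : Matrix (Fin N) (Fin N) ℂ) (hA : A.IsSymm) :
    ∑ r, ∑ s, A r s • (1 / 2 : ℂ) • (Matrix.single r s (1 : ℂ) + Matrix.single s r 1) = A := by
  have h1 : ∑ r, ∑ s, A r s • Matrix.single r s (1 : ℂ) = A := by
    conv_rhs => rw [Matrix.matrix_eq_sum_single A]
    simp
  have h2 : ∑ r, ∑ s, A r s • Matrix.single s r (1 : ℂ) = A := by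
    rw [Finset.sum_comm]
    conv_rhs => rw [← h1]
    refine Finset.sum_congr rfl fun r _ => Finset.sum_congr rfl fun s _ => by rw [hA.apply]
  have h3 : ∀ r s, A r s • (1 / 2 : ℂ) • (Matrix.single r s (1 : ℂ) + Matrix.single s r 1)
      = (1 / 2 : ℂ) • (A r s • Matrix.single r s (1 : ℂ))
        + (1 / 2 : ℂ) • (A r s • Matrix.single s r (1 : ℂ)) := fun r s => by module
  simp only [h3, Finset.sum_add_distrib, ← Finset.smul_sum, h1, h2]
  module

theorem ι_smul (c : ℂ) (x : Alg N) : ι (c • x) = c • ι x :=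
  (ι (N := N) : Alg N →ₗ[ℂ] U N).map_smul c x

theorem alg_eq_sum (x : Alg N) :
    x = x.M 0 0 • H N + x.M 0 1 • E N + x.M 1 0 • F N + ∑ r, (x.X r 0 • f r + x.X r 1 • e r)
      + ∑ r, ∑ s, x.κ r s • Z r s := by
  apply alg_ext
  · ext i j
    fin_cases i <;> fin_cases j <;> simp [H, E, F, e, f, Z, M_11]
  · ext i j
    fin_cases j <;> simp [H, E, F, e, f, Z, Matrix.sum_apply, Matrix.single_apply]
  · simp only [add_κ, sum_κ, smul_κ, Z, mk_κ, symm_matrix_eq_sum x.κ (symm_κ x)]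
    simp [H, E, F, e, f]

/-- An induction principle for the enveloping algebra. -/
theorem U_mul_induction {P : U N → Prop} (h1 : P 1) (hadd : ∀ u v, P u → P v → P (u + v))
    (hsmul : ∀ (c : ℂ) u, P u → P (c • u)) (hι : ∀ x u, P u → P (ι x * u)) (u : U N) : P u := by
  -- The Lie algebra map into the generated subalgebra lifts to the enveloping algebra. Followed by
  -- the inclusion it agrees with the identity on generators, so by uniqueness it is the identity
  -- and the subalgebra is everything.
  have htop : (⊤ : Subalgebra ℂ (U N)) = Algebra.adjoin ℂ (Set.range (ι (N := N))) := by
    symm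
    rw [eq_top_iff]
    let C := Algebra.adjoin ℂ (Set.range (ι (N := N)))
    let g : Alg N →ₗ⁅ℂ⁆ C :=
      { toFun := fun x => ⟨ι x, Algebra.subset_adjoin ⟨x, rfl⟩⟩
        map_add' := fun x y => Subtype.ext (by simp)
        map_smul' := fun c x => Subtype.ext (by simp)
        map_lie' := fun {x y} => Subtype.ext (by
          simp [LieRing.of_associative_ring_bracket]) }
    have h : C.val.comp (UniversalEnvelopingAlgebra.lift ℂ g) = AlgHom.id ℂ (U N) := by
      apply UniversalEnvelopingAlgebra.hom_ext
      ext x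
      change C.val (UniversalEnvelopingAlgebra.lift ℂ g (UniversalEnvelopingAlgebra.ι ℂ x)) = ι x
      rw [UniversalEnvelopingAlgebra.lift_ι_apply]
      rfl
    intro u _
    have := congrArg (fun p : U N →ₐ[ℂ] U N => p u) h
    simp only [AlgHom.comp_apply, AlgHom.id_apply] at this
    rw [← this]
    exact (UniversalEnvelopingAlgebra.lift ℂ g u).2
  have key : ∀ u ∈ Algebra.adjoin ℂ (Set.range (ι (N := N))), ∀ v, P v → P (u * v) := by
    intro u hu
    induction hu using Algebra.adjoin_induction with
    | mem x hx => obtain ⟨x, rfl⟩ := hx; exact hι x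
    | algebraMap c => intro v hv; rw [← Algebra.smul_def]; exact hsmul c v hv
    | add x y _ _ hx hy => intro v hv; rw [add_mul]; exact hadd _ _ (hx v hv) (hy v hv)
    | mul x y _ _ hx hy => intro v hv; rw [mul_assoc]; exact hx _ (hy _ hv)
  have := key u (htop ▸ Algebra.mem_top) 1 h1
  rwa [mul_one] at this

theorem mem_center_of_commute {u : U N} (h : ∀ x, ι x * u = u * ι x) :
    u ∈ Subalgebra.center ℂ (U N) := by
  rw [Subalgebra.mem_center_iff]
  intro b
  refine U_mul_induction (P := fun b => b * u = u * b) (by simp) ?_ ?_ ?_ b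
  · intro x y hx hy; rw [add_mul, mul_add, hx, hy]
  · intro c x hx; rw [smul_mul_assoc, mul_smul_comm, hx]
  · intro x v hv; rw [mul_assoc, hv, ← mul_assoc, h, mul_assoc]

/-! Brackets of the basis elements -/

theorem H_lie_E : ⁅H N, E N⁆ = (2 : ℂ) • E N := by
  apply alg_ext
  · ext i j
    fin_cases i <;> fin_cases j <;> simp [H, E]; norm_num
  · simp [H, E]
  · simp [H, E]

theorem H_lie_F : ⁅H N, F N⁆ = -((2 : ℂ) • F N) := by
  apply alg_ext
  · ext i j
    fin_cases i <;> fin_cases j <;> simp [H, F]; norm_num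
  · simp [H, F]
  · simp [H, F]

theorem E_lie_F : ⁅E N, F N⁆ = H N := by
  apply alg_ext
  · ext i j
    fin_cases i <;> fin_cases j <;> simp [H, E, F]
  · simp [E, F, H]
  · simp [E, F, H]

theorem E_lie_e (r : Fin N) : ⁅E N, e r⁆ = 0 := by
  apply alg_ext
  · simp [E, e]
  · ext i j
    fin_cases j <;> simp [E, e, Matrix.single_apply, Matrix.mul_apply, Fin.sum_univ_two]
  · simp [E, e]

theorem E_lie_f (r : Fin N) : ⁅E N, f r⁆ = -e r := by
  apply alg_ext
  · simp [E, e, f]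
  · ext i j
    fin_cases j <;> simp [E, e, f, Matrix.single_apply, Matrix.mul_apply, Fin.sum_univ_two]
  · simp [E, e, f]

theorem F_lie_e (r : Fin N) : ⁅F N, e r⁆ = -f r := by
  apply alg_ext
  · simp [F, e, f]
  · ext i j
    fin_cases j <;> simp [F, e, f, Matrix.single_apply, Matrix.mul_apply, Fin.sum_univ_two]
  · simp [F, e, f]

theorem F_lie_f (r : Fin N) : ⁅F N, f r⁆ = 0 := by
  apply alg_ext
  · simp [F, f]
  · ext i j
    fin_cases j <;> simp [F, f, Matrix.single_apply, Matrix.mul_apply, Fin.sum_univ_two]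
  · simp [F, f]

theorem e_lie_e (r s : Fin N) : ⁅e r, e s⁆ = 0 := by
  apply alg_ext
  · simp [e]
  · simp [e]
  · ext i j
    simp [e, J]

theorem f_lie_f (r s : Fin N) : ⁅f r, f s⁆ = 0 := by
  apply alg_ext
  · simp [f]
  · simp [f]
  · ext i j
    simp [f, J]

/-- The relations of the enveloping algebra hold in its image under any homomorphism, with the
images of the `Z_{rs}` as coefficients. -/
theorem jacobiRel_of_hom {C R : Type*} [CommRing C] [Ring R] [Algebra C R] [Algebra ℂ R]
    (θ : U N →ₐ[ℂ] R) (A : Matrix (Fin N) (Fin N) C)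
    (hZ : ∀ r s, θ (ι (Z r s)) = algebraMap C R (A r s)) :
    JacobiRel A (θ (ι (H N))) (θ (ι (E N))) (θ (ι (F N))) (fun r => θ (ι (e r)))
      (fun r => θ (ι (f r))) := by
  have lie (x y : Alg N) : θ (ι x) * θ (ι y) = θ (ι y) * θ (ι x) + θ (ι ⁅x, y⁆) := by
    rw [← map_mul, ι_mul, map_add, map_mul]
  have h2 (x : R) : (2 : C) • x = (2 : ℂ) • x := by
    rw [two_smul, two_smul]
  constructor
  · rw [lie, H_lie_E, ι_smul, map_smul, h2]
  · rw [lie, H_lie_F, map_neg, map_neg, ι_smul, map_smul, h2, sub_eq_add_neg]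
  · rw [lie, E_lie_F]
  · intro r; rw [lie, H_lie_e]
  · intro r; rw [lie, H_lie_f, map_neg, map_neg, sub_eq_add_neg]
  · intro r; rw [lie, E_lie_e, map_zero, map_zero, add_zero]
  · intro r; rw [lie, E_lie_f, map_neg, map_neg, sub_eq_add_neg]
  · intro r; rw [lie, F_lie_e, map_neg, map_neg, sub_eq_add_neg]
  · intro r; rw [lie, F_lie_f, map_zero, map_zero, add_zero]
  · intro r s; rw [lie, e_lie_e, map_zero, map_zero, add_zero]
  · intro r s; rw [lie, f_lie_f, map_zero, map_zero, add_zero]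
  · intro r s
    rw [lie, e_lie_f, ι_smul, map_smul, hZ, mul_smul, ← Algebra.algebraMap_eq_smul_one,
      h2, neg_smul, sub_eq_add_neg]

variable (N) in
/-- The enveloping algebra as an algebra over its center. -/
noncomputable abbrev centerAlgebra : Algebra (Subalgebra.center ℂ (U N)) (U N) :=
  (Subalgebra.center ℂ (U N)).val.toRingHom.toAlgebra' fun c x =>
    (Subalgebra.mem_center_iff.1 c.2 x).symm

/-- The factor four removes the denominators of the Casimir element, so that the commutator
computation runs over any commutative ring `C`. Here the integer coefficients, taken in `C`, are
identified with complex ones; this applies with `C` the centre of the enveloping algebra. -/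
theorem fourCasimir_eq {C R : Type*} [CommRing C] [Ring R] [Algebra C R] [Algebra ℂ R]
    (A : Matrix (Fin N) (Fin N) C) (H E F : R) (e f : Fin N → R) :
    fourCasimir A H E F e f = (4 : ℂ) •
      (algebraMap C R A.det * (H * H + ((N : ℂ) + 2) • H + (4 : ℂ) • (F * E))
        - H * (∑ r, ∑ s, algebraMap C R (A.adjugate r s) * (f r * e s))
        - F * (∑ r, ∑ s, algebraMap C R (A.adjugate r s) * (e r * e s))
        + (∑ r, ∑ s, algebraMap C R (A.adjugate r s) * (f r * f s)) * E
        - (((N : ℂ) + 3) / 2) • (∑ r, ∑ s, algebraMap C R (A.adjugate r s) * (f r * e s))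
        + (1 / 4 : ℂ) • (∑ r, ∑ s, ∑ t, ∑ u,
          algebraMap C R (minorOf A r u s t) * (f r * f t * (e s * e u)))) := by
  have hnat (n : ℕ) (u : R) : (n : C) • u = (n : ℂ) • u := by
    rw [Nat.cast_smul_eq_nsmul, Nat.cast_smul_eq_nsmul]
  have h4 (u : R) : (4 : C) • u = (4 : ℂ) • u := by exact_mod_cast hnat 4 u
  have h23 (u : R) : (2 * ((N : C) + 3)) • u = (2 * ((N : ℂ) + 3)) • u := by
    exact_mod_cast hnat (2 * (N + 3)) u
  have hN2 (u : R) : ((N : C) + 2) • u = ((N : ℂ) + 2) • u := by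
    exact_mod_cast hnat (N + 2) u
  rw [fourCasimir, h23, mul_smul]
  simp only [quad, quartic, h4, hN2]
  simp only [Algebra.smul_def (R := C)]
  module

/-- The Lie algebra elements commuting with a given element are closed under brackets. As `f_r =
-[F, e_r]` and `H = [E, F]`, the commutators with `e_r`, `E` and `F` suffice besides the central
`Z_{rs}`. -/
theorem casimir_mem_center : casimir N ∈ Subalgebra.center ℂ (U N) := by
  let _ := centerAlgebra N
  have hrel := jacobiRel_of_hom (AlgHom.id ℂ (U N)) (matZ N) fun _ _ => rfl
  simp only [AlgHom.id_apply] at hrel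
  have hA : (matZ N).IsSymm := symm_matZ
  have hfour : fourCasimir (matZ N) (ι (H N)) (ι (E N)) (ι (F N))
      (fun r => ι (e r)) (fun r => ι (f r)) = (4 : ℂ) • casimir N := fourCasimir_eq ..
  have hcomm (x : U N) : x * casimir N = casimir N * x ↔
      x * ((4 : ℂ) • casimir N) = ((4 : ℂ) • casimir N) * x := by
    rw [mul_smul_comm, smul_mul_assoc]
    exact (smul_right_injective (U N) (by norm_num : (4 : ℂ) ≠ 0)).eq_iff.symm
  have he (r : Fin N) : ι (e r) * casimir N = casimir N * ι (e r) := by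
    rw [hcomm, ← hfour]; exact hrel.e_commute_fourCasimir hA r
  have hE : ι (E N) * casimir N = casimir N * ι (E N) := by
    rw [hcomm, ← hfour]; exact hrel.E_commute_fourCasimir hA
  have hF : ι (F N) * casimir N = casimir N * ι (F N) := by
    rw [hcomm, ← hfour]; exact hrel.F_commute_fourCasimir hA
  have hlie {x y : Alg N} (hx : ι x * casimir N = casimir N * ι x)
      (hy : ι y * casimir N = casimir N * ι y) :
      ι ⁅x, y⁆ * casimir N = casimir N * ι ⁅x, y⁆ := by
    rw [LieHom.map_lie, LieRing.of_associative_ring_bracket, sub_mul, mul_sub, mul_assoc, hy,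
      mul_assoc, hx, ← mul_assoc, ← mul_assoc, hx, hy, mul_assoc, mul_assoc]
  have hf (r : Fin N) : ι (f r) * casimir N = casimir N * ι (f r) := by
    have := hlie hF (he r)
    rw [F_lie_e] at this
    simpa using this
  have hH : ι (H N) * casimir N = casimir N * ι (H N) := by
    have := hlie hE hF
    rwa [E_lie_F] at this
  refine mem_center_of_commute fun x => ?_
  rw [alg_eq_sum x]
  simp only [map_add, map_sum, ι_smul, add_mul, mul_add, Finset.sum_mul, Finset.mul_sum,
    smul_mul_assoc, mul_smul_comm, he, hE, hF, hf, hH]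
  refine congrArg _ ?_
  refine Finset.sum_congr rfl fun r _ => Finset.sum_congr rfl fun s _ => ?_
  rw [Subalgebra.mem_center_iff.1 (ι_mem_center (Z_lie r s))]

/-! ## Homomorphisms out of the enveloping algebra -/

section Lift

variable {R : Type*} [Ring R] [Algebra ℂ R] {c : Matrix (Fin N) (Fin N) ℂ} {H' E' F' : R}
  {e' f' : Fin N → R}

/-- The linear extension of prescribed images of the basis elements. -/
noncomputable def liftFun (c : Matrix (Fin N) (Fin N) ℂ) (H' E' F' : R) (e' f' : Fin N → R)
    (x : Alg N) : R :=
  x.M 0 0 • H' + x.M 0 1 • E' + x.M 1 0 • F' + Fintype.linearCombination ℂ f' (fun r => x.X r 0)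
    + Fintype.linearCombination ℂ e' (fun r => x.X r 1)
    + (∑ r, ∑ s, c r s * x.κ r s) • (1 : R)

namespace JacobiRel

/-- Bilinear extension of the relations between basis elements. Grouping the `e_r` and the `f_r`
into linear combinations leaves only the basic kinds of product to reorder. -/
theorem liftFun_lie (h : JacobiRel c H' E' F' e' f') (hc : c.IsSymm) (x y : Alg N) :
    liftFun c H' E' F' e' f' ⁅x, y⁆ =
      liftFun c H' E' F' e' f' x * liftFun c H' E' F' e' f' y
        - liftFun c H' E' F' e' f' y * liftFun c H' E' F' e' f' x := by
  have He (a : Fin N → ℂ) : H' * Fintype.linearCombination ℂ e' a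
      = Fintype.linearCombination ℂ e' a * H' + Fintype.linearCombination ℂ e' a := by
    simp only [Fintype.linearCombination_apply, Finset.mul_sum, Finset.sum_mul, mul_smul_comm,
      smul_mul_assoc, h.H_e, smul_add, Finset.sum_add_distrib]
  have Hf (a : Fin N → ℂ) : H' * Fintype.linearCombination ℂ f' a
      = Fintype.linearCombination ℂ f' a * H' - Fintype.linearCombination ℂ f' a := by
    simp only [Fintype.linearCombination_apply, Finset.mul_sum, Finset.sum_mul, mul_smul_comm,
      smul_mul_assoc, h.H_f, smul_sub, Finset.sum_sub_distrib]
  have Ee (a : Fin N → ℂ) : E' * Fintype.linearCombination ℂ e' a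
      = Fintype.linearCombination ℂ e' a * E' := by
    simp only [Fintype.linearCombination_apply, Finset.mul_sum, Finset.sum_mul, mul_smul_comm,
      smul_mul_assoc, h.E_e]
  have Ef (a : Fin N → ℂ) : E' * Fintype.linearCombination ℂ f' a
      = Fintype.linearCombination ℂ f' a * E' - Fintype.linearCombination ℂ e' a := by
    simp only [Fintype.linearCombination_apply, Finset.mul_sum, Finset.sum_mul, mul_smul_comm,
      smul_mul_assoc, h.E_f, smul_sub, Finset.sum_sub_distrib]
  have Fe (a : Fin N → ℂ) : F' * Fintype.linearCombination ℂ e' a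
      = Fintype.linearCombination ℂ e' a * F' - Fintype.linearCombination ℂ f' a := by
    simp only [Fintype.linearCombination_apply, Finset.mul_sum, Finset.sum_mul, mul_smul_comm,
      smul_mul_assoc, h.F_e, smul_sub, Finset.sum_sub_distrib]
  have Ff (a : Fin N → ℂ) : F' * Fintype.linearCombination ℂ f' a
      = Fintype.linearCombination ℂ f' a * F' := by
    simp only [Fintype.linearCombination_apply, Finset.mul_sum, Finset.sum_mul, mul_smul_comm,
      smul_mul_assoc, h.F_f]
  have ee (a b : Fin N → ℂ) :
      Fintype.linearCombination ℂ e' a * Fintype.linearCombination ℂ e' b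
        = Fintype.linearCombination ℂ e' b * Fintype.linearCombination ℂ e' a := by
    rw [Fintype.linearCombination_apply, Fintype.linearCombination_apply, Finset.sum_mul_sum,
      Finset.sum_mul_sum, Finset.sum_comm]
    refine Finset.sum_congr rfl fun r _ => Finset.sum_congr rfl fun s _ => ?_
    rw [smul_mul_smul_comm, smul_mul_smul_comm, h.e_e, mul_comm]
  have ff (a b : Fin N → ℂ) :
      Fintype.linearCombination ℂ f' a * Fintype.linearCombination ℂ f' b
        = Fintype.linearCombination ℂ f' b * Fintype.linearCombination ℂ f' a := by
    rw [Fintype.linearCombination_apply, Fintype.linearCombination_apply, Finset.sum_mul_sum,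
      Finset.sum_mul_sum, Finset.sum_comm]
    refine Finset.sum_congr rfl fun r _ => Finset.sum_congr rfl fun s _ => ?_
    rw [smul_mul_smul_comm, smul_mul_smul_comm, h.f_f, mul_comm]
  have ef (a b : Fin N → ℂ) :
      Fintype.linearCombination ℂ e' a * Fintype.linearCombination ℂ f' b
        = Fintype.linearCombination ℂ f' b * Fintype.linearCombination ℂ e' a
          - (2 * ∑ r, ∑ s, c r s * (b r * a s)) • (1 : R) := by
    rw [Fintype.linearCombination_apply, Fintype.linearCombination_apply, Finset.sum_mul_sum,
      Finset.sum_mul_sum, Finset.sum_comm, Finset.mul_sum, Finset.sum_smul,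
      ← Finset.sum_sub_distrib]
    refine Finset.sum_congr rfl fun r _ => ?_
    rw [Finset.mul_sum, Finset.sum_smul, ← Finset.sum_sub_distrib]
    refine Finset.sum_congr rfl fun s _ => ?_
    rw [smul_mul_smul_comm, smul_mul_smul_comm, h.e_f, hc.apply]
    module
  -- The cocycle has two transposed halves that `c`, being symmetric, does not distinguish. They add
  -- up to the factor `2` in the relation between `e_r` and `f_s`.
  have hκ : (∑ r, ∑ s, c r s * ⁅x, y⁆.κ r s)
      = 2 * (∑ r, ∑ s, c r s * (x.X r 0 * y.X s 1)) - 2 * ∑ r, ∑ s, c r s * (y.X r 0 * x.X s 1) := by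
    have h1 : ∀ r s, c r s * ⁅x, y⁆.κ r s = c r s * (x.X r 0 * y.X s 1)
        - c r s * (y.X r 0 * x.X s 1) + c s r * (x.X s 0 * y.X r 1)
        - c s r * (y.X s 0 * x.X r 1) := by
      intro r s
      rw [hc.apply r s, lie_κ]
      simp [J, Matrix.mul_apply, Fin.sum_univ_two]
      ring
    simp only [h1, Finset.sum_sub_distrib, Finset.sum_add_distrib]
    rw [Finset.sum_comm (f := fun r s => c s r * (x.X s 0 * y.X r 1)),
      Finset.sum_comm (f := fun r s => c s r * (y.X s 0 * x.X r 1))]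
    ring
  have hX0 : (fun r => ⁅x, y⁆.X r 0) = y.M 0 0 • (fun r => x.X r 0) + y.M 1 0 • (fun r => x.X r 1)
      - x.M 0 0 • (fun r => y.X r 0) - x.M 1 0 • (fun r => y.X r 1) := by
    funext r
    simp [Matrix.mul_apply, Fin.sum_univ_two]
    ring
  have hX1 : (fun r => ⁅x, y⁆.X r 1) = y.M 0 1 • (fun r => x.X r 0) - y.M 0 0 • (fun r => x.X r 1)
      - x.M 0 1 • (fun r => y.X r 0) + x.M 0 0 • (fun r => y.X r 1) := by
    funext r
    simp [Matrix.mul_apply, Fin.sum_univ_two, M_11]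
    ring
  have hM0 : ⁅x, y⁆.M 0 0 = x.M 0 1 * y.M 1 0 - y.M 0 1 * x.M 1 0 := by
    simp [Matrix.mul_apply, Fin.sum_univ_two]
    ring
  have hM1 : ⁅x, y⁆.M 0 1 = 2 * (x.M 0 0 * y.M 0 1) - 2 * (y.M 0 0 * x.M 0 1) := by
    simp [Matrix.mul_apply, Fin.sum_univ_two, M_11]
    ring
  have hM2 : ⁅x, y⁆.M 1 0 = 2 * (y.M 0 0 * x.M 1 0) - 2 * (x.M 0 0 * y.M 1 0) := by
    simp [Matrix.mul_apply, Fin.sum_univ_two, M_11]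
    ring
  rw [liftFun, hκ, hX0, hX1, hM0, hM1, hM2]
  simp only [liftFun, map_add, map_sub, map_smul]
  simp only [mul_add, add_mul, smul_mul_assoc, mul_smul_comm, mul_one, one_mul, h.H_E, h.H_F, h.E_F,
    He, Hf, Ee, Ef, Fe, Ff, ef]
  rw [ee _ (fun r => x.X r 1), ff _ (fun r => x.X r 0)]
  module

/-- Elements satisfying the defining relations give a homomorphism from the enveloping algebra. -/
theorem exists_hom (h : JacobiRel c H' E' F' e' f') (hc : c.IsSymm) :
    ∃ θ : U N →ₐ[ℂ] R, θ (ι (H N)) = H' ∧ θ (ι (E N)) = E' ∧ θ (ι (F N)) = F' ∧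
      (∀ r, θ (ι (e r)) = e' r) ∧ (∀ r, θ (ι (f r)) = f' r) ∧
      ∀ r s, θ (ι (Z r s)) = algebraMap ℂ R (c r s) := by
  let g : Alg N →ₗ⁅ℂ⁆ R :=
    { toFun := liftFun c H' E' F' e' f'
      map_add' := fun x y => by
        have h0 : (fun r => (x + y).X r 0) = (fun r => x.X r 0) + (fun r => y.X r 0) := rfl
        have h1 : (fun r => (x + y).X r 1) = (fun r => x.X r 1) + (fun r => y.X r 1) := rfl
        have h2 : (∑ r, ∑ s, c r s * (x + y).κ r s)
            = (∑ r, ∑ s, c r s * x.κ r s) + ∑ r, ∑ s, c r s * y.κ r s := by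
          simp [mul_add, Finset.sum_add_distrib]
        simp only [liftFun, h0, h1, h2, map_add, add_M, Matrix.add_apply]
        module
      map_smul' := fun a x => by
        have h0 : (fun r => (a • x).X r 0) = a • (fun r => x.X r 0) := rfl
        have h1 : (fun r => (a • x).X r 1) = a • (fun r => x.X r 1) := rfl
        have h2 : (∑ r, ∑ s, c r s * (a • x).κ r s) = a * ∑ r, ∑ s, c r s * x.κ r s := by
          simp [Finset.mul_sum, mul_left_comm]
        simp only [liftFun, h0, h1, h2, map_smul, smul_M, Matrix.smul_apply, smul_eq_mul,
          RingHom.id_apply]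
        module
      map_lie' := fun {x y} => by
        rw [LieRing.of_associative_ring_bracket]
        exact h.liftFun_lie hc x y }
  refine ⟨UniversalEnvelopingAlgebra.lift ℂ g, ?_, ?_, ?_, ?_, ?_, ?_⟩
  · rw [UniversalEnvelopingAlgebra.lift_ι_apply]
    change liftFun c H' E' F' e' f' _ = _
    simp [liftFun, H, Fintype.linearCombination_apply]
  · rw [UniversalEnvelopingAlgebra.lift_ι_apply]
    change liftFun c H' E' F' e' f' _ = _
    simp [liftFun, E, Fintype.linearCombination_apply]
  · rw [UniversalEnvelopingAlgebra.lift_ι_apply]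
    change liftFun c H' E' F' e' f' _ = _
    simp [liftFun, F, Fintype.linearCombination_apply]
  · intro r
    rw [UniversalEnvelopingAlgebra.lift_ι_apply]
    change liftFun c H' E' F' e' f' _ = _
    simp [liftFun, e, Fintype.linearCombination_apply, Matrix.single_apply, ite_smul]
  · intro r
    rw [UniversalEnvelopingAlgebra.lift_ι_apply]
    change liftFun c H' E' F' e' f' _ = _
    simp [liftFun, f, Fintype.linearCombination_apply, Matrix.single_apply, ite_smul]
  · intro r s
    rw [UniversalEnvelopingAlgebra.lift_ι_apply]
    change liftFun c H' E' F' e' f' _ = _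
    have : ∑ p, ∑ q, c p q * ((1 / 2 : ℂ) * (Matrix.single r s (1 : ℂ) p q
        + Matrix.single s r 1 p q)) = c r s := by
      have h3 : ∀ p q, c p q * ((1 / 2 : ℂ) * (Matrix.single r s (1 : ℂ) p q
          + Matrix.single s r 1 p q)) = (if r = p ∧ s = q then c r s / 2 else 0)
            + (if s = p ∧ r = q then c r s / 2 else 0) := by
        intro p q
        simp only [Matrix.single_apply]
        split_ifs with h1 h2 h2
        · rw [h1.1, h1.2]; ring
        · rw [h1.1, h1.2]; ring
        · rw [← h2.1, ← h2.2, hc.apply]; ring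
        · ring
      simp only [h3, Finset.sum_add_distrib, ite_and]
      simp
    simp only [liftFun, Z, mk_M, mk_X, mk_κ, Matrix.smul_apply, Matrix.add_apply, smul_eq_mul, this]
    simp [Fintype.linearCombination_apply, Algebra.algebraMap_eq_smul_one]

end JacobiRel

/-- A homomorphism that maps the `Z_{rs}` to scalars maps every polynomial in the `Z_{rs}` to
the corresponding scalar. -/
theorem hom_polynomial_matZ (θ : U N →ₐ[ℂ] R) (hZ : ∀ r s, θ (ι (Z r s)) = algebraMap ℂ R (c r s))
    (p : MvPolynomial (Fin N × Fin N) ℂ) :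
    θ (MvPolynomial.aeval (fun i : Fin N × Fin N => matZ N i.1 i.2) p : Subalgebra.center ℂ (U N))
      = algebraMap ℂ R (MvPolynomial.aeval (fun i : Fin N × Fin N => c i.1 i.2) p) := by
  have h : (θ.comp (Subalgebra.center ℂ (U N)).val).comp
      (MvPolynomial.aeval fun i : Fin N × Fin N => matZ N i.1 i.2)
      = (Algebra.ofId ℂ R).comp (MvPolynomial.aeval fun i : Fin N × Fin N => c i.1 i.2) := by
    refine MvPolynomial.algHom_ext fun i => ?_
    simp only [AlgHom.comp_apply, MvPolynomial.aeval_X]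
    exact hZ i.1 i.2
  exact congrArg (fun g : MvPolynomial (Fin N × Fin N) ℂ →ₐ[ℂ] R => g p) h

/-! ### Specialization of the generic determinant, adjugate and minors -/

section

variable {C : Type*} [CommRing C] [Algebra ℂ C] (A : Matrix (Fin N) (Fin N) C)

theorem map_aeval_mvPolynomialX : (Matrix.mvPolynomialX (Fin N) (Fin N) ℂ).map
      ((MvPolynomial.aeval fun i : Fin N × Fin N => A i.1 i.2 : _ →ₐ[ℂ] C) : _ →+* C) = A := by
  ext i j
  simp [Matrix.mvPolynomialX_apply]

theorem aeval_det : MvPolynomial.aeval (fun i : Fin N × Fin N => A i.1 i.2)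
    (Matrix.mvPolynomialX (Fin N) (Fin N) ℂ).det = A.det := by
  have := RingHom.map_det ((MvPolynomial.aeval fun i : Fin N × Fin N => A i.1 i.2 : _ →ₐ[ℂ] C) :
    _ →+* C) (Matrix.mvPolynomialX (Fin N) (Fin N) ℂ)
  rwa [RingHom.mapMatrix_apply, map_aeval_mvPolynomialX] at this

theorem aeval_adjugate (r s : Fin N) : MvPolynomial.aeval (fun i : Fin N × Fin N => A i.1 i.2)
    ((Matrix.mvPolynomialX (Fin N) (Fin N) ℂ).adjugate r s) = A.adjugate r s := by
  have := map_adjugate_apply ((MvPolynomial.aeval fun i : Fin N × Fin N => A i.1 i.2 : _ →ₐ[ℂ] C) :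
    _ →+* C) (Matrix.mvPolynomialX (Fin N) (Fin N) ℂ) r s
  rwa [map_aeval_mvPolynomialX] at this

theorem aeval_minorOf (r u s t : Fin N) :
    MvPolynomial.aeval (fun i : Fin N × Fin N => A i.1 i.2)
      (minorOf (Matrix.mvPolynomialX (Fin N) (Fin N) ℂ) r u s t) = minorOf A r u s t := by
  have := map_minorOf ((MvPolynomial.aeval fun i : Fin N × Fin N => A i.1 i.2 : _ →ₐ[ℂ] C) :
    _ →+* C) (Matrix.mvPolynomialX (Fin N) (Fin N) ℂ) r u s t
  rwa [map_aeval_mvPolynomialX] at this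

end

theorem hom_detZ (θ : U N →ₐ[ℂ] R) (hZ : ∀ r s, θ (ι (Z r s)) = algebraMap ℂ R (c r s)) :
    θ (detZ N) = algebraMap ℂ R c.det := by
  have h := hom_polynomial_matZ θ hZ (Matrix.mvPolynomialX (Fin N) (Fin N) ℂ).det
  rwa [aeval_det, aeval_det] at h

theorem hom_adjZ (θ : U N →ₐ[ℂ] R) (hZ : ∀ r s, θ (ι (Z r s)) = algebraMap ℂ R (c r s))
    (r s : Fin N) : θ (adjZ N r s) = algebraMap ℂ R (c.adjugate r s) := by
  have h := hom_polynomial_matZ θ hZ ((Matrix.mvPolynomialX (Fin N) (Fin N) ℂ).adjugate r s)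
  rwa [aeval_adjugate, aeval_adjugate] at h

theorem hom_minor (θ : U N →ₐ[ℂ] R) (hZ : ∀ r s, θ (ι (Z r s)) = algebraMap ℂ R (c r s))
    (r u s t : Fin N) : θ (minor r u s t : U N) = algebraMap ℂ R (minorOf c r u s t) := by
  have h := hom_polynomial_matZ θ hZ (minorOf (Matrix.mvPolynomialX (Fin N) (Fin N) ℂ) r u s t)
  rwa [aeval_minorOf, aeval_minorOf] at h

end Lift

/-! ## Splitting off the Weyl algebra -/

section Split

variable {R : Type*} [Ring R] [Algebra ℂ R] {c d : Matrix (Fin N) (Fin N) ℂ} {H' E' F' : R}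
  {e' f' : Fin N → R}

/-- The Leibniz rule: if the commutator with `X` sends `x` to `x'` and `y` to `y'`, it acts on
quadratic expressions as a derivation. It underlies the commutators with quadratic expressions
needed for the splitting. -/
theorem mul_quad {X : R} {x y x' y' : Fin N → R} (a : Matrix (Fin N) (Fin N) ℂ)
    (hx : ∀ r, X * x r = x r * X + x' r) (hy : ∀ r, X * y r = y r * X + y' r) :
    X * quad a x y = quad a x y * X + quad a x' y + quad a x y' := by
  simp only [quad, Finset.mul_sum, Finset.sum_mul, mul_smul_comm, smul_mul_assoc,
    ← Finset.sum_add_distrib]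
  refine Finset.sum_congr rfl fun r _ => Finset.sum_congr rfl fun s _ => ?_
  rw [← mul_assoc, hx, add_mul, mul_assoc, hy, mul_add, mul_assoc]
  module

theorem quad_neg_left (a : Matrix (Fin N) (Fin N) ℂ) (x y : Fin N → R) :
    quad a (fun r => -x r) y = -quad a x y := by
  simp [quad]

theorem quad_neg_right (a : Matrix (Fin N) (Fin N) ℂ) (x y : Fin N → R) :
    quad a x (fun r => -y r) = -quad a x y := by
  simp [quad]

theorem quad_zero_left (a : Matrix (Fin N) (Fin N) ℂ) (y : Fin N → R) :
    quad a (fun _ => 0) y = 0 := by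
  simp [quad]

theorem quad_zero_right (a : Matrix (Fin N) (Fin N) ℂ) (x : Fin N → R) :
    quad a x (fun _ => 0) = 0 := by
  simp [quad]

theorem commute_quad {X : R} {x y : Fin N → R} (a : Matrix (Fin N) (Fin N) ℂ)
    (hx : ∀ r, X * x r = x r * X) (hy : ∀ r, X * y r = y r * X) :
    X * quad a x y = quad a x y * X := by
  rw [mul_quad (x' := fun _ => 0) (y' := fun _ => 0) a (by simpa using hx) (by simpa using hy),
    quad_zero_left, quad_zero_right, add_zero, add_zero]

/-- The Heisenberg relations. -/
structure HeisRel (c : Matrix (Fin N) (Fin N) ℂ) (e f : Fin N → R) : Prop where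
  e_e r s : e r * e s = e s * e r
  f_f r s : f r * f s = f s * f r
  e_f r s : e r * f s = f s * e r - (2 * c r s) • (1 : R)

theorem JacobiRel.heisRel (h : JacobiRel c H' E' F' e' f') : HeisRel c e' f' :=
  ⟨h.e_e, h.f_f, h.e_f⟩

/-- The image of `H` under the metaplectic representation; `d` is the inverse of `c`. -/
noncomputable def metaH (d : Matrix (Fin N) (Fin N) ℂ) (e f : Fin N → R) : R :=
  (1 / 4 : ℂ) • (quad d f e + quad d e f)

/-- The image of `E` under the metaplectic representation. -/
noncomputable def metaE (d : Matrix (Fin N) (Fin N) ℂ) (e : Fin N → R) : R :=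
  (1 / 4 : ℂ) • quad d e e

/-- The image of `F` under the metaplectic representation. -/
noncomputable def metaF (d : Matrix (Fin N) (Fin N) ℂ) (f : Fin N → R) : R :=
  -((1 / 4 : ℂ) • quad d f f)

theorem sum_inv_smul (hcd : c * d = 1) (p : Fin N) (x : Fin N → R) :
    ∑ r, ∑ s, (c p r * d r s) • x s = x p := by
  rw [Finset.sum_comm]
  simp only [← Finset.sum_smul, ← Matrix.mul_apply, hcd, Matrix.one_apply]
  simp

theorem quad_scalar_left (hcd : c * d = 1) (p : Fin N) (x : Fin N → R) :
    quad d (fun r => (2 * c p r) • (1 : R)) x = (2 : ℂ) • x p := by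
  rw [← sum_inv_smul hcd p x, Finset.smul_sum, quad]
  refine Finset.sum_congr rfl fun r _ => ?_
  rw [Finset.smul_sum]
  refine Finset.sum_congr rfl fun s _ => ?_
  rw [smul_mul_assoc, one_mul]
  module

namespace HeisRel

theorem e_mul_quad (h : HeisRel c e' f') (p : Fin N) (x : Fin N → R)
    (hx : ∀ r, e' p * x r = x r * e' p) (hcd : c * d = 1) :
    e' p * quad d f' x = quad d f' x * e' p - (2 : ℂ) • x p := by
  have := mul_quad (x' := fun r => -((2 * c p r) • (1 : R))) (y' := fun _ => 0) (X := e' p)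
    (x := f') (y := x) d (fun r => by rw [h.e_f, sub_eq_add_neg]) (by simpa using hx)
  rw [this, quad_zero_right, quad_neg_left, quad_scalar_left hcd, add_zero, sub_eq_add_neg]

theorem quad_comm (h : HeisRel c e' f') (hd : d.IsSymm) (hcd : c * d = 1) :
    quad d e' f' = quad d f' e' - (2 * (N : ℂ)) • (1 : R) := by
  have h1 : quad d e' f' = quad d f' e' - ∑ r, ∑ s, (d r s * (2 * c s r)) • (1 : R) := by
    rw [quad_swap hd e' f', quad, ← Finset.sum_sub_distrib]
    refine Finset.sum_congr rfl fun r _ => ?_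
    rw [← Finset.sum_sub_distrib]
    refine Finset.sum_congr rfl fun s _ => ?_
    rw [h.e_f]
    module
  have h2 : ∑ r, ∑ s, (d r s * (2 * c s r)) = 2 * N := by
    rw [Finset.sum_comm]
    have : ∀ s, ∑ r, d r s * (2 * c s r) = 2 := by
      intro s
      have := congrFun (congrFun hcd s) s
      rw [Matrix.mul_apply, Matrix.one_apply_eq] at this
      calc ∑ r, d r s * (2 * c s r) = 2 * ∑ r, c s r * d r s := by
            rw [Finset.mul_sum]
            exact Finset.sum_congr rfl fun r _ => by ring
        _ = 2 := by rw [this, mul_one]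
    rw [Finset.sum_congr rfl fun s _ => this s]
    simp [mul_comm]
  rw [h1]
  simp only [← Finset.sum_smul]
  rw [h2]

/-- Exchanging `e` and `f` reverses the sign of the form. This symmetry derives half of the
metaplectic relations from the other half. -/
theorem swap (h : HeisRel c e' f') (hc : c.IsSymm) : HeisRel (-c) f' e' :=
  ⟨h.f_f, h.e_e, fun r s => by
    rw [h.e_f, Matrix.neg_apply, hc.apply]
    module⟩

theorem metaE_e (h : HeisRel c e' f') (p : Fin N) : metaE d e' * e' p = e' p * metaE d e' := by
  rw [metaE, smul_mul_assoc, mul_smul_comm, commute_quad d (h.e_e p) (h.e_e p)]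

theorem metaF_f (h : HeisRel c e' f') (p : Fin N) : metaF d f' * f' p = f' p * metaF d f' := by
  rw [metaF, neg_mul, mul_neg, smul_mul_assoc, mul_smul_comm, commute_quad d (h.f_f p) (h.f_f p)]

theorem metaF_e (h : HeisRel c e' f') (hd : d.IsSymm) (hcd : c * d = 1) (p : Fin N) :
    metaF d f' * e' p = e' p * metaF d f' - f' p := by
  have h1 := mul_quad (X := e' p) (x := f') (y := f') d
    (x' := fun r => -((2 * c p r) • (1 : R))) (y' := fun r => -((2 * c p r) • (1 : R)))
    (fun r => by rw [h.e_f, sub_eq_add_neg]) (fun r => by rw [h.e_f, sub_eq_add_neg])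
  have h2 := quad_scalar_left hcd p f'
  have h3 : quad d f' (fun r => (2 * c p r) • (1 : R)) = (2 : ℂ) • f' p := by
    rw [← h2, quad_swap hd]
    simp only [quad, mul_smul_comm, smul_mul_assoc, mul_one, one_mul]
  rw [quad_neg_left, quad_neg_right, h2, h3] at h1
  rw [metaF, neg_mul, mul_neg, smul_mul_assoc, mul_smul_comm, h1]
  module

theorem metaE_f (h : HeisRel c e' f') (hc : c.IsSymm) (hd : d.IsSymm) (hcd : c * d = 1)
    (p : Fin N) : metaE d e' * f' p = f' p * metaE d e' - e' p := by
  have h1 := (h.swap hc).metaF_e (d := -d) (by rw [Matrix.IsSymm, Matrix.transpose_neg, hd.eq])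
    (by rw [neg_mul_neg, hcd]) p
  have h2 : metaF (-d) e' = metaE d e' := by simp [metaF, metaE, quad]
  rwa [h2] at h1

theorem metaH_e (h : HeisRel c e' f') (hd : d.IsSymm) (hcd : c * d = 1) (p : Fin N) :
    metaH d e' f' * e' p = e' p * metaH d e' f' + e' p := by
  have h1 := h.e_mul_quad p e' (h.e_e p) hcd
  rw [metaH, h.quad_comm hd hcd]
  simp only [smul_mul_assoc, mul_smul_comm, mul_add, mul_sub, add_mul, sub_mul, mul_one, one_mul, h1]
  module

theorem metaH_f (h : HeisRel c e' f') (hc : c.IsSymm) (hd : d.IsSymm) (hcd : c * d = 1)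
    (p : Fin N) : metaH d e' f' * f' p = f' p * metaH d e' f' - f' p := by
  have h1 := (h.swap hc).metaH_e (d := -d) (by rw [Matrix.IsSymm, Matrix.transpose_neg, hd.eq])
    (by rw [neg_mul_neg, hcd]) p
  have h2 : metaH (-d) f' e' = -metaH d e' f' := by simp [metaH, quad, add_comm]
  rw [h2, neg_mul, mul_neg] at h1
  rw [← neg_inj, h1]
  abel

/-- The metaplectic representation. -/
theorem jacobiRel (h : HeisRel c e' f') (hc : c.IsSymm) (hd : d.IsSymm) (hcd : c * d = 1) :
    JacobiRel c (metaH d e' f') (metaE d e') (metaF d f') e' f' where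
  H_E := by
    have := mul_quad d (h.metaH_e hd hcd) (h.metaH_e hd hcd)
    rw [metaE, mul_smul_comm, this, smul_mul_assoc]
    module
  H_F := by
    have := mul_quad (x' := fun r => -f' r) (y' := fun r => -f' r) d
      (fun r => by rw [h.metaH_f hc hd hcd, sub_eq_add_neg])
      (fun r => by rw [h.metaH_f hc hd hcd, sub_eq_add_neg])
    rw [quad_neg_left, quad_neg_right] at this
    rw [metaF, mul_neg, mul_smul_comm, this, neg_mul, smul_mul_assoc]
    module
  E_F := by
    have := mul_quad (x' := fun r => -e' r) (y' := fun r => -e' r) d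
      (fun r => by rw [h.metaE_f hc hd hcd, sub_eq_add_neg])
      (fun r => by rw [h.metaE_f hc hd hcd, sub_eq_add_neg])
    rw [quad_neg_left, quad_neg_right] at this
    rw [metaF, mul_neg, mul_smul_comm, this, neg_mul, smul_mul_assoc, metaH]
    module
  H_e := h.metaH_e hd hcd
  H_f := h.metaH_f hc hd hcd
  E_e := h.metaE_e
  E_f := h.metaE_f hc hd hcd
  F_e := h.metaF_e hd hcd
  F_f := h.metaF_f
  e_e := h.e_e
  f_f := h.f_f
  e_f := h.e_f

end HeisRel

/-- An `sl₂`-triple commuting with a Heisenberg algebra. -/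
structure SplitRel (c : Matrix (Fin N) (Fin N) ℂ) (H E F : R) (e f : Fin N → R) : Prop
    extends HeisRel c e f where
  H_E : H * E = E * H + (2 : ℂ) • E
  H_F : H * F = F * H - (2 : ℂ) • F
  E_F : E * F = F * E + H
  H_e r : H * e r = e r * H
  H_f r : H * f r = f r * H
  E_e r : E * e r = e r * E
  E_f r : E * f r = f r * E
  F_e r : F * e r = e r * F
  F_f r : F * f r = f r * F

/-- The given triple and the metaplectic triple have the same commutators with every `e_r` and
`f_r`. Their difference therefore commutes with the Heisenberg elements, hence with the metaplectic
triple, which is quadratic in them; this makes the difference an `sl₂`-triple in its own right. -/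
theorem JacobiRel.splitRel (h : JacobiRel c H' E' F' e' f') (hc : c.IsSymm) (hd : d.IsSymm)
    (hcd : c * d = 1) :
    SplitRel c (H' - metaH d e' f') (E' - metaE d e') (F' - metaF d f') e' f' := by
  have t := h.heisRel.jacobiRel hc hd hcd
  have He (r) : (H' - metaH d e' f') * e' r = e' r * (H' - metaH d e' f') := by
    rw [sub_mul, mul_sub, h.H_e, t.H_e]; abel
  have Hf (r) : (H' - metaH d e' f') * f' r = f' r * (H' - metaH d e' f') := by
    rw [sub_mul, mul_sub, h.H_f, t.H_f]; abel
  have Ee (r) : (E' - metaE d e') * e' r = e' r * (E' - metaE d e') := by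
    rw [sub_mul, mul_sub, h.E_e, t.E_e]
  have Ef (r) : (E' - metaE d e') * f' r = f' r * (E' - metaE d e') := by
    rw [sub_mul, mul_sub, h.E_f, t.E_f]; abel
  have Fe (r) : (F' - metaF d f') * e' r = e' r * (F' - metaF d f') := by
    rw [sub_mul, mul_sub, h.F_e, t.F_e]; abel
  have Ff (r) : (F' - metaF d f') * f' r = f' r * (F' - metaF d f') := by
    rw [sub_mul, mul_sub, h.F_f, t.F_f]
  have HE : (H' - metaH d e' f') * metaE d e' = metaE d e' * (H' - metaH d e' f') := by
    rw [metaE, mul_smul_comm, smul_mul_assoc, commute_quad d He He]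
  have HF : (H' - metaH d e' f') * metaF d f' = metaF d f' * (H' - metaH d e' f') := by
    rw [metaF, mul_neg, neg_mul, mul_smul_comm, smul_mul_assoc, commute_quad d Hf Hf]
  have EF : (E' - metaE d e') * metaF d f' = metaF d f' * (E' - metaE d e') := by
    rw [metaF, mul_neg, neg_mul, mul_smul_comm, smul_mul_assoc, commute_quad d Ef Ef]
  have hEH : E' * metaH d e' f' = metaH d e' f' * E' - (2 : ℂ) • metaE d e' := by
    have h1 := mul_quad (X := E') (x := f') (y := e') d (x' := fun r => -e' r) (y' := fun _ => 0)
      (fun r => by rw [h.E_f, sub_eq_add_neg]) (fun r => by rw [h.E_e, add_zero])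
    have h2 := mul_quad (X := E') (x := e') (y := f') d (x' := fun _ => 0) (y' := fun r => -e' r)
      (fun r => by rw [h.E_e, add_zero]) (fun r => by rw [h.E_f, sub_eq_add_neg])
    rw [quad_neg_left, quad_zero_right] at h1
    rw [quad_neg_right, quad_zero_left] at h2
    rw [metaH, metaE, mul_smul_comm, mul_add, h1, h2, smul_mul_assoc, add_mul]
    module
  have hFH : F' * metaH d e' f' = metaH d e' f' * F' + (2 : ℂ) • metaF d f' := by
    have h1 := mul_quad (X := F') (x := f') (y := e') d (y' := fun r => -f' r) (x' := fun _ => 0)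
      (fun r => by rw [h.F_f, add_zero]) (fun r => by rw [h.F_e, sub_eq_add_neg])
    have h2 := mul_quad (X := F') (x := e') (y := f') d (y' := fun _ => 0) (x' := fun r => -f' r)
      (fun r => by rw [h.F_e, sub_eq_add_neg]) (fun r => by rw [h.F_f, add_zero])
    rw [quad_neg_right, quad_zero_left] at h1
    rw [quad_neg_left, quad_zero_right] at h2
    rw [metaH, metaF, mul_smul_comm, mul_add, h1, h2, smul_mul_assoc, add_mul]
    module
  have hFE : F' * metaE d e' = metaE d e' * F' - metaH d e' f' := by
    have h1 := mul_quad (X := F') (x := e') (y := e') d (x' := fun r => -f' r)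
      (y' := fun r => -f' r)
      (fun r => by rw [h.F_e, sub_eq_add_neg]) (fun r => by rw [h.F_e, sub_eq_add_neg])
    rw [quad_neg_right, quad_neg_left] at h1
    rw [metaH, metaE, mul_smul_comm, h1, smul_mul_assoc]
    module
  refine ⟨h.heisRel, ?_, ?_, ?_, He, Hf, Ee, Ef, Fe, Ff⟩
  · rw [mul_sub, HE]
    simp only [sub_mul, mul_sub, h.H_E, hEH]
    module
  · rw [mul_sub, HF]
    simp only [sub_mul, mul_sub, h.H_F, hFH]
    module
  · rw [mul_sub, EF]
    simp only [sub_mul, mul_sub, h.E_F, hFE]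
    module

/-- The converse of `JacobiRel.splitRel`: the sum of two commuting `sl₂`-triples is an `sl₂`-triple,
and only the metaplectic summand acts on the Heisenberg elements. Representations can thus be built
from split data. -/
theorem SplitRel.jacobiRel (h : SplitRel c H' E' F' e' f') (hc : c.IsSymm) (hd : d.IsSymm)
    (hcd : c * d = 1) :
    JacobiRel c (H' + metaH d e' f') (E' + metaE d e') (F' + metaF d f') e' f' := by
  have t := h.toHeisRel.jacobiRel hc hd hcd
  have cE (X : R) (hX : ∀ r, X * e' r = e' r * X) : X * metaE d e' = metaE d e' * X := by
    rw [metaE, mul_smul_comm, smul_mul_assoc, commute_quad d hX hX]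
  have cF (X : R) (hX : ∀ r, X * f' r = f' r * X) : X * metaF d f' = metaF d f' * X := by
    rw [metaF, mul_neg, neg_mul, mul_smul_comm, smul_mul_assoc, commute_quad d hX hX]
  have cH (X : R) (hX : ∀ r, X * e' r = e' r * X) (hX' : ∀ r, X * f' r = f' r * X) :
      X * metaH d e' f' = metaH d e' f' * X := by
    rw [metaH, mul_smul_comm, smul_mul_assoc, mul_add, add_mul, commute_quad d hX' hX,
      commute_quad d hX hX']
  constructor
  · rw [mul_add, add_mul, add_mul, cE H' h.H_e, h.H_E, t.H_E, add_mul, mul_add, mul_add,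
      cH E' h.E_e h.E_f]
    module
  · rw [mul_add, add_mul, add_mul, cF H' h.H_f, h.H_F, t.H_F, add_mul, mul_add, mul_add,
      cH F' h.F_e h.F_f]
    module
  · rw [mul_add, add_mul, add_mul, cF E' h.E_f, h.E_F, t.E_F, add_mul, mul_add, mul_add,
      cE F' h.F_e]
    module
  · intro r; rw [add_mul, mul_add, h.H_e, t.H_e]; abel
  · intro r; rw [add_mul, mul_add, h.H_f, t.H_f]; abel
  · intro r; rw [add_mul, mul_add, h.E_e, t.E_e]
  · intro r; rw [add_mul, mul_add, h.E_f, t.E_f]; abel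
  · intro r; rw [add_mul, mul_add, h.F_e, t.F_e]; abel
  · intro r; rw [add_mul, mul_add, h.F_f, t.F_f]
  · exact h.e_e
  · exact h.f_f
  · exact h.e_f

end Split

/-! ## The basis adapted to the isotropy subalgebra -/

/-- The relations of an `sl₂`-triple `(h, p, m)`, with raising operator `p` and lowering operator
`m`, that commutes with a Weyl algebra. -/
structure OscRel {R : Type*} [Ring R] [Algebra ℂ R] (h p m : R) (y D : Fin N → R) : Prop where
  h_p : h * p = p * h + (2 : ℂ) • p
  h_m : h * m = m * h - (2 : ℂ) • m
  p_m : p * m = m * p + h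
  h_y r : h * y r = y r * h
  h_D r : h * D r = D r * h
  p_y r : p * y r = y r * p
  p_D r : p * D r = D r * p
  m_y r : m * y r = y r * m
  m_D r : m * D r = D r * m
  y_y r s : y r * y s = y s * y r
  D_D r s : D r * D s = D s * D r
  D_y r s : D r * y s = y s * D r + if r = s then 1 else 0

section Cayley

variable {R : Type*} [Ring R] [Algebra ℂ R] {c : Matrix (Fin N) (Fin N) ℂ}
  {H' E' F' h p m : R} {e' f' y D : Fin N → R}

/-- The semisimple element `i(F - E)`. -/
noncomputable def cayH (E F : R) : R := Complex.I • (F - E)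

/-- The raising operator of the triple with semisimple element `i(F - E)`. -/
noncomputable def cayP (H E F : R) : R := (1 / 2 : ℂ) • H + (Complex.I / 2) • (E + F)

/-- The lowering operator of the triple with semisimple element `i(F - E)`. -/
noncomputable def cayM (H E F : R) : R := (1 / 2 : ℂ) • H - (Complex.I / 2) • (E + F)

/-- The creation operators. -/
noncomputable def cayY (e f : Fin N → R) (r : Fin N) : R := e r - Complex.I • f r

/-- The annihilation operators, up to normalization. -/
noncomputable def cayB (e f : Fin N → R) (r : Fin N) : R := e r + Complex.I • f r

/-- The annihilation operators; `d` is the inverse of `c`. -/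
noncomputable def cayD (d : Matrix (Fin N) (Fin N) ℂ) (e f : Fin N → R) (r : Fin N) : R :=
  ∑ s, (-(Complex.I / 4) * d r s) • cayB e f s

/-- The Casimir operator does not depend on which conjugate `sl₂`-triple is used to write it. -/
theorem SplitRel.casimir_cayley (hs : SplitRel c H' E' F' e' f') :
    cayH E' F' * cayH E' F' + (2 : ℂ) • cayH E' F' + (4 : ℂ) • (cayM H' E' F' * cayP H' E' F')
      = H' * H' + (2 : ℂ) • H' + (4 : ℂ) • (F' * E') := by
  simp only [cayH, cayP, cayM, smul_mul_assoc, mul_smul_comm, mul_add, mul_sub, add_mul, sub_mul,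
    hs.H_E, hs.H_F, hs.E_F, smul_add, smul_sub]
  match_scalars <;> ring_nf <;> simp [Complex.I_sq]

theorem HeisRel.cayB_cayY (hs : HeisRel c e' f') (hc : c.IsSymm) (r s : Fin N) :
    cayB e' f' r * cayY e' f' s = cayY e' f' s * cayB e' f' r + (4 * Complex.I * c r s) • (1 : R) := by
  simp only [cayB, cayY, smul_mul_assoc, mul_smul_comm, mul_add, mul_sub, add_mul, sub_mul,
    hs.e_e r s, hs.f_f r s, hs.e_f, smul_add, smul_sub, hc.apply r s]
  module

theorem SplitRel.oscRel {d : Matrix (Fin N) (Fin N) ℂ} (hs : SplitRel c H' E' F' e' f')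
    (hc : c.IsSymm) (hdc : d * c = 1) :
    OscRel (cayH E' F') (cayP H' E' F') (cayM H' E' F') (cayY e' f') (cayD d e' f') := by
  have hb (X : R) (hX : ∀ r, X * e' r = e' r * X) (hX' : ∀ r, X * f' r = f' r * X) (r : Fin N) :
      X * cayD d e' f' r = cayD d e' f' r * X := by
    simp only [cayD, cayB, Finset.mul_sum, Finset.sum_mul, mul_smul_comm, smul_mul_assoc, mul_add,
      add_mul, hX, hX']
  have hy (X : R) (hX : ∀ r, X * e' r = e' r * X) (hX' : ∀ r, X * f' r = f' r * X) (r : Fin N) :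
      X * cayY e' f' r = cayY e' f' r * X := by
    simp only [cayY, mul_smul_comm, smul_mul_assoc, mul_sub, sub_mul, hX, hX']
  have he : ∀ X ∈ ({cayH E' F', cayP H' E' F', cayM H' E' F'} : Set R), ∀ r,
      X * e' r = e' r * X ∧ X * f' r = f' r * X := by
    rintro X (rfl | rfl | rfl) r <;>
    simp only [cayH, cayP, cayM, mul_smul_comm, smul_mul_assoc, mul_add, add_mul, mul_sub, sub_mul,
      hs.H_e, hs.H_f, hs.E_e, hs.E_f, hs.F_e, hs.F_f, and_self]
  have hB (r s : Fin N) : cayB e' f' r * cayB e' f' s = cayB e' f' s * cayB e' f' r := by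
    simp only [cayB, smul_mul_assoc, mul_smul_comm, mul_add, add_mul, hs.e_e r s, hs.f_f r s,
      hs.e_f, smul_add, smul_sub, hc.apply r s]
    module
  constructor
  · simp only [cayH, cayP, smul_mul_assoc, mul_smul_comm, mul_add, mul_sub, add_mul, sub_mul,
      hs.H_E, hs.H_F, hs.E_F, smul_add, smul_sub]
    match_scalars <;> ring_nf <;> simp [Complex.I_sq] <;> norm_num
  · simp only [cayH, cayM, smul_mul_assoc, mul_smul_comm, mul_add, mul_sub, add_mul, sub_mul,
      hs.H_E, hs.H_F, hs.E_F, smul_add, smul_sub]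
    match_scalars <;> ring_nf <;> simp [Complex.I_sq] <;> norm_num
  · simp only [cayH, cayM, cayP, smul_mul_assoc, mul_smul_comm, mul_add, mul_sub, add_mul, sub_mul,
      hs.H_E, hs.H_F, hs.E_F, smul_add, smul_sub]
    match_scalars <;> ring_nf
  · exact hy _ (fun r => (he _ (by simp) r).1) (fun r => (he _ (by simp) r).2)
  · exact hb _ (fun r => (he _ (by simp) r).1) (fun r => (he _ (by simp) r).2)
  · exact hy _ (fun r => (he _ (by simp) r).1) (fun r => (he _ (by simp) r).2)
  · exact hb _ (fun r => (he _ (by simp) r).1) (fun r => (he _ (by simp) r).2)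
  · exact hy _ (fun r => (he _ (by simp) r).1) (fun r => (he _ (by simp) r).2)
  · exact hb _ (fun r => (he _ (by simp) r).1) (fun r => (he _ (by simp) r).2)
  · intro r s
    simp only [cayY, smul_mul_assoc, mul_smul_comm, mul_sub, sub_mul, hs.e_e r s, hs.f_f r s,
      hs.e_f, smul_sub, hc.apply r s]
    module
  · intro r s
    rw [cayD, cayD, Finset.sum_mul_sum, Finset.sum_mul_sum, Finset.sum_comm]
    refine Finset.sum_congr rfl fun t _ => Finset.sum_congr rfl fun u _ => ?_
    rw [smul_mul_smul_comm, smul_mul_smul_comm, hB, mul_comm (-(Complex.I / 4) * d r u)]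
  · intro r s
    have h1 := congrFun (congrFun hdc r) s
    rw [Matrix.mul_apply, Matrix.one_apply] at h1
    rw [cayD, Finset.sum_mul, Finset.mul_sum]
    -- The commutator of `cayB` with `cayY` is `4i c`; the constant `-i/4` in `cayD` is the inverse
    -- of `4i`, and `d` is the inverse of `c`.
    have h2 : ∀ t, (-(Complex.I / 4) * d r t) • cayB e' f' t * cayY e' f' s
        = cayY e' f' s * (-(Complex.I / 4) * d r t) • cayB e' f' t + (d r t * c t s) • (1 : R) := by
      intro t
      rw [smul_mul_assoc, mul_smul_comm, hs.cayB_cayY hc]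
      match_scalars <;> ring_nf
      simp
    rw [Finset.sum_congr rfl fun t _ => h2 t, Finset.sum_add_distrib, ← Finset.sum_smul, h1]
    simp

/-- The metaplectic image of `H̃` is the oscillator Hamiltonian: the total degree operator shifted
by the zero-point energy `N/2`, which comes from normal ordering. -/
theorem HeisRel.sum_cayY_cayD {d : Matrix (Fin N) (Fin N) ℂ} (hs : HeisRel c e' f')
    (hd : d.IsSymm) (hcd : c * d = 1) :
    ∑ r, cayY e' f' r * cayD d e' f' r + ((N : ℂ) / 2) • (1 : R)
      = Complex.I • (metaF d f' - metaE d e') := by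
  have h1 : ∑ r, cayY e' f' r * cayD d e' f' r = (-(Complex.I / 4)) •
      (quad d e' e' + quad d f' f' + Complex.I • (quad d e' f' - quad d f' e')) := by
    simp only [quad, cayD, cayB, cayY, Finset.mul_sum, Finset.smul_sum, ← Finset.sum_add_distrib,
      ← Finset.sum_sub_distrib]
    refine Finset.sum_congr rfl fun r _ => Finset.sum_congr rfl fun s _ => ?_
    simp only [smul_mul_assoc, mul_smul_comm, mul_add, sub_mul, smul_add, smul_sub]
    match_scalars <;> ring_nf <;> simp <;> ring
  rw [h1, hs.quad_comm hd hcd, metaE, metaF]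
  match_scalars <;> ring_nf <;> simp [Complex.I_sq]

/-- The Heisenberg generators `e_r` in terms of creation and annihilation operators. -/
noncomputable def oscE (c : Matrix (Fin N) (Fin N) ℂ) (y D : Fin N → R) (r : Fin N) : R :=
  (1 / 2 : ℂ) • (y r + ∑ s, (4 * Complex.I * c r s) • D s)

/-- The Heisenberg generators `f_r` in terms of creation and annihilation operators. -/
noncomputable def oscF (c : Matrix (Fin N) (Fin N) ℂ) (y D : Fin N → R) (r : Fin N) : R :=
  (Complex.I / 2) • (y r - ∑ s, (4 * Complex.I * c r s) • D s)

/-- The inverse Cayley transform. Applied to the model it turns shift operators into a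
representation of the Jacobi Lie algebra. -/
theorem OscRel.splitRel (ho : OscRel h p m y D) (hc : c.IsSymm) :
    SplitRel c (p + m) (-(Complex.I / 2) • (p - m - h)) (-(Complex.I / 2) • (p - m + h))
      (oscE c y D) (oscF c y D) := by
  have hb (X : R) (hX : ∀ r, X * D r = D r * X) (r : Fin N) :
      X * (∑ s, (4 * Complex.I * c r s) • D s) = (∑ s, (4 * Complex.I * c r s) • D s) * X := by
    simp only [Finset.mul_sum, Finset.sum_mul, mul_smul_comm, smul_mul_assoc, hX]
  have hby (r s : Fin N) : (∑ t, (4 * Complex.I * c r t) • D t) * y s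
      = y s * (∑ t, (4 * Complex.I * c r t) • D t) + (4 * Complex.I * c r s) • (1 : R) := by
    simp only [Finset.mul_sum, Finset.sum_mul, mul_smul_comm, smul_mul_assoc, ho.D_y, smul_add,
      Finset.sum_add_distrib, smul_ite, smul_zero]
    simp
  have hbb (r s : Fin N) := hb (∑ t, (4 * Complex.I * c r t) • D t)
    (fun s => by
      simp only [Finset.mul_sum, Finset.sum_mul, mul_smul_comm, smul_mul_assoc, ho.D_D _ s]) s
  refine ⟨⟨?_, ?_, ?_⟩, ?_, ?_, ?_, ?_, ?_, ?_, ?_, ?_, ?_⟩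
  · intro r s
    simp only [oscE, smul_mul_assoc, mul_smul_comm, mul_add, add_mul, ho.y_y r s, hby, hbb r s,
      hc.apply r s]
    module
  · intro r s
    simp only [oscF, smul_mul_assoc, mul_smul_comm, mul_sub, sub_mul, ho.y_y r s, hby, hbb r s,
      hc.apply r s]
    module
  · intro r s
    simp only [oscE, oscF, smul_mul_assoc, mul_smul_comm, mul_sub, sub_mul, mul_add, add_mul,
      ho.y_y r s, hby, hbb r s, hc.apply r s]
    match_scalars <;> ring_nf <;> simp <;> ring
  · simp only [smul_mul_assoc, mul_smul_comm, mul_add, mul_sub, add_mul, sub_mul,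
      ho.h_p, ho.h_m, ho.p_m, smul_add, smul_sub]
    module
  · simp only [smul_mul_assoc, mul_smul_comm, mul_add, mul_sub, add_mul, sub_mul,
      ho.h_p, ho.h_m, ho.p_m, smul_add, smul_sub]
    module
  · simp only [smul_mul_assoc, mul_smul_comm, mul_add, mul_sub, add_mul, sub_mul,
      ho.h_p, ho.h_m, ho.p_m, smul_add, smul_sub]
    match_scalars <;> ring_nf <;> simp <;> ring
  all_goals
    intro r
    simp only [oscE, oscF, smul_mul_assoc, mul_smul_comm, mul_add, mul_sub, add_mul, sub_mul,
      ho.h_y, ho.p_y, ho.m_y, hb h ho.h_D, hb p ho.p_D, hb m ho.m_D]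
    module

theorem cayH_osc : cayH (-(Complex.I / 2) • (p - m - h)) (-(Complex.I / 2) • (p - m + h)) = h := by
  rw [cayH]
  match_scalars <;> ring_nf <;> simp

theorem cayP_osc : cayP (p + m) (-(Complex.I / 2) • (p - m - h))
    (-(Complex.I / 2) • (p - m + h)) = p := by
  rw [cayP]
  match_scalars <;> ring_nf <;> simp <;> ring

theorem cayM_osc : cayM (p + m) (-(Complex.I / 2) • (p - m - h))
    (-(Complex.I / 2) • (p - m + h)) = m := by
  rw [cayM]
  match_scalars <;> ring_nf <;> simp <;> ring

theorem cayY_osc : cayY (oscE c y D) (oscF c y D) = y := by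
  funext r
  rw [cayY, oscE, oscF]
  match_scalars <;> ring_nf <;> simp <;> ring

theorem cayD_osc {d : Matrix (Fin N) (Fin N) ℂ} (hdc : d * c = 1) :
    cayD d (oscE c y D) (oscF c y D) = D := by
  have hB (s : Fin N) : cayB (oscE c y D) (oscF c y D) s
      = ∑ t, (4 * Complex.I * c s t) • D t := by
    rw [cayB, oscE, oscF]
    match_scalars <;> ring_nf <;> simp <;> ring
  funext r
  simp only [cayD, hB, Finset.smul_sum, smul_smul]
  rw [Finset.sum_comm]
  have h1 : ∀ t, ∑ s, (-(Complex.I / 4) * d r s * (4 * Complex.I * c s t)) • D t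
      = (if r = t then (1 : ℂ) else 0) • D t := by
    intro t
    have h2 := congrFun (congrFun hdc r) t
    rw [Matrix.mul_apply, Matrix.one_apply] at h2
    rw [← Finset.sum_smul, ← h2]
    congr 1
    refine Finset.sum_congr rfl fun s _ => ?_
    linear_combination (-(d r s * c s t)) * Complex.I_mul_I
  rw [Finset.sum_congr rfl fun t _ => h1 t]
  simp

end Cayley

/-! ## Lifts of the adapted basis to the enveloping algebra -/

section Lifts

variable {R : Type*} [Ring R] [Algebra ℂ R] {c : Matrix (Fin N) (Fin N) ℂ}
  (d : Matrix (Fin N) (Fin N) ℂ)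

/-- `H` minus its metaplectic part. -/
noncomputable def splitH : U N := ι (H N) - metaH d (fun r => ι (e r)) (fun r => ι (f r))

/-- `E` minus its metaplectic part. -/
noncomputable def splitE : U N := ι (E N) - metaE d (fun r => ι (e r))

/-- `F` minus its metaplectic part. -/
noncomputable def splitF : U N := ι (F N) - metaF d (fun r => ι (f r))

/-- The lift of the semisimple element of the adapted triple. -/
noncomputable def liftH : U N := cayH (splitE d) (splitF d)

/-- The lift of the raising operator of the adapted triple. -/
noncomputable def liftP : U N := cayP (splitH d) (splitE d) (splitF d)

/-- The lift of the lowering operator of the adapted triple. -/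
noncomputable def liftM : U N := cayM (splitH d) (splitE d) (splitF d)

/-- The lifts of the creation operators. -/
noncomputable def liftY (r : Fin N) : U N := cayY (fun r => ι (e r)) (fun r => ι (f r)) r

/-- The lifts of the annihilation operators. -/
noncomputable def liftD (r : Fin N) : U N := cayD d (fun r => ι (e r)) (fun r => ι (f r)) r

variable {d}

theorem hom_quad (θ : U N →ₐ[ℂ] R) (x y : Fin N → U N) :
    θ (quad d x y) = quad d (fun r => θ (x r)) (fun r => θ (y r)) := by
  simp [quad]

theorem hom_splitH (θ : U N →ₐ[ℂ] R) : θ (splitH d) =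
    θ (ι (H N)) - metaH d (fun r => θ (ι (e r))) (fun r => θ (ι (f r))) := by
  simp only [splitH, metaH, map_sub, map_smul, map_add, hom_quad]

theorem hom_splitE (θ : U N →ₐ[ℂ] R) : θ (splitE d) =
    θ (ι (E N)) - metaE d (fun r => θ (ι (e r))) := by
  simp only [splitE, metaE, map_sub, map_smul, hom_quad]

theorem hom_splitF (θ : U N →ₐ[ℂ] R) : θ (splitF d) =
    θ (ι (F N)) - metaF d (fun r => θ (ι (f r))) := by
  simp only [splitF, metaF, map_sub, map_neg, map_smul, hom_quad]

theorem hom_liftH (θ : U N →ₐ[ℂ] R) : θ (liftH d) = cayH (θ (splitE d)) (θ (splitF d)) := by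
  simp only [liftH, cayH, map_smul, map_sub]

theorem hom_liftP (θ : U N →ₐ[ℂ] R) :
    θ (liftP d) = cayP (θ (splitH d)) (θ (splitE d)) (θ (splitF d)) := by
  simp only [liftP, cayP, map_smul, map_add]

theorem hom_liftM (θ : U N →ₐ[ℂ] R) :
    θ (liftM d) = cayM (θ (splitH d)) (θ (splitE d)) (θ (splitF d)) := by
  simp only [liftM, cayM, map_smul, map_add, map_sub]

theorem hom_liftY (θ : U N →ₐ[ℂ] R) :
    (fun r => θ (liftY r)) = cayY (fun r => θ (ι (e r))) (fun r => θ (ι (f r))) := by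
  funext r
  simp only [liftY, cayY, map_smul, map_sub]

theorem hom_liftD (θ : U N →ₐ[ℂ] R) :
    (fun r => θ (liftD d r)) = cayD d (fun r => θ (ι (e r))) (fun r => θ (ι (f r))) := by
  funext r
  simp only [liftD, cayD, cayB, map_smul, map_add, map_sum]

theorem splitRel_of_hom (θ : U N →ₐ[ℂ] R) (hZ : ∀ r s, θ (ι (Z r s)) = algebraMap ℂ R (c r s))
    (hc : c.IsSymm) (hd : d.IsSymm) (hcd : c * d = 1) :
    SplitRel c (θ (splitH d)) (θ (splitE d)) (θ (splitF d)) (fun r => θ (ι (e r)))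
      (fun r => θ (ι (f r))) := by
  rw [hom_splitH, hom_splitE, hom_splitF]
  exact (jacobiRel_of_hom θ c hZ).splitRel hc hd hcd

theorem oscRel_of_hom (θ : U N →ₐ[ℂ] R) (hZ : ∀ r s, θ (ι (Z r s)) = algebraMap ℂ R (c r s))
    (hc : c.IsSymm) (hd : d.IsSymm) (hcd : c * d = 1) :
    OscRel (θ (liftH d)) (θ (liftP d)) (θ (liftM d)) (fun r => θ (liftY r))
      (fun r => θ (liftD d r)) := by
  rw [hom_liftH, hom_liftP, hom_liftM, hom_liftY, hom_liftD]
  exact (splitRel_of_hom θ hZ hc hd hcd).oscRel hc (mul_eq_one_comm.1 hcd)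

/-- A representation of `OscRel` extends to the enveloping algebra. -/
theorem OscRel.exists_hom {h p m : R} {y D : Fin N → R} (ho : OscRel h p m y D) (hc : c.IsSymm)
    (hd : d.IsSymm) (hcd : c * d = 1) :
    ∃ θ : U N →ₐ[ℂ] R, (∀ r s, θ (ι (Z r s)) = algebraMap ℂ R (c r s)) ∧ θ (liftH d) = h ∧
      θ (liftP d) = p ∧ θ (liftM d) = m ∧ (∀ r, θ (liftY r) = y r) ∧
      ∀ r, θ (liftD d r) = D r := by
  obtain ⟨θ, hH, hE, hF, he, hf, hZ⟩ := ((ho.splitRel hc).jacobiRel hc hd hcd).exists_hom hc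
  have he' : (fun r => θ (ι (e r))) = oscE c y D := funext he
  have hf' : (fun r => θ (ι (f r))) = oscF c y D := funext hf
  refine ⟨θ, hZ, ?_, ?_, ?_, ?_, ?_⟩
  · rw [hom_liftH, hom_splitE, hom_splitF, hE, hF, he', hf', add_sub_cancel_right,
      add_sub_cancel_right, cayH_osc]
  · rw [hom_liftP, hom_splitE, hom_splitF, hom_splitH, hE, hF, hH, he', hf', add_sub_cancel_right,
      add_sub_cancel_right, add_sub_cancel_right, cayP_osc]
  · rw [hom_liftM, hom_splitE, hom_splitF, hom_splitH, hE, hF, hH, he', hf', add_sub_cancel_right,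
      add_sub_cancel_right, add_sub_cancel_right, cayM_osc]
  · refine congrFun ?_
    rw [hom_liftY, he', hf', cayY_osc]
  · refine congrFun ?_
    rw [hom_liftD, he', hf', cayD_osc (mul_eq_one_comm.1 hcd)]

theorem ι_tildeH : ι (tildeH (N := N)).1 = cayH (ι (E N)) (ι (F N)) := by
  rw [tildeH, ι_smul, map_sub, cayH]

/-- `H̃ = i(F - E)` is the sum of its part in the split `sl₂`, which is `liftH`, and its metaplectic
part, the shifted degree operator. -/
theorem hom_tildeH (θ : U N →ₐ[ℂ] R) (hZ : ∀ r s, θ (ι (Z r s)) = algebraMap ℂ R (c r s))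
    (hd : d.IsSymm) (hcd : c * d = 1) :
    θ (ι (tildeH (N := N)).1) =
      θ (liftH d) + ∑ r, θ (liftY r) * θ (liftD d r) + ((N : ℂ) / 2) • (1 : R) := by
  have h1 := (jacobiRel_of_hom θ c hZ).heisRel.sum_cayY_cayD hd hcd
  rw [add_assoc]
  have h2 : ∑ r, θ (liftY r) * θ (liftD d r) = ∑ r,
      cayY (fun r => θ (ι (e r))) (fun r => θ (ι (f r))) r *
        cayD d (fun r => θ (ι (e r))) (fun r => θ (ι (f r))) r := by
    rw [← hom_liftY, ← hom_liftD]
  rw [h2, h1, hom_liftH, hom_splitE, hom_splitF, ι_tildeH, cayH, cayH, map_smul, map_sub]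
  module

/-- With the entries of `Z` and `Z⁻¹` replaced by the scalars `c` and `d`, the identity
`casimir_abstract` applies in `R` without localization. Its triple is the split triple, and
`SplitRel.casimir_cayley` passes to the adapted one. -/
theorem hom_casimir (θ : U N →ₐ[ℂ] R) (hZ : ∀ r s, θ (ι (Z r s)) = algebraMap ℂ R (c r s))
    (hc : c.IsSymm) (hd : d.IsSymm) (hcd : c * d = 1) :
    θ (casimir N) = c.det • (θ (liftH d) * θ (liftH d) + (2 : ℂ) • θ (liftH d)
      + (4 : ℂ) • (θ (liftM d) * θ (liftP d)) - ((N : ℂ) * (N + 4) / 4) • (1 : R)) := by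
  have hdc : d * c = 1 := mul_eq_one_comm.1 hcd
  have hdet : c.det ≠ 0 := by
    intro h0
    have := congrArg Matrix.det hcd
    rw [Matrix.det_mul, h0, zero_mul, Matrix.det_one] at this
    exact zero_ne_one this
  have hs := splitRel_of_hom θ hZ hc hd hcd
  have hj := jacobiRel_of_hom θ c hZ
  have hadj : c.adjugate = c.det • d := by
    calc c.adjugate = c.adjugate * (c * d) := by rw [hcd, mul_one]
      _ = c.det • d := by rw [← mul_assoc, Matrix.adjugate_mul, Matrix.smul_mul, one_mul]
  have hmin (r u s t : Fin N) : minorOf c r u s t = c.det * (d r s * d u t - d u s * d r t) := by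
    apply mul_left_cancel₀ hdet
    rw [det_mul_minorOf, hadj]
    simp only [Matrix.smul_apply, smul_eq_mul]
    ring
  have hent (M M' : Matrix (Fin N) (Fin N) ℂ) (hM : M * M' = 1) (r t : Fin N) :
      ∑ s, algebraMap ℂ R (M r s) * algebraMap ℂ R (M' s t) = if r = t then 1 else 0 := by
    have := congrFun (congrFun hM r) t
    rw [Matrix.mul_apply, Matrix.one_apply] at this
    simp only [← map_mul, ← map_sum, this]
    split_ifs <;> simp
  have key := casimir_abstract (θ (ι (H N))) (θ (ι (E N))) (θ (ι (F N)))
    (fun r => θ (ι (e r))) (fun r => θ (ι (f r))) (fun r s => algebraMap ℂ R (c r s))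
    (fun r s => algebraMap ℂ R (d r s)) (fun r s x => Algebra.commutes _ _)
    (fun r s x => Algebra.commutes _ _) (hent d c hdc) (hent c d hcd)
    (fun r s => by rw [hd.apply]) hj.H_e hj.H_f (fun r s => by
      rw [hj.e_f, mul_smul, Algebra.algebraMap_eq_smul_one])
  have hq (x y : Fin N → R) : ∑ r, ∑ s, x r * algebraMap ℂ R (d r s) * y s = quad d x y := by
    refine Finset.sum_congr rfl fun r _ => Finset.sum_congr rfl fun s _ => ?_
    rw [← Algebra.commutes, mul_assoc, ← Algebra.smul_def]
  have hH : θ (splitH d) = θ (ι (H N)) - (1 / 4 : ℂ) •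
      ((∑ r, ∑ s, θ (ι (f r)) * algebraMap ℂ R (d r s) * θ (ι (e s))) +
        ∑ r, ∑ s, θ (ι (e r)) * algebraMap ℂ R (d r s) * θ (ι (f s))) := by
    rw [hom_splitH, metaH, hq (fun r => θ (ι (f r))) (fun r => θ (ι (e r))),
      hq (fun r => θ (ι (e r))) (fun r => θ (ι (f r)))]
  have hE : θ (splitE d) = θ (ι (E N)) - (1 / 4 : ℂ) •
      ∑ r, ∑ s, θ (ι (e r)) * algebraMap ℂ R (d r s) * θ (ι (e s)) := by
    rw [hom_splitE, metaE, hq (fun r => θ (ι (e r))) (fun r => θ (ι (e r)))]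
  have hF : θ (splitF d) = θ (ι (F N)) + (1 / 4 : ℂ) •
      ∑ r, ∑ s, θ (ι (f r)) * algebraMap ℂ R (d r s) * θ (ι (f s)) := by
    rw [hom_splitF, metaF, hq (fun r => θ (ι (f r))) (fun r => θ (ι (f r))), sub_neg_eq_add]
  rw [hom_liftH, hom_liftM, hom_liftP, hs.casimir_cayley, ← pow_two, hH, hE, hF, key]
  simp only [casimir, map_add, map_sub, map_mul, map_sum, map_smul, hom_detZ θ hZ, hom_adjZ θ hZ,
    hom_minor θ hZ, hmin, hadj, Matrix.smul_apply, smul_eq_mul]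
  simp only [mul_assoc (algebraMap ℂ R c.det), ← Finset.mul_sum]
  simp only [Algebra.algebraMap_eq_smul_one, smul_mul_assoc, mul_smul_comm, one_mul, mul_one,
    smul_add, smul_sub, sub_mul]
  module

/-- A subalgebra that contains the images of the lifts contains the image of the enveloping
algebra. -/
theorem hom_mem_of_lifts_mem (θ : U N →ₐ[ℂ] R)
    (hZ : ∀ r s, θ (ι (Z r s)) = algebraMap ℂ R (c r s)) (hcd : c * d = 1)
    (S : Subalgebra ℂ R) (hh : θ (liftH d) ∈ S) (hp : θ (liftP d) ∈ S) (hm : θ (liftM d) ∈ S)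
    (hy : ∀ r, θ (liftY r) ∈ S) (hD : ∀ r, θ (liftD d r) ∈ S) (u : U N) : θ u ∈ S := by
  have hb (r : Fin N) : cayB (fun r => θ (ι (e r))) (fun r => θ (ι (f r))) r
      = ∑ s, (4 * Complex.I * c r s) • θ (liftD d s) := by
    have h1 (s : Fin N) : θ (liftD d s) = cayD d (fun r => θ (ι (e r))) (fun r => θ (ι (f r))) s :=
      congrFun (hom_liftD θ) s
    simp only [h1, cayD, Finset.smul_sum, smul_smul]
    rw [Finset.sum_comm]
    have h2 : ∀ t, ∑ s, (4 * Complex.I * c r s * (-(Complex.I / 4) * d s t)) = if r = t then 1 else 0 := by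
      intro t
      have h3 := congrFun (congrFun hcd r) t
      rw [Matrix.mul_apply, Matrix.one_apply] at h3
      rw [← h3]
      refine Finset.sum_congr rfl fun s _ => ?_
      linear_combination (-(c r s * d s t)) * Complex.I_mul_I
    simp only [← Finset.sum_smul, h2]
    simp
  have hbS (r : Fin N) : cayB (fun r => θ (ι (e r))) (fun r => θ (ι (f r))) r ∈ S := by
    rw [hb]
    exact S.sum_mem fun s _ => S.smul_mem (hD s) _
  have hyS (r : Fin N) : cayY (fun r => θ (ι (e r))) (fun r => θ (ι (f r))) r ∈ S := by
    rw [← hom_liftY]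
    exact hy r
  have he (r : Fin N) : θ (ι (e r)) ∈ S := by
    have : θ (ι (e r)) = (1 / 2 : ℂ) • (cayY (fun r => θ (ι (e r))) (fun r => θ (ι (f r))) r
        + cayB (fun r => θ (ι (e r))) (fun r => θ (ι (f r))) r) := by
      rw [cayY, cayB]
      module
    rw [this]
    exact S.smul_mem (S.add_mem (hyS r) (hbS r)) _
  have hf (r : Fin N) : θ (ι (f r)) ∈ S := by
    have : θ (ι (f r)) = (Complex.I / 2) • (cayY (fun r => θ (ι (e r))) (fun r => θ (ι (f r))) r
        - cayB (fun r => θ (ι (e r))) (fun r => θ (ι (f r))) r) := by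
      rw [cayY, cayB]
      match_scalars <;> ring_nf <;> simp
    rw [this]
    exact S.smul_mem (S.sub_mem (hyS r) (hbS r)) _
  have hq {x y : Fin N → R} (hx : ∀ r, x r ∈ S) (hy : ∀ r, y r ∈ S) : quad d x y ∈ S :=
    S.sum_mem fun r _ => S.sum_mem fun s _ => S.smul_mem (S.mul_mem (hx r) (hy s)) _
  have hH : θ (ι (H N)) ∈ S := by
    have : θ (ι (H N)) = θ (liftP d) + θ (liftM d)
        + metaH d (fun r => θ (ι (e r))) (fun r => θ (ι (f r))) := by
      rw [hom_liftP, hom_liftM, cayP, cayM, hom_splitH]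
      module
    rw [this]
    exact S.add_mem (S.add_mem hp hm) (S.smul_mem (S.add_mem (hq hf he) (hq he hf)) _)
  have hE : θ (ι (E N)) ∈ S := by
    have : θ (ι (E N)) = -(Complex.I / 2) • (θ (liftP d) - θ (liftM d) - θ (liftH d))
        + metaE d (fun r => θ (ι (e r))) := by
      rw [hom_liftP, hom_liftM, hom_liftH, cayP, cayM, cayH, hom_splitE]
      match_scalars <;> ring_nf <;> simp
    rw [this]
    exact S.add_mem (S.smul_mem (S.sub_mem (S.sub_mem hp hm) hh) _) (S.smul_mem (hq he he) _)
  have hF : θ (ι (F N)) ∈ S := by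
    have : θ (ι (F N)) = -(Complex.I / 2) • (θ (liftP d) - θ (liftM d) + θ (liftH d))
        + metaF d (fun r => θ (ι (f r))) := by
      rw [hom_liftP, hom_liftM, hom_liftH, cayP, cayM, cayH, hom_splitF]
      match_scalars <;> ring_nf <;> simp
    rw [this]
    exact S.add_mem (S.smul_mem (S.add_mem (S.sub_mem hp hm) hh) _)
      (S.neg_mem (S.smul_mem (hq hf hf) _))
  refine U_mul_induction (P := fun u => θ u ∈ S) ?_ ?_ ?_ ?_ u
  · rw [map_one]; exact S.one_mem
  · intro u v hu hv; rw [map_add]; exact S.add_mem hu hv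
  · intro a u hu; rw [map_smul]; exact S.smul_mem hu a
  · intro x u hu
    rw [map_mul]
    refine S.mul_mem ?_ hu
    rw [alg_eq_sum x]
    simp only [map_add, map_sum, map_smul, hZ]
    refine S.add_mem (S.add_mem (S.add_mem (S.add_mem (S.smul_mem hH _) (S.smul_mem hE _))
      (S.smul_mem hF _)) ?_) ?_
    · exact S.sum_mem fun r _ => S.add_mem (S.smul_mem (hf r) _) (S.smul_mem (he r) _)
    · exact S.sum_mem fun r _ => S.sum_mem fun s _ => S.smul_mem (S.algebraMap_mem _) _

/-! Weights of the lifts under the isotropy subalgebra -/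

theorem ι_commutator (x y z : Alg N) (h : ⁅x, y⁆ = z) : ι x * ι y = ι y * ι x + ι z := by
  rw [ι_mul, h]

/-- The weights `1`, `-1` and `2` of the lifts `liftY`, `liftD` and `liftP` hold in the enveloping
algebra itself, with `Z` unspecialized. Hence products of lifts of total weight zero are genuine
invariants, not merely invariants modulo the slash ideal. -/
theorem tildeH_mul_liftY (r : Fin N) :
    ι (tildeH (N := N)).1 * liftY r = liftY r * ι (tildeH (N := N)).1 + liftY r := by
  have h1 := ι_commutator _ _ _ (F_lie_e r)
  have h2 := ι_commutator _ _ _ (F_lie_f r)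
  have h3 := ι_commutator _ _ _ (E_lie_e r)
  have h4 := ι_commutator _ _ _ (E_lie_f r)
  rw [ι_tildeH, liftY, cayY, cayH]
  simp only [smul_mul_assoc, mul_smul_comm, mul_sub, sub_mul, h1, h2, h3, h4, map_zero, map_neg]
  match_scalars <;> ring_nf <;> simp

theorem tildeH_mul_cayB (r : Fin N) :
    ι (tildeH (N := N)).1 * cayB (fun r => ι (e r)) (fun r => ι (f r)) r
      = cayB (fun r => ι (e r)) (fun r => ι (f r)) r * ι (tildeH (N := N)).1
        - cayB (fun r => ι (e r)) (fun r => ι (f r)) r := by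
  have h1 := ι_commutator _ _ _ (F_lie_e r)
  have h2 := ι_commutator _ _ _ (F_lie_f r)
  have h3 := ι_commutator _ _ _ (E_lie_e r)
  have h4 := ι_commutator _ _ _ (E_lie_f r)
  rw [ι_tildeH, cayB, cayH]
  simp only [smul_mul_assoc, mul_smul_comm, mul_sub, sub_mul, mul_add, add_mul, h1, h2, h3, h4,
    map_zero, map_neg]
  match_scalars <;> ring_nf <;> simp

theorem tildeH_mul_liftD (r : Fin N) :
    ι (tildeH (N := N)).1 * liftD d r = liftD d r * ι (tildeH (N := N)).1 - liftD d r := by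
  simp only [liftD, cayD, Finset.mul_sum, Finset.sum_mul, mul_smul_comm, smul_mul_assoc,
    tildeH_mul_cayB, smul_sub, Finset.sum_sub_distrib]

theorem tildeH_mul_liftP :
    ι (tildeH (N := N)).1 * liftP d = liftP d * ι (tildeH (N := N)).1 + (2 : ℂ) • liftP d := by
  -- The metaplectic part of the raising operator is purely quadratic in the creation operators,
  -- which have weight one, so it has weight two like the raising operator of `sl₂`.
  have h1 : liftP d = cayP (ι (H N)) (ι (E N)) (ι (F N)) - (Complex.I / 8) •
      quad d (fun r => liftY r) (fun r => liftY r) := by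
    have : quad d (fun r => (liftY r : U N)) (fun r => liftY r)
        = quad d (fun r => ι (e r)) (fun r => ι (e r))
          - quad d (fun r => ι (f r)) (fun r => ι (f r))
          - Complex.I • (quad d (fun r => ι (e r)) (fun r => ι (f r))
            + quad d (fun r => ι (f r)) (fun r => ι (e r))) := by
      simp only [quad, liftY, cayY, Finset.smul_sum, ← Finset.sum_sub_distrib,
        ← Finset.sum_add_distrib]
      refine Finset.sum_congr rfl fun r _ => Finset.sum_congr rfl fun s _ => ?_
      simp only [smul_mul_assoc, mul_smul_comm, mul_sub, sub_mul]
      match_scalars <;> ring_nf <;> simp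
    rw [this, liftP, cayP, cayP, splitH, splitE, splitF, metaH, metaE, metaF]
    match_scalars <;> ring_nf <;> simp <;> ring
  have h2 : ι (tildeH (N := N)).1 * cayP (ι (H N)) (ι (E N)) (ι (F N))
      = cayP (ι (H N)) (ι (E N)) (ι (F N)) * ι (tildeH (N := N)).1
        + (2 : ℂ) • cayP (ι (H N)) (ι (E N)) (ι (F N)) := by
    have h3 := ι_commutator _ _ _ (H_lie_E (N := N))
    have h4 := ι_commutator _ _ _ (H_lie_F (N := N))
    have h5 := ι_commutator _ _ _ (E_lie_F (N := N))
    rw [ι_tildeH, cayP, cayH]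
    simp only [smul_mul_assoc, mul_smul_comm, mul_sub, sub_mul, mul_add, add_mul, h3, h4, h5,
      map_neg, ι_smul, smul_add, smul_sub]
    match_scalars <;> ring_nf <;> simp <;> ring
  have h6 := mul_quad (X := ι (tildeH (N := N)).1) d (fun r => tildeH_mul_liftY (N := N) r)
    (fun r => tildeH_mul_liftY r)
  rw [h1, mul_sub, h2, mul_smul_comm, h6, sub_mul, smul_mul_assoc]
  module

end Lifts

/-! ## A model by weighted shift operators -/

variable (N) in
/-- The ring of coefficients of the model, with one variable for the Casimir operator of `sl₂` and
one for each degree operator. -/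
abbrev Coef : Type := MvPolynomial (Option (Fin N)) ℂ

variable (N) in
/-- The lattice of weights of the model. -/
abbrev Lat : Type := Option (Fin N) → ℤ

variable (N) in
/-- The space of the model. -/
abbrev Model : Type := Lat N → Coef N

/-- The weighted shift `F ↦ (n ↦ a n F(n + v))`. -/
noncomputable def wShift (a : Lat N → Coef N) (v : Lat N) : Module.End (Coef N) (Model N) where
  toFun F n := a n * F (n + v)
  map_add' F G := by funext n; simp [mul_add]
  map_smul' q F := by funext n; simp [mul_left_comm]

theorem wShift_apply (a : Lat N → Coef N) (v : Lat N) (F : Model N) (n : Lat N) :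
    wShift a v F n = a n * F (n + v) := rfl

theorem wShift_mul (a b : Lat N → Coef N) (v w : Lat N) :
    wShift a v * wShift b w = wShift (fun n => a n * b (n + v)) (v + w) := by
  refine LinearMap.ext fun F => funext fun n => ?_
  simp [wShift_apply, Module.End.mul_apply, mul_assoc, add_assoc]

theorem wShift_add (a b : Lat N → Coef N) (v : Lat N) :
    wShift a v + wShift b v = wShift (fun n => a n + b n) v := by
  refine LinearMap.ext fun F => funext fun n => ?_
  simp [wShift_apply, add_mul]

theorem wShift_sub (a b : Lat N → Coef N) (v : Lat N) :
    wShift a v - wShift b v = wShift (fun n => a n - b n) v := by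
  refine LinearMap.ext fun F => funext fun n => ?_
  simp [wShift_apply, sub_mul]

theorem smul_wShift (z : ℂ) (a : Lat N → Coef N) (v : Lat N) :
    z • wShift a v = wShift (fun n => MvPolynomial.C z * a n) v := by
  refine LinearMap.ext fun F => funext fun n => ?_
  simp [wShift_apply, MvPolynomial.smul_eq_C_mul, mul_assoc]

theorem one_eq_wShift : (1 : Module.End (Coef N) (Model N)) = wShift (fun _ => 1) 0 := by
  refine LinearMap.ext fun F => funext fun n => ?_
  simp [wShift_apply]

variable (k : ℂ)

/-- The weights of the semisimple element. -/
noncomputable def hVal (n : Lat N) : Coef N :=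
  MvPolynomial.C (k - N / 2 + 2 * n none) - ∑ r, MvPolynomial.X (some r)

/-- The coefficients of the lowering operator. -/
noncomputable def mVal (n : Lat N) : Coef N :=
  MvPolynomial.C (1 / 4) * (MvPolynomial.X none - hVal k n ^ 2 - 2 * hVal k n)

/-- The weights of the degree operators. -/
noncomputable def gVal (r : Fin N) (n : Lat N) : Coef N :=
  MvPolynomial.X (some r) + MvPolynomial.C (n (some r) : ℂ)

/-- The semisimple element in the model. -/
noncomputable def modH : Module.End (Coef N) (Model N) := wShift (hVal k) 0

/-- The raising operator in the model. -/
noncomputable def modP : Module.End (Coef N) (Model N) := wShift (fun _ => 1) (-Pi.single none 1)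

/-- The lowering operator in the model. -/
noncomputable def modM : Module.End (Coef N) (Model N) := wShift (mVal k) (Pi.single none 1)

/-- The creation operators in the model. -/
noncomputable def modY (r : Fin N) : Module.End (Coef N) (Model N) :=
  wShift (fun _ => 1) (-Pi.single (some r) 1)

/-- The annihilation operators in the model. -/
noncomputable def modD (r : Fin N) : Module.End (Coef N) (Model N) :=
  wShift (fun n => gVal r (n + Pi.single (some r) 1)) (Pi.single (some r) 1)

theorem hVal_add (n v : Lat N) : hVal k (n + v) = hVal k n + MvPolynomial.C (2 * (v none : ℂ)) := by
  simp only [hVal, Pi.add_apply, Int.cast_add, mul_add, map_add]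
  ring

theorem gVal_add (r : Fin N) (n v : Lat N) :
    gVal r (n + v) = gVal r n + MvPolynomial.C (v (some r) : ℂ) := by
  simp only [gVal, Pi.add_apply, Int.cast_add, map_add]
  ring

theorem modM_mul_modP : modM (N := N) k * modP = wShift (mVal k) 0 := by
  rw [modM, modP, wShift_mul]
  simp

theorem modY_mul_modD (r : Fin N) : modY r * modD r = wShift (gVal r) 0 := by
  rw [modY, modD, wShift_mul]
  simp

/-- The coefficients are dictated by the intended action at the origin: `y_r D_r` is `X (some r)`,
and `H̃ = h + ∑ y_r D_r + N/2` must be `k`, which determines `h`. The product `m p` is then solved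
from the equation `h² + 2h + 4mp = X none`. The relation between `p` and `m` is the identity `mVal
(n - v) = mVal n + hVal n`, with `v` the unit vector at `none`. -/
theorem oscRel_model : OscRel (N := N) (modH k) modP (modM k) modY modD where
  h_p := by
    simp only [modH, modP, wShift_mul, smul_wShift, zero_add, add_zero, wShift_add, hVal_add]
    congr 1
    funext n
    simp
  h_m := by
    simp only [modH, modM, wShift_mul, smul_wShift, zero_add, add_zero, wShift_sub, hVal_add]
    congr 1
    funext n
    simp
    ring
  p_m := by
    rw [modM_mul_modP, modP, modM, modH, wShift_mul, wShift_add, neg_add_cancel]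
    congr 1
    funext n
    have h4 : (MvPolynomial.C (1 / 4) : Coef N) * 4 = 1 := by
      rw [show (4 : Coef N) = MvPolynomial.C 4 from (map_ofNat MvPolynomial.C 4).symm, ← map_mul]
      norm_num
    have h2 : (MvPolynomial.C (2 * ((-1 : ℤ) : ℂ)) : Coef N) = -2 := by
      rw [show (2 * ((-1 : ℤ) : ℂ)) = -2 by norm_num, map_neg, map_ofNat]
    simp only [mVal, hVal_add, Pi.neg_apply, Pi.single_eq_same, h2]
    linear_combination (hVal k n) * h4
  h_y r := by
    simp [modH, modY, wShift_mul, hVal_add]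
  h_D r := by
    simp [modH, modD, wShift_mul, hVal_add, mul_comm]
  p_y r := by
    simp [modP, modY, wShift_mul, add_comm]
  p_D r := by
    simp [modP, modD, wShift_mul, gVal_add, add_comm]
  m_y r := by
    simp [modM, modY, wShift_mul, mVal, hVal_add, add_comm]
  m_D r := by
    simp [modM, modD, wShift_mul, mVal, hVal_add, gVal_add, add_comm, mul_comm]
  y_y r s := by
    simp [modY, wShift_mul, add_comm]
  D_D r s := by
    by_cases hrs : r = s
    · rw [hrs]
    · simp [modD, wShift_mul, gVal_add, add_comm, mul_comm, hrs, Ne.symm hrs]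
  D_y r s := by
    by_cases hrs : r = s
    · subst hrs
      rw [modY_mul_modD, if_pos rfl, one_eq_wShift, modD, modY, wShift_mul, wShift_add,
        add_neg_cancel]
      congr 1
      funext n
      simp [gVal_add]
    · rw [if_neg hrs]
      simp [modD, modY, wShift_mul, gVal_add, add_comm, hrs]

theorem modH_casimir : modH (N := N) k * modH k + (2 : ℂ) • modH k + (4 : ℂ) • (modM k * modP)
    = wShift (fun _ => MvPolynomial.X none) 0 := by
  rw [modM_mul_modP, modH, wShift_mul, smul_wShift, smul_wShift, add_zero, wShift_add, wShift_add]
  congr 1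
  funext n
  have h4 : (MvPolynomial.C 4 : Coef N) * MvPolynomial.C (1 / 4) = 1 := by
    rw [← map_mul]
    norm_num
  have h2 : (MvPolynomial.C 2 : Coef N) = 2 := map_ofNat MvPolynomial.C 2
  rw [mVal, add_zero, h2]
  linear_combination (MvPolynomial.X none - hVal k n ^ 2 - 2 * hVal k n) * h4

variable (N) in
/-- The generator of the model. -/
noncomputable def vac : Model N := Pi.single 0 1

/-- A shift vector `v` moves supports by `-v`; this is why the raising operators have negative shift
vectors. -/
theorem wShift_single (a : Lat N → Coef N) (v n : Lat N) (q : Coef N) :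
    wShift a v (Pi.single n q) = Pi.single (n - v) (a (n - v) * q) := by
  funext m
  rw [wShift_apply, Pi.single_apply, Pi.single_apply]
  by_cases h : m + v = n
  · rw [if_pos h, if_pos (by rw [← h, add_sub_cancel_right]), ← h, add_sub_cancel_right]
  · rw [if_neg h, if_neg (fun h' => h (by rw [h', sub_add_cancel])), mul_zero]

/-! ## Words in the raising and lowering operators -/

/-- Evaluation of polynomials needs a commutative target, which the subalgebra generated by
commuting elements provides. -/
theorem exists_algHom_of_commute {σ R : Type*} [Ring R] [Algebra ℂ R] (t : σ → R)
    (ht : ∀ i j, t i * t j = t j * t i) :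
    ∃ Φ : MvPolynomial σ ℂ →ₐ[ℂ] R, ∀ i, Φ (MvPolynomial.X i) = t i := by
  let S := Algebra.adjoin ℂ (Set.range t)
  let _ : CommRing S := Algebra.adjoinCommRingOfComm ℂ (by
    rintro _ ⟨i, rfl⟩ _ ⟨j, rfl⟩
    exact ht i j)
  refine ⟨S.val.comp (MvPolynomial.aeval fun i => (⟨t i, Algebra.subset_adjoin ⟨i, rfl⟩⟩ : S)),
    fun i => ?_⟩
  rw [AlgHom.comp_apply, MvPolynomial.aeval_X]
  rfl

section Words

variable {R : Type*} [Ring R]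

/-- The `a`-th power of the raising operator, or the `-a`-th power of the lowering operator. -/
def zpw (X Y : R) (a : ℤ) : R := if 0 ≤ a then X ^ a.toNat else Y ^ (-a).toNat

theorem zpw_zero (X Y : R) : zpw X Y 0 = 1 := by simp [zpw]

theorem mul_zpw_of_nonneg (X Y : R) {a : ℤ} (ha : 0 ≤ a) : X * zpw X Y a = zpw X Y (a + 1) := by
  rw [zpw, zpw, if_pos ha, if_pos (by omega), show (a + 1).toNat = a.toNat + 1 by omega, pow_succ']

theorem mul_zpw_of_nonpos (X Y : R) {a : ℤ} (ha : a ≤ 0) : Y * zpw X Y a = zpw X Y (a - 1) := by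
  rcases ha.eq_or_lt with rfl | ha
  · simp [zpw]
  · rw [zpw, zpw, if_neg (by omega), if_neg (by omega),
      show (-(a - 1)).toNat = (-a).toNat + 1 by omega, pow_succ']

theorem commute_zpw {T X Y : R} (hX : T * X = X * T) (hY : T * Y = Y * T) (a : ℤ) :
    T * zpw X Y a = zpw X Y a * T := by
  rw [zpw]
  split_ifs
  · exact (Commute.pow_right hX _ : Commute _ _)
  · exact (Commute.pow_right hY _ : Commute _ _)

theorem weight_zpw {T X Y : R} (hX : T * X = X * (T + 1)) (hY : T * Y = Y * (T - 1)) (a : ℤ) :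
    T * zpw X Y a = zpw X Y a * (T + a) := by
  rw [zpw]
  split_ifs with ha
  · obtain ⟨n, rfl⟩ := Int.eq_ofNat_of_zero_le ha
    simp only [Int.toNat_natCast, Int.cast_natCast]
    clear ha
    induction n with
    | zero => simp
    | succ n ih =>
      rw [pow_succ, ← mul_assoc, ih, mul_assoc, mul_assoc, add_mul, hX, (n.cast_commute X).eq]
      push_cast
      noncomm_ring
  · obtain ⟨n, hn⟩ := Int.eq_ofNat_of_zero_le (show 0 ≤ -a by omega)
    obtain rfl : a = -(n : ℤ) := by omega
    simp only [neg_neg, Int.toNat_natCast, Int.cast_neg, Int.cast_natCast]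
    clear ha hn
    induction n with
    | zero => simp
    | succ n ih =>
      rw [pow_succ, ← mul_assoc, ih, mul_assoc, mul_assoc, add_mul, hY, neg_mul,
        (n.cast_commute Y).eq]
      push_cast
      noncomm_ring

variable {σ : Type*}

/-- An ordered product of powers of raising or lowering operators. -/
def wordL (X Y : σ → R) (l : List σ) (n : σ → ℤ) : R := (l.map fun i => zpw (X i) (Y i) (n i)).prod

theorem wordL_cons (X Y : σ → R) (i : σ) (l : List σ) (n : σ → ℤ) :
    wordL X Y (i :: l) n = zpw (X i) (Y i) (n i) * wordL X Y l n := by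
  simp [wordL]

theorem commute_wordL {T : R} (X Y : σ → R) (l : List σ) (n : σ → ℤ)
    (hX : ∀ i ∈ l, T * X i = X i * T) (hY : ∀ i ∈ l, T * Y i = Y i * T) :
    T * wordL X Y l n = wordL X Y l n * T := by
  induction l with
  | nil => simp [wordL]
  | cons i l ih =>
    rw [wordL_cons, ← mul_assoc, commute_zpw (hX i (by simp)) (hY i (by simp)), mul_assoc,
      ih (fun j hj => hX j (by simp [hj])) (fun j hj => hY j (by simp [hj])), mul_assoc]

theorem wordL_congr (X Y : σ → R) (l : List σ) {n n' : σ → ℤ} (h : ∀ i ∈ l, n i = n' i) :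
    wordL X Y l n = wordL X Y l n' := by
  rw [wordL, wordL]
  congr 1
  exact List.map_congr_left fun i hi => by rw [h i hi]

/-- One factor of a word may be moved to the left. -/
theorem exists_wordL_eq_mul (X Y : σ → R) (hc : ∀ i j, i ≠ j → X i * X j = X j * X i ∧
      X i * Y j = Y j * X i ∧ Y i * X j = X j * Y i ∧ Y i * Y j = Y j * Y i)
    (l : List σ) (hl : l.Nodup) (i : σ) (hi : i ∈ l) (n : σ → ℤ) :
    ∃ T : R, (∀ n', (∀ j, j ≠ i → n' j = n j) →
        wordL X Y l n' = zpw (X i) (Y i) (n' i) * T) ∧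
      ∀ V : R, (∀ j, j ≠ i → V * X j = X j * V ∧ V * Y j = Y j * V) → V * T = T * V := by
  induction l with
  | nil => simp at hi
  | cons j l ih =>
    rw [List.nodup_cons] at hl
    by_cases hij : i = j
    · subst hij
      have hne : ∀ j ∈ l, j ≠ i := fun j hj h => hl.1 (h ▸ hj)
      refine ⟨wordL X Y l n, fun n' hn' => ?_, fun V hV => ?_⟩
      · rw [wordL_cons, wordL_congr X Y l fun j hj => hn' j (hne j hj)]
      · exact commute_wordL X Y l n (fun j hj => (hV j (hne j hj)).1)
          (fun j hj => (hV j (hne j hj)).2)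
    · obtain ⟨T, hT, hT'⟩ := ih hl.2 (by simpa [hij] using hi)
      refine ⟨zpw (X j) (Y j) (n j) * T, fun n' hn' => ?_, fun V hV => ?_⟩
      · obtain ⟨h1, h2, h3, h4⟩ := hc i j hij
        have h5 : zpw (X i) (Y i) (n' i) * zpw (X j) (Y j) (n j)
            = zpw (X j) (Y j) (n j) * zpw (X i) (Y i) (n' i) :=
          commute_zpw (commute_zpw h1.symm h3.symm _).symm (commute_zpw h2.symm h4.symm _).symm _
        rw [wordL_cons, hT n' hn', hn' j (Ne.symm hij), ← mul_assoc, ← mul_assoc, h5]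
      · obtain ⟨h1, h2⟩ := hV j (Ne.symm hij)
        rw [← mul_assoc, commute_zpw h1 h2, mul_assoc, hT' V hV, mul_assoc]

end Words

/-! ## Words in the adapted generators -/

section Gen

variable {R : Type*} [Ring R] [Algebra ℂ R]

/-- The raising operators. -/
def genX (p : R) (y : Fin N → R) (i : Option (Fin N)) : R := i.elim p y

variable (N) in
/-- The word with exponents `n`. -/
noncomputable def word (p m : R) (y D : Fin N → R) (n : Lat N) : R :=
  wordL (genX p y) (genX m D) (Finset.univ : Finset (Option (Fin N))).toList n

theorem hom_word {R' : Type*} [Ring R'] [Algebra ℂ R'] (θ : R →ₐ[ℂ] R') (p m : R) (y D : Fin N → R)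
    (n : Lat N) : θ (word N p m y D n)
      = word N (θ p) (θ m) (fun r => θ (y r)) (fun r => θ (D r)) n := by
  simp only [word, wordL, map_list_prod, List.map_map]
  congr 1
  refine List.map_congr_left fun i _ => ?_
  simp only [Function.comp, zpw, apply_ite θ, map_pow]
  cases i <;> rfl

variable {h p m : R} {y D : Fin N → R}

theorem word_zero : word N p m y D 0 = 1 := by
  simp [word, wordL, zpw_zero]

/-- The degree operators. -/
noncomputable def genW (h : R) (y D : Fin N → R) (i : Option (Fin N)) : R :=
  i.elim ((1 / 2 : ℂ) • h) fun r => y r * D r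

/-- The Casimir operator of the adapted triple. -/
noncomputable def oscCasimir (h p m : R) : R := h * h + (2 : ℂ) • h + (4 : ℂ) • (m * p)

namespace OscRel

theorem gen_comm (ho : OscRel h p m y D) (i j : Option (Fin N)) (hij : i ≠ j) :
    genX p y i * genX p y j = genX p y j * genX p y i ∧
      genX p y i * genX m D j = genX m D j * genX p y i ∧
      genX m D i * genX p y j = genX p y j * genX m D i ∧
      genX m D i * genX m D j = genX m D j * genX m D i := by
  rcases i with _ | r <;> rcases j with _ | s
  · exact absurd rfl hij
  · exact ⟨ho.p_y s, ho.p_D s, ho.m_y s, ho.m_D s⟩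
  · exact ⟨(ho.p_y r).symm, (ho.m_y r).symm, (ho.p_D r).symm, (ho.m_D r).symm⟩
  · have hrs : r ≠ s := fun h => hij (by rw [h])
    refine ⟨ho.y_y r s, ?_, ?_, ho.D_D r s⟩
    · have := ho.D_y s r
      rw [if_neg hrs.symm, add_zero] at this
      exact this.symm
    · have := ho.D_y r s
      rwa [if_neg hrs, add_zero] at this

theorem weight_X (ho : OscRel h p m y D) (i j : Option (Fin N)) :
    genW h y D i * genX p y j = genX p y j * (genW h y D i + if i = j then 1 else 0) := by
  rcases i with _ | r <;> rcases j with _ | s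
  · simp only [genW, genX, Option.elim, if_true, smul_mul_assoc, ho.h_p, mul_add, mul_smul_comm,
      mul_one]
    module
  · simp [genW, genX, ho.h_y]
  · simp only [genW, genX, Option.elim, reduceCtorEq, if_false, add_zero]
    rw [mul_assoc, ← ho.p_D, ← mul_assoc, ← ho.p_y, mul_assoc]
  · simp only [genW, genX, Option.elim, Option.some.injEq]
    rw [mul_assoc, ho.D_y, mul_add, mul_add, ← mul_assoc, ho.y_y, mul_assoc]
    split_ifs with hrs
    · rw [hrs]
    · simp

theorem weight_Y (ho : OscRel h p m y D) (i j : Option (Fin N)) :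
    genW h y D i * genX m D j = genX m D j * (genW h y D i - if i = j then 1 else 0) := by
  rcases i with _ | r <;> rcases j with _ | s
  · simp only [genW, genX, Option.elim, if_true, smul_mul_assoc, ho.h_m, mul_sub, mul_smul_comm,
      mul_one]
    module
  · simp [genW, genX, ho.h_D]
  · simp only [genW, genX, Option.elim, reduceCtorEq, if_false, sub_zero]
    rw [mul_assoc, ← ho.m_D, ← mul_assoc, ← ho.m_y, mul_assoc]
  · simp only [genW, genX, Option.elim, Option.some.injEq]
    rw [mul_sub, ← mul_assoc, ho.D_y, add_mul, mul_assoc, mul_assoc, ho.D_D]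
    by_cases hrs : r = s
    · subst hrs; simp
    · simp [hrs, Ne.symm hrs]

/-- The `i`-th degree operator commutes with all letters of other indices, so only the factor with
index `i`, moved to the front, shifts it. -/
theorem weight_word (ho : OscRel h p m y D) (i : Option (Fin N)) (n : Lat N) :
    genW h y D i * word N p m y D n = word N p m y D n * (genW h y D i + (n i : R)) := by
  obtain ⟨T, hT, hT'⟩ := exists_wordL_eq_mul (genX p y) (genX m D) ho.gen_comm _
    (Finset.nodup_toList Finset.univ) i (by simp) n
  have h1 : genW h y D i * T = T * genW h y D i := by
    refine hT' _ fun j hj => ⟨?_, ?_⟩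
    · rw [ho.weight_X, if_neg hj.symm, add_zero]
    · rw [ho.weight_Y, if_neg hj.symm, sub_zero]
  rw [word, hT n fun _ _ => rfl, ← mul_assoc, weight_zpw (by rw [ho.weight_X, if_pos rfl])
    (by rw [ho.weight_Y, if_pos rfl]), mul_assoc, mul_assoc, mul_add T, add_mul, h1,
    ((n i).cast_commute T).eq]

/-- If the `i`-th exponent is nonnegative, the word grows. If it is negative, the new letter meets a
lowering letter; the pair is an operator of degree zero acting on a shorter word. In both cases the
result belongs to the neighbouring lattice point. -/
theorem X_mul_word (ho : OscRel h p m y D) (i : Option (Fin N)) (n : Lat N) :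
    genX p y i * word N p m y D n = word N p m y D (n + Pi.single i 1) ∨
      genX p y i * word N p m y D n
        = genX p y i * genX m D i * word N p m y D (n + Pi.single i 1) := by
  obtain ⟨T, hT, -⟩ := exists_wordL_eq_mul (genX p y) (genX m D) ho.gen_comm _
    (Finset.nodup_toList Finset.univ) i (by simp) n
  have h1 := hT n fun _ _ => rfl
  have h2 := hT (n + Pi.single i 1) fun j hj => by simp [hj]
  rw [Pi.add_apply, Pi.single_eq_same] at h2
  rcases le_or_gt 0 (n i) with hn | hn
  · left
    rw [word, word, h1, h2, ← mul_assoc, mul_zpw_of_nonneg _ _ hn]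
  · right
    rw [word, word, h1, h2, mul_assoc, ← mul_assoc (genX m D i),
      mul_zpw_of_nonpos _ _ (show n i + 1 ≤ 0 by omega), add_sub_cancel_right]

theorem Y_mul_word (ho : OscRel h p m y D) (i : Option (Fin N)) (n : Lat N) :
    genX m D i * word N p m y D n = word N p m y D (n - Pi.single i 1) ∨
      genX m D i * word N p m y D n
        = genX m D i * genX p y i * word N p m y D (n - Pi.single i 1) := by
  obtain ⟨T, hT, -⟩ := exists_wordL_eq_mul (genX p y) (genX m D) ho.gen_comm _
    (Finset.nodup_toList Finset.univ) i (by simp) n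
  have h1 := hT n fun _ _ => rfl
  have h2 := hT (n - Pi.single i 1) fun j hj => by simp [hj]
  rw [Pi.sub_apply, Pi.single_eq_same] at h2
  rcases le_or_gt (n i) 0 with hn | hn
  · left
    rw [word, word, h1, h2, ← mul_assoc, mul_zpw_of_nonpos _ _ hn]
  · right
    rw [word, word, h1, h2, mul_assoc, ← mul_assoc (genX p y i),
      mul_zpw_of_nonneg _ _ (show 0 ≤ n i - 1 by omega), sub_add_cancel]

theorem oscCasimir_comm (ho : OscRel h p m y D) (i : Option (Fin N)) :
    oscCasimir h p m * genX p y i = genX p y i * oscCasimir h p m ∧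
      oscCasimir h p m * genX m D i = genX m D i * oscCasimir h p m := by
  rcases i with _ | r
  · have hp : p * h = h * p - (2 : ℂ) • p := by rw [ho.h_p]; abel
    have hm : m * h = h * m + (2 : ℂ) • m := by rw [ho.h_m]; abel
    have hhp : p * (h * h) = h * h * p - (4 : ℂ) • (h * p) + (4 : ℂ) • p := by
      rw [← mul_assoc, hp, sub_mul, mul_assoc, hp, smul_mul_assoc, hp, mul_sub, mul_smul_comm,
        mul_assoc]
      module
    have hhm : m * (h * h) = h * h * m + (4 : ℂ) • (h * m) + (4 : ℂ) • m := by
      rw [← mul_assoc, hm, add_mul, mul_assoc, hm, smul_mul_assoc, hm, mul_add, mul_smul_comm,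
        mul_assoc]
      module
    have hpm : p * (m * p) = m * p * p + h * p := by rw [← mul_assoc, ho.p_m, add_mul]
    have hmm : m * p * m = m * (m * p) + h * m + (2 : ℂ) • m := by
      rw [mul_assoc, ho.p_m, mul_add, hm]
      abel
    constructor
    · simp only [genX, Option.elim, oscCasimir, mul_add, add_mul, mul_smul_comm, smul_mul_assoc,
        hhp, hp, hpm]
      module
    · simp only [genX, Option.elim, oscCasimir, mul_add, add_mul, mul_smul_comm, smul_mul_assoc,
        hhm, hm, hmm]
      module
  · have key (T : R) (h1 : h * T = T * h) (h2 : p * T = T * p) (h3 : m * T = T * m) :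
        oscCasimir h p m * T = T * oscCasimir h p m := by
      have h4 : h * h * T = T * (h * h) := by rw [mul_assoc, h1, ← mul_assoc, h1, mul_assoc]
      have h5 : m * p * T = T * (m * p) := by rw [mul_assoc, h2, ← mul_assoc, h3, mul_assoc]
      rw [oscCasimir, add_mul, add_mul, mul_add, mul_add, smul_mul_assoc, smul_mul_assoc, h1, h4,
        h5, mul_smul_comm, mul_smul_comm]
    exact ⟨key _ (ho.h_y r) (ho.p_y r) (ho.m_y r), key _ (ho.h_D r) (ho.p_D r) (ho.m_D r)⟩

theorem oscCasimir_word (ho : OscRel h p m y D) (n : Lat N) :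
    oscCasimir h p m * word N p m y D n = word N p m y D n * oscCasimir h p m :=
  commute_wordL _ _ _ _ (fun i _ => (ho.oscCasimir_comm i).1) fun i _ => (ho.oscCasimir_comm i).2

theorem oscCasimir_h (ho : OscRel h p m y D) : oscCasimir h p m * h = h * oscCasimir h p m := by
  have : m * p * h = h * (m * p) := by
    have hp : p * h = h * p - (2 : ℂ) • p := by rw [ho.h_p]; abel
    have hm : m * h = h * m + (2 : ℂ) • m := by rw [ho.h_m]; abel
    rw [mul_assoc, hp, mul_sub, mul_smul_comm, ← mul_assoc, hm, add_mul, smul_mul_assoc,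
      add_sub_cancel_right, mul_assoc]
  rw [oscCasimir, add_mul, add_mul, mul_add, mul_add, smul_mul_assoc, smul_mul_assoc, this,
    mul_smul_comm, mul_smul_comm, mul_assoc]

/-- The polynomials in the Casimir operator and the degree operators. -/
theorem exists_coef_hom (ho : OscRel h p m y D) : ∃ Φ : Coef N →ₐ[ℂ] R,
    Φ (MvPolynomial.X none) = oscCasimir h p m ∧
      (∀ r, Φ (MvPolynomial.X (some r)) = y r * D r) ∧ ∀ q, h * Φ q = Φ q * h := by
  have hyD (r : Fin N) (T : R) (h1 : T * y r = y r * T) (h2 : T * D r = D r * T) :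
      T * (y r * D r) = y r * D r * T := by
    rw [← mul_assoc, h1, mul_assoc, h2, mul_assoc]
  obtain ⟨Φ, hΦ⟩ := exists_algHom_of_commute
    (fun i : Option (Fin N) => i.elim (oscCasimir h p m) fun r => y r * D r) (by
      have h1 (r : Fin N) := hyD r _ (ho.oscCasimir_comm (some r)).1 (ho.oscCasimir_comm (some r)).2
      rintro (_ | r) (_ | s)
      · rfl
      · exact h1 s
      · exact (h1 r).symm
      · have hX := ho.weight_X (some r) (some s)
        have hY := ho.weight_Y (some r) (some s)
        by_cases hrs : r = s
        · rw [hrs]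
        · simp only [Option.some.injEq, hrs, if_false, add_zero, sub_zero] at hX hY
          exact hyD s _ hX hY)
  refine ⟨Φ, hΦ none, fun r => hΦ (some r), fun q => ?_⟩
  induction q using MvPolynomial.induction_on with
  | C a =>
    rw [← MvPolynomial.algebraMap_eq, AlgHom.commutes, Algebra.commutes]
  | add q q' hq hq' => rw [map_add, mul_add, add_mul, hq, hq']
  | mul_X q i hq =>
    have hi : h * Φ (MvPolynomial.X i) = Φ (MvPolynomial.X i) * h := by
      rw [hΦ]
      rcases i with _ | r
      · exact ho.oscCasimir_h.symm
      · exact hyD r h (ho.h_y r) (ho.h_D r)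
    rw [map_mul, ← mul_assoc, hq, mul_assoc, hi, mul_assoc]

end OscRel

end Gen

/-! ## Cyclic modules are spanned by words -/

section Span

variable {M : Type*} [AddCommGroup M] [Module ℂ M]

/-- The operators that preserve every member of a family of subspaces. -/
def stabilizer {σ : Type*} (W : σ → Submodule ℂ M) : Subalgebra ℂ (Module.End ℂ M) where
  carrier := {T | ∀ n, ∀ v ∈ W n, T v ∈ W n}
  mul_mem' hS hT n v hv := hS n _ (hT n v hv)
  add_mem' hS hT n v hv := (W n).add_mem (hS n v hv) (hT n v hv)
  algebraMap_mem' c n _ hv := (W n).smul_mem c hv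

variable {h p m : Module.End ℂ M} {y D : Fin N → Module.End ℂ M}

/-- The image of the word with exponents `n` and the coefficient operators. -/
noncomputable def wordSpace (p m : Module.End ℂ M) (y D : Fin N → Module.End ℂ M)
    (Φ : Coef N →ₐ[ℂ] Module.End ℂ M) (v : M) (n : Lat N) : Submodule ℂ M :=
  LinearMap.range ((word N p m y D n).comp ((LinearMap.applyₗ v).comp Φ.toLinearMap))

/-- Operators of degree zero preserve each word space, because they commute with words up to scalars
and act on `v` through coefficient operators. Raising and lowering letters move between neighbouring
word spaces. So the sum of the word spaces is stable under all the lifts, hence under the whole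
enveloping algebra, and it contains `v`. -/
theorem OscRel.hom_mem_iSup_wordSpace {c d : Matrix (Fin N) (Fin N) ℂ}
    {θ : U N →ₐ[ℂ] Module.End ℂ M}
    (ho : OscRel (θ (liftH d)) (θ (liftP d)) (θ (liftM d)) (fun r => θ (liftY r))
      (fun r => θ (liftD d r)))
    (hZ : ∀ r s, θ (ι (Z r s)) = algebraMap ℂ _ (c r s)) (hcd : c * d = 1)
    {Φ : Coef N →ₐ[ℂ] Module.End ℂ M}
    (hΦ0 : Φ (MvPolynomial.X none) = oscCasimir (θ (liftH d)) (θ (liftP d)) (θ (liftM d)))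
    (hΦ : ∀ r, Φ (MvPolynomial.X (some r)) = θ (liftY r) * θ (liftD d r))
    (hΦh : ∀ q, θ (liftH d) * Φ q = Φ q * θ (liftH d)) {v : M} {q₀ : Coef N}
    (hv : θ (liftH d) v = Φ q₀ v) (u : U N) :
    θ u v ∈ ⨆ n, wordSpace (θ (liftP d)) (θ (liftM d)) (fun r => θ (liftY r))
      (fun r => θ (liftD d r)) Φ v n := by
  set h := θ (liftH d)
  set p := θ (liftP d)
  set m := θ (liftM d)
  set y := fun r => θ (liftY r)
  set D := fun r => θ (liftD d r)
  set W := wordSpace p m y D Φ v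
  have hcas : oscCasimir h p m ∈ stabilizer W := by
    rintro n _ ⟨q, rfl⟩
    refine ⟨MvPolynomial.X none * q, ?_⟩
    have := congrArg (fun T : Module.End ℂ M => T (Φ q v)) (ho.oscCasimir_word n)
    simp only [Module.End.mul_apply] at this
    simp only [LinearMap.comp_apply, LinearMap.applyₗ_apply_apply, AlgHom.toLinearMap_apply,
      map_mul, hΦ0, Module.End.mul_apply, this]
  have hyD (r : Fin N) : y r * D r ∈ stabilizer W := by
    rintro n _ ⟨q, rfl⟩
    refine ⟨MvPolynomial.X (some r) * q + (n (some r) : ℂ) • q, ?_⟩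
    have := congrArg (fun T : Module.End ℂ M => T (Φ q v)) (ho.weight_word (some r) n)
    simp only [Module.End.mul_apply, LinearMap.add_apply, map_add] at this
    simp only [LinearMap.comp_apply, LinearMap.applyₗ_apply_apply, AlgHom.toLinearMap_apply,
      map_mul, map_add, map_smul, hΦ, Module.End.mul_apply]
    refine Eq.trans ?_ this.symm
    simp [genW, Module.End.intCast_apply, Int.cast_smul_eq_zsmul, y, D]
  have hh : h ∈ stabilizer W := by
    rintro n _ ⟨q, rfl⟩
    -- Moving `h` through the word adds twice the exponent at `none`; then `h` commutes with the
    -- coefficient operator and acts on `v` as `q₀`.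
    refine ⟨q * q₀ + (2 * (n none : ℂ)) • q, ?_⟩
    have := congrArg (fun T : Module.End ℂ M => (2 : ℂ) • T (Φ q v)) (ho.weight_word none n)
    simp only [genW, Option.elim, Module.End.mul_apply, LinearMap.add_apply, map_add,
      LinearMap.smul_apply, map_smul, smul_smul, smul_add] at this
    norm_num at this
    have h2 := congrArg (fun T : Module.End ℂ M => T v) (hΦh q)
    simp only [Module.End.mul_apply] at h2
    simp only [LinearMap.comp_apply, LinearMap.applyₗ_apply_apply, AlgHom.toLinearMap_apply,
      map_mul, map_add, map_smul, Module.End.mul_apply, ← hv, ← h2]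
    refine Eq.trans ?_ this.symm
    rw [mul_smul, Int.cast_smul_eq_zsmul]
  -- `m p` is solved from the Casimir operator, which commutes with every word, and from `h`.
  have hmp : m * p ∈ stabilizer W := by
    have : m * p = (1 / 4 : ℂ) • (oscCasimir h p m - h * h - (2 : ℂ) • h) := by
      rw [oscCasimir]
      module
    rw [this]
    exact Subalgebra.smul_mem _ (Subalgebra.sub_mem _ (Subalgebra.sub_mem _ hcas
      (Subalgebra.mul_mem _ hh hh)) (Subalgebra.smul_mem _ hh _)) _
  have hXY (i : Option (Fin N)) : genX p y i * genX m D i ∈ stabilizer W := by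
    rcases i with _ | r
    · change p * m ∈ _
      rw [ho.p_m]
      exact Subalgebra.add_mem _ hmp hh
    · exact hyD r
  have hYX (i : Option (Fin N)) : genX m D i * genX p y i ∈ stabilizer W := by
    rcases i with _ | r
    · exact hmp
    · change D r * y r ∈ _
      rw [ho.D_y, if_pos rfl]
      exact Subalgebra.add_mem _ (hyD r) (Subalgebra.one_mem _)
  have hle {T : Module.End ℂ M} (hT : ∀ n, ∀ x ∈ W n, T x ∈ ⨆ n, W n) :
      T ∈ stabilizer (fun _ : Unit => ⨆ n, W n) := by
    intro _ x hx
    have : ⨆ n, W n ≤ (⨆ n, W n).comap T := iSup_le hT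
    exact this hx
  have hmem (n : Lat N) (x : M) (hx : x ∈ W n) : x ∈ ⨆ n, W n := (le_iSup W n) hx
  have hX (i : Option (Fin N)) : genX p y i ∈ stabilizer (fun _ : Unit => ⨆ n, W n) := by
    refine hle ?_
    rintro n _ ⟨q, rfl⟩
    rcases ho.X_mul_word i n with hw | hw
    · refine hmem (n + Pi.single i 1) _ ⟨q, ?_⟩
      exact (congrArg (fun T : Module.End ℂ M => T (Φ q v)) hw).symm
    · refine hmem (n + Pi.single i 1) _ ?_
      have := congrArg (fun T : Module.End ℂ M => T (Φ q v)) hw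
      exact (Eq.symm this) ▸ hXY i _ _ ⟨q, rfl⟩
  have hY (i : Option (Fin N)) : genX m D i ∈ stabilizer (fun _ : Unit => ⨆ n, W n) := by
    refine hle ?_
    rintro n _ ⟨q, rfl⟩
    rcases ho.Y_mul_word i n with hw | hw
    · refine hmem (n - Pi.single i 1) _ ⟨q, ?_⟩
      exact (congrArg (fun T : Module.End ℂ M => T (Φ q v)) hw).symm
    · refine hmem (n - Pi.single i 1) _ ?_
      have := congrArg (fun T : Module.End ℂ M => T (Φ q v)) hw
      exact (Eq.symm this) ▸ hYX i _ _ ⟨q, rfl⟩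
  have hall := hom_mem_of_lifts_mem θ hZ hcd (stabilizer (fun _ : Unit => ⨆ n, W n))
    (hle fun n x hx => hmem n _ (hh n x hx)) (hX none) (hY none) (fun r => hX (some r))
    (fun r => hY (some r)) u
  refine hall () v (hmem 0 v ⟨1, ?_⟩)
  simp [word_zero]

end Span

/-! ## Words in the model -/

theorem hVal_eval (k : ℂ) (n : Lat N) (g : Option (Fin N) → ℂ) (hg : ∀ r, g (some r) = 0) :
    MvPolynomial.eval g (hVal k n) = k - N / 2 + 2 * n none := by
  simp [hVal, hg]

theorem mVal_ne_zero (k : ℂ) (n : Lat N) : mVal k n ≠ 0 := by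
  intro h0
  set z : ℂ := k - N / 2 + 2 * n none with hz
  -- At this point `hVal` is `z`, and the Casimir variable exceeds `z² + 2z` by one, so `mVal` takes
  -- the value `1/4`.
  obtain ⟨g, hg0, hg⟩ : ∃ g : Option (Fin N) → ℂ, g none = z ^ 2 + 2 * z + 1 ∧
      ∀ r, g (some r) = 0 := ⟨fun i => i.elim (z ^ 2 + 2 * z + 1) fun _ => 0, rfl, fun _ => rfl⟩
  have h1 := congrArg (MvPolynomial.eval g) h0
  simp only [mVal, map_mul, map_sub, map_pow, hVal_eval k n g hg, MvPolynomial.eval_X,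
    MvPolynomial.eval_C, map_zero, map_ofNat, hg0, ← hz] at h1
  have : (1 / 4 : ℂ) = 0 := by linear_combination h1
  norm_num at this

theorem gVal_ne_zero (r : Fin N) (n : Lat N) : gVal r n ≠ 0 := by
  intro h0
  have h1 := congrArg (MvPolynomial.eval (fun _ => 1 - (n (some r) : ℂ))) h0
  simp [gVal] at h1

theorem exists_zpw_single (k : ℂ) (i : Option (Fin N)) (a : ℤ) (n : Lat N) (q : Coef N)
    (hq : q ≠ 0) : ∃ q', q' ≠ 0 ∧ zpw (genX modP modY i) (genX (modM k) modD i) a (Pi.single n q)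
      = Pi.single (n + Pi.single i a) q' := by
  have hX (n : Lat N) (q : Coef N) (hq : q ≠ 0) : ∃ q', q' ≠ 0 ∧
      genX modP modY i (Pi.single n q) = Pi.single (n + Pi.single i 1) q' := by
    refine ⟨q, hq, ?_⟩
    rcases i with _ | r
    · change modP _ = _
      rw [modP, wShift_single, sub_neg_eq_add, one_mul]
    · change modY r _ = _
      rw [modY, wShift_single, sub_neg_eq_add, one_mul]
  have hY (n : Lat N) (q : Coef N) (hq : q ≠ 0) : ∃ q', q' ≠ 0 ∧
      genX (modM k) modD i (Pi.single n q) = Pi.single (n - Pi.single i 1) q' := by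
    rcases i with _ | r
    · exact ⟨_, mul_ne_zero (mVal_ne_zero k _) hq, wShift_single _ _ _ _⟩
    · exact ⟨_, mul_ne_zero (gVal_ne_zero r _) hq, wShift_single _ _ _ _⟩
  rw [zpw]
  split_ifs with ha
  · obtain ⟨b, rfl⟩ := Int.eq_ofNat_of_zero_le ha
    simp only [Int.toNat_natCast]
    clear ha
    induction b with
    | zero => exact ⟨q, hq, by simp⟩
    | succ b ih =>
      obtain ⟨q₁, hq₁, h₁⟩ := ih
      obtain ⟨q₂, hq₂, h₂⟩ := hX _ q₁ hq₁
      refine ⟨q₂, hq₂, ?_⟩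
      rw [pow_succ', Module.End.mul_apply, h₁, h₂, add_assoc, ← Pi.single_add]
      rfl
  · obtain ⟨b, hb⟩ := Int.eq_ofNat_of_zero_le (show 0 ≤ -a by omega)
    obtain rfl : a = -(b : ℤ) := by omega
    simp only [neg_neg, Int.toNat_natCast]
    clear ha hb
    induction b with
    | zero => exact ⟨q, hq, by simp⟩
    | succ b ih =>
      obtain ⟨q₁, hq₁, h₁⟩ := ih
      obtain ⟨q₂, hq₂, h₂⟩ := hY _ q₁ hq₁
      refine ⟨q₂, hq₂, ?_⟩
      rw [pow_succ', Module.End.mul_apply, h₁, h₂, add_sub_assoc, ← Pi.single_sub]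
      congr 3
      push_cast
      ring

/-- Raising letters shift a delta without changing its coefficient, and lowering letters multiply it
by a nonzero polynomial. The coefficient ring is a domain, so no word kills the vacuum, and distinct
words land at distinct lattice points. -/
theorem exists_word_vac (k : ℂ) (n : Lat N) :
    ∃ q, q ≠ 0 ∧ word N modP (modM k) modY modD n (vac N) = Pi.single n q := by
  have key (l : List (Option (Fin N))) (hl : l.Nodup) : ∃ q : Coef N, q ≠ 0 ∧
      wordL (genX modP modY) (genX (modM k) modD) l n (vac N)
        = Pi.single (fun i => if i ∈ l then n i else 0) q := by
    induction l with
    | nil => exact ⟨1, one_ne_zero, by simp [wordL, vac]; rfl⟩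
    | cons i l ih =>
      rw [List.nodup_cons] at hl
      obtain ⟨q₁, hq₁, h₁⟩ := ih hl.2
      obtain ⟨q₂, hq₂, h₂⟩ := exists_zpw_single k i (n i) (fun i => if i ∈ l then n i else 0) q₁ hq₁
      refine ⟨q₂, hq₂, ?_⟩
      rw [wordL_cons, Module.End.mul_apply, h₁, h₂]
      congr 1
      funext j
      by_cases hj : j = i
      · subst hj
        simp [hl.1]
      · simp [hj]
  obtain ⟨q, hq, h⟩ := key _ (Finset.nodup_toList Finset.univ)
  refine ⟨q, hq, ?_⟩
  rw [word, h]
  simp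

/-! ## Faithfulness of the model -/

section Faithful

variable {M : Type*} [AddCommGroup M] [Module ℂ M] {c d : Matrix (Fin N) (Fin N) ℂ} {k : ℂ}

theorem modY_mul_modD_vac (r : Fin N) : modY r (modD r (vac N)) =
    (MvPolynomial.X (some r) : Coef N) • vac N := by
  rw [← Module.End.mul_apply, modY_mul_modD, vac, wShift_single, sub_zero, ← Pi.single_smul]
  simp [gVal]

theorem modCasimir (F : Model N) :
    oscCasimir (modH k) modP (modM k) F = (MvPolynomial.X none : Coef N) • F := by
  rw [oscCasimir, modH_casimir]
  funext n
  simp [wShift_apply]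

/-- Injectivity on the cyclic module generated by `v`: an element is a sum over lattice points of
words applied to coefficient operators. Its component at `n` maps to the coefficient times a nonzero
polynomial, placed at `n`. If the image vanishes, every coefficient polynomial vanishes, and so does
the element. -/
theorem eq_zero_of_model_eq_zero (θ : U N →ₐ[ℂ] Module.End ℂ M)
    (hZ : ∀ r s, θ (ι (Z r s)) = algebraMap ℂ _ (c r s)) (hc : c.IsSymm) (hd : d.IsSymm)
    (hcd : c * d = 1) (v : M) (hv : θ (ι (tildeH (N := N)).1) v = k • v)
    (θ' : U N →ₐ[ℂ] Module.End (Coef N) (Model N)) (hH : θ' (liftH d) = modH k)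
    (hP : θ' (liftP d) = modP) (hM : θ' (liftM d) = modM k) (hY : ∀ r, θ' (liftY r) = modY r)
    (hD : ∀ r, θ' (liftD d r) = modD r) (π : M →ₗ[ℂ] Model N)
    (hπ : ∀ u x, π (θ u x) = θ' u (π x)) (hπv : π v = vac N) (u : U N) (hu : θ' u (vac N) = 0) :
    θ u v = 0 := by
  have ho := oscRel_of_hom θ hZ hc hd hcd
  obtain ⟨Φ, hΦ0, hΦ, hΦh⟩ := ho.exists_coef_hom
  -- Since `H̃ = h + ∑ y_r D_r + N/2` acts on `v` by `k`, the element `h` acts on `v` through a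
  -- coefficient operator.
  have hv' : θ (liftH d) v
      = Φ (MvPolynomial.C (k - N / 2) - ∑ r, MvPolynomial.X (some r)) v := by
    have h1 := hom_tildeH θ hZ hd hcd
    have h2 := congrArg (fun T : Module.End ℂ M => T v) h1
    simp only [hv, LinearMap.add_apply, LinearMap.smul_apply, Module.End.one_apply] at h2
    rw [map_sub, map_sum, ← MvPolynomial.algebraMap_eq, AlgHom.commutes]
    simp only [hΦ, LinearMap.sub_apply, Module.algebraMap_end_apply, sub_smul, h2]
    abel
  have hmem := ho.hom_mem_iSup_wordSpace hZ hcd hΦ0 hΦ hΦh hv' u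
  -- The Casimir operator and the `y_r D_r` come from the enveloping algebra, so the intertwiner
  -- carries them to the operators of the model, which act on the vacuum by the variables.
  have hΦv (q : Coef N) : π (Φ q v) = q • vac N := by
    induction q using MvPolynomial.induction_on with
    | C a =>
      rw [← MvPolynomial.algebraMap_eq, AlgHom.commutes, Module.algebraMap_end_apply, map_smul, hπv,
        algebraMap_smul]
    | add q q' hq hq' => rw [map_add, LinearMap.add_apply, map_add, hq, hq', add_smul]
    | mul_X q i hq =>
      rw [mul_comm q, map_mul, Module.End.mul_apply]
      rcases i with _ | r
      · rw [hΦ0]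
        have : oscCasimir (θ (liftH d)) (θ (liftP d)) (θ (liftM d))
            = θ (oscCasimir (liftH d) (liftP d) (liftM d)) := by
          simp [oscCasimir]
        rw [this, hπ, hq]
        have : θ' (oscCasimir (liftH d) (liftP d) (liftM d))
            = oscCasimir (modH k) modP (modM k) := by
          simp [oscCasimir, hH, hP, hM]
        rw [this, modCasimir, mul_smul]
      · rw [hΦ, ← map_mul, hπ, hq, map_mul, hY, hD, Module.End.mul_apply, map_smul, map_smul,
          modY_mul_modD_vac, mul_smul, smul_comm]
  obtain ⟨g, hg, hsum⟩ := (Submodule.mem_iSup_iff_exists_finsupp _ _).1 hmem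
  have hgn (n : Lat N) : ∃ q Q : Coef N, Q ≠ 0 ∧ π (g n) = Pi.single n (q * Q) ∧
      (q = 0 → g n = 0) := by
    obtain ⟨q, hq⟩ := hg n
    obtain ⟨Q, hQ, hw⟩ := exists_word_vac k n
    refine ⟨q, Q, hQ, ?_, fun h0 => ?_⟩
    · rw [← hq]
      simp only [LinearMap.comp_apply, LinearMap.applyₗ_apply_apply, AlgHom.toLinearMap_apply]
      rw [← hom_word θ, hπ, hom_word θ', hΦv, hP, hM, funext hY, funext hD, map_smul]
      rw [hw, ← Pi.single_smul, smul_eq_mul]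
    · rw [← hq, h0]
      simp
  have hπu : π (θ u v) = 0 := by rw [hπ, hπv, hu]
  have hzero (n : Lat N) : g n = 0 := by
    obtain ⟨q, Q, hQ, h1, h2⟩ := hgn n
    apply h2
    have h3 := congrFun hπu n
    rw [← hsum, Finsupp.sum, map_sum, Finset.sum_apply, Finset.sum_eq_single n] at h3
    · rw [h1, Pi.single_eq_same] at h3
      exact (mul_eq_zero.1 h3).resolve_right hQ
    · intro n' _ hn'
      obtain ⟨q', Q', -, h4, -⟩ := hgn n'
      rw [h4, Pi.single_eq_of_ne hn'.symm]
    · intro hn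
      rw [Finsupp.notMem_support_iff.1 hn, map_zero, Pi.zero_apply]
  rw [← hsum]
  exact Finset.sum_eq_zero fun n _ => hzero n

end Faithful

/-! ## The isotropy subalgebra -/

theorem isotropy_eq_sum (Y : isotropy N) :
    Y.1 = (-(Complex.I * Y.1.M 1 0)) • (tildeH (N := N)).1 + ∑ r, ∑ s, Y.1.κ r s • Z r s := by
  obtain ⟨Y, hM, hX⟩ := Y
  have h00 : Y.M 0 0 = 0 := by
    have := congrFun (congrFun hM 0) 0
    simp only [Matrix.transpose_apply, Matrix.neg_apply] at this
    linear_combination this / 2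
  have h01 : Y.M 0 1 = -Y.M 1 0 := by
    have := congrFun (congrFun hM 1) 0
    simpa only [Matrix.transpose_apply, Matrix.neg_apply] using this
  have h := alg_eq_sum Y
  have hf : ∑ r, (Y.X r 0 • f r + Y.X r 1 • e r) = 0 := by
    simp [show Y.X = 0 from hX]
  rw [hf, h00, h01, add_zero] at h
  simp only
  rw [tildeH]
  conv_lhs => rw [h]
  congr 1
  match_scalars
  · ring
  · linear_combination (-(Y.M 1 0)) * Complex.I_mul_I
  · linear_combination (Y.M 1 0) * Complex.I_mul_I

theorem Z_mem_isotropy (r s : Fin N) : Z r s ∈ isotropy N := ⟨by simp [Z], by simp [Z]⟩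

theorem slashRep_Z (k : ℂ) {L : Matrix (Fin N) (Fin N) ℂ} (hL : L.IsSymm) (r s : Fin N) :
    slashRep k L ⟨Z r s, Z_mem_isotropy r s⟩ = -(2 * Real.pi * Complex.I * L r s) := by
  simp only [slashRep, LieHom.coe_mk]
  simp [Z, Matrix.add_mul, Matrix.trace_single_mul, hL.apply r s]
  ring

theorem slashRep_eq (k : ℂ) {L : Matrix (Fin N) (Fin N) ℂ} (hL : L.IsSymm) (Y : isotropy N) :
    slashRep k L Y = Complex.I * k * Y.1.M 1 0
      - ∑ r, ∑ s, Y.1.κ r s * (2 * Real.pi * Complex.I * L r s) := by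
  simp only [slashRep, LieHom.coe_mk]
  congr 1
  rw [Matrix.trace, Finset.mul_sum]
  refine Finset.sum_congr rfl fun r _ => ?_
  rw [Matrix.diag_apply, Matrix.mul_apply, Finset.mul_sum]
  refine Finset.sum_congr rfl fun s _ => ?_
  rw [hL.apply]
  ring

/-- The isotropy subalgebra is spanned by `H̃` and the central `Z_{rs}`, so invariance is the single
condition of weight zero for `H̃`. -/
theorem mem_invariants_of_commute {u : U N}
    (h : ι (tildeH (N := N)).1 * u = u * ι (tildeH (N := N)).1) : u ∈ invariants N := by
  rw [invariants, Subalgebra.mem_centralizer_iff]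
  rintro _ ⟨Y, rfl⟩
  rw [isotropy_eq_sum Y]
  simp only [map_add, map_sum, ι_smul, add_mul, mul_add, smul_mul_assoc, mul_smul_comm, h,
    Finset.sum_mul, Finset.mul_sum]
  refine congrArg _ ?_
  refine Finset.sum_congr rfl fun r _ => Finset.sum_congr rfl fun s _ => ?_
  rw [Subalgebra.mem_center_iff.1 (ι_mem_center (Z_lie r s))]

/-! ### The slash ideal as the annihilator of the vacuum -/

section Index

/-- The scalars by which the `Z_{rs}` act modulo `slashIdeal k L`. -/
noncomputable def indexMat (L : Matrix (Fin N) (Fin N) ℂ) : Matrix (Fin N) (Fin N) ℂ :=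
  (2 * Real.pi * Complex.I) • L

variable (k : ℂ) {L d : Matrix (Fin N) (Fin N) ℂ}

theorem Z_sub_mem_slashIdeal (hL : L.IsSymm) (r s : Fin N) :
    ι (Z r s) - algebraMap ℂ (U N) (indexMat L r s) ∈ slashIdeal k L := by
  have h : ι (Z r s) + algebraMap ℂ (U N) (slashRep k L ⟨Z r s, Z_mem_isotropy r s⟩)
      ∈ slashIdeal k L := Ideal.subset_span ⟨⟨Z r s, Z_mem_isotropy r s⟩, rfl⟩
  rw [slashRep_Z k hL, map_neg, ← sub_eq_add_neg] at h
  exact h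

theorem tildeH_sub_mem_slashIdeal :
    ι (tildeH (N := N)).1 - algebraMap ℂ (U N) k ∈ slashIdeal k L := by
  have h : ι (tildeH (N := N)).1 + algebraMap ℂ (U N) (slashRep k L tildeH) ∈ slashIdeal k L :=
    Ideal.subset_span ⟨tildeH, rfl⟩
  rwa [slashRep_tildeH, map_neg, ← sub_eq_add_neg] at h

variable {k}

/-- The model as a representation of the enveloping algebra. -/
structure IsModelHom (k : ℂ) (L d : Matrix (Fin N) (Fin N) ℂ)
    (θ : U N →ₐ[ℂ] Module.End (Coef N) (Model N)) : Prop where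
  Z r s : θ (ι (Z r s)) = algebraMap ℂ _ (indexMat L r s)
  H : θ (liftH d) = modH k
  P : θ (liftP d) = modP
  M : θ (liftM d) = modM k
  Y r : θ (liftY r) = modY r
  D r : θ (liftD d r) = modD r

theorem exists_isModelHom (k : ℂ) (hL : L.IsSymm) (hd : d.IsSymm) (hcd : indexMat L * d = 1) :
    ∃ θ, IsModelHom k L d θ := by
  have hc : (indexMat L).IsSymm := Matrix.IsSymm.smul hL _
  obtain ⟨θ, h1, h2, h3, h4, h5, h6⟩ := (oscRel_model (N := N) k).exists_hom hc hd hcd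
  exact ⟨θ, h1, h2, h3, h4, h5, h6⟩

namespace IsModelHom

variable {θ : U N →ₐ[ℂ] Module.End (Coef N) (Model N)}

theorem tildeH_eq (hθ : IsModelHom k L d θ) (hd : d.IsSymm) (hcd : indexMat L * d = 1) :
    θ (ι (tildeH (N := N)).1)
      = wShift (fun n => MvPolynomial.C (k + 2 * n none + ∑ r, (n (some r) : ℂ))) 0 := by
  rw [hom_tildeH θ hθ.Z hd hcd, hθ.H]
  simp only [hθ.Y, hθ.D, modY_mul_modD]
  refine LinearMap.ext fun F => funext fun n => ?_
  simp only [modH, LinearMap.add_apply, LinearMap.sum_apply, LinearMap.smul_apply, Pi.add_apply,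
    Finset.sum_apply, Pi.smul_apply, wShift_apply, add_zero, Module.End.one_apply, hVal, gVal,
    MvPolynomial.smul_eq_C_mul, ← Finset.sum_mul, Finset.sum_add_distrib, map_add, map_sub, map_sum]
  ring

/-- The annihilator of a vector is a left ideal, so it is enough that the generators kill the
vacuum: `H̃` acts there by `k` and `Z_{rs}` by `2πi L_{rs}`, the negatives of the values of
`slashRep`. -/
theorem slashIdeal_vac (hθ : IsModelHom k L d θ) (hL : L.IsSymm) (hd : d.IsSymm)
    (hcd : indexMat L * d = 1) {u : U N} (hu : u ∈ slashIdeal k L) : θ u (vac N) = 0 := by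
  have hH : θ (ι (tildeH (N := N)).1) (vac N) = k • vac N := by
    rw [hθ.tildeH_eq hd hcd, vac, wShift_single, sub_zero, ← Pi.single_smul,
      MvPolynomial.smul_eq_C_mul]
    simp
  rw [slashIdeal] at hu
  induction hu using Submodule.span_induction with
  | mem x hx =>
    obtain ⟨Y, rfl⟩ := hx
    have hY := congrArg ι (isotropy_eq_sum Y)
    rw [slashRep_eq k hL Y, map_add, hY]
    simp only [map_add, map_sum, map_sub, map_smul, hθ.Z, AlgHom.commutes,
      LinearMap.add_apply, LinearMap.smul_apply, LinearMap.sub_apply, LinearMap.sum_apply,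
      Module.algebraMap_end_apply, hH, smul_smul, ← Finset.sum_smul, indexMat, Matrix.smul_apply,
      smul_eq_mul]
    module
  | zero => simp
  | add x y _ _ hx hy => rw [map_add, LinearMap.add_apply, hx, hy, add_zero]
  | smul c x _ hx => rw [smul_eq_mul, map_mul, Module.End.mul_apply, hx, map_zero]

/-- The model is faithful modulo `slashIdeal`. -/
theorem mem_slashIdeal (hθ : IsModelHom k L d θ) (hL : L.IsSymm) (hd : d.IsSymm)
    (hcd : indexMat L * d = 1) {u : U N} (hu : θ u (vac N) = 0) : u ∈ slashIdeal k L := by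
  have hc : (indexMat L).IsSymm := Matrix.IsSymm.smul hL _
  let f₀ : U N →ₗ[ℂ] Model N :=
    { toFun := fun u => θ u (vac N)
      map_add' := fun u v => by simp
      map_smul' := fun c u => by simp }
  let π : (U N ⧸ slashIdeal k L) →ₗ[ℂ] Model N :=
    (((slashIdeal k L).restrictScalars ℂ).liftQ f₀ fun u hu =>
      hθ.slashIdeal_vac hL hd hcd hu).comp
      (Submodule.Quotient.restrictScalarsEquiv ℂ (slashIdeal k L)).symm.toLinearMap
  have hπ (u : U N) : π (Submodule.Quotient.mk u) = θ u (vac N) := rfl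
  have hmk (u v : U N) : Algebra.lsmul ℂ ℂ (U N ⧸ slashIdeal k L) u (Submodule.Quotient.mk v)
      = Submodule.Quotient.mk (u * v) := rfl
  have hsmul (a : ℂ) (v : U N) : a • (Submodule.Quotient.mk v : U N ⧸ slashIdeal k L)
      = Submodule.Quotient.mk (a • v) := rfl
  -- The quotient is cyclic on the class of `1`. The `Z_{rs}` act by scalars on all of it, not only
  -- on the generator: being central, they can be moved to the right, where `Z_{rs}` minus its
  -- scalar lies in the left ideal.
  have h := eq_zero_of_model_eq_zero (M := U N ⧸ slashIdeal k L) (k := k)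
    (Algebra.lsmul ℂ ℂ (U N ⧸ slashIdeal k L)) (c := indexMat L) (d := d)
    (fun r s => by
      refine LinearMap.ext fun x => ?_
      obtain ⟨v, rfl⟩ := Submodule.Quotient.mk_surjective _ x
      rw [hmk, Module.algebraMap_end_apply, hsmul, Submodule.Quotient.eq,
        ← Subalgebra.mem_center_iff.1 (ι_mem_center (Z_lie r s)), Algebra.smul_def,
        Algebra.commutes, ← mul_sub]
      exact Ideal.mul_mem_left _ _ (Z_sub_mem_slashIdeal k hL r s))
    hc hd hcd (Submodule.Quotient.mk 1)
    (by
      rw [hmk, hsmul, Submodule.Quotient.eq, mul_one, ← Algebra.algebraMap_eq_smul_one]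
      exact tildeH_sub_mem_slashIdeal k)
    θ hθ.H hθ.P hθ.M hθ.Y hθ.D π
    (fun u x => by
      obtain ⟨v, rfl⟩ := Submodule.Quotient.mk_surjective _ x
      rw [hmk, hπ, hπ, map_mul, Module.End.mul_apply])
    (by rw [hπ, map_one, Module.End.one_apply]) u hu
  rwa [hmk, mul_one, Submodule.Quotient.mk_eq_zero] at h

end IsModelHom

end Index

/-! ## Shift-invariant polynomials -/

/-- The value at `0` is repeated at all the points `-2n`, so in characteristic zero the polynomial
agrees with a constant infinitely often. -/
theorem polynomial_eval_eq_of_shift {P : Polynomial ℂ} (hP : ∀ t, P.eval (t - 2) = P.eval t)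
    (t : ℂ) : P.eval t = P.eval 0 := by
  have h1 (n : ℕ) : P.eval (-(2 * n : ℂ)) = P.eval 0 := by
    induction n with
    | zero => simp
    | succ n ih =>
      rw [← ih, ← hP (-(2 * n : ℂ))]
      congr 1
      push_cast
      ring
  have h2 : P = Polynomial.C (P.eval 0) := by
    refine Polynomial.eq_of_infinite_eval_eq _ _ (Set.Infinite.mono (s := Set.range
      fun n : ℕ => -(2 * n : ℂ)) ?_ (Set.infinite_range_of_injective ?_))
    · rintro _ ⟨n, rfl⟩
      simp [h1 n]
    · intro a b hab
      simpa using hab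
  rw [h2]
  simp

variable (N) in
/-- The shift of one of the degree variables by `-2`. -/
noncomputable def degShift (r : Fin N) : Coef N →ₐ[ℂ] Coef N :=
  MvPolynomial.aeval fun i => MvPolynomial.X i - MvPolynomial.C (if i = some r then 2 else 0)

/-- In each degree variable separately, with the others fixed at a point, `q` is shift-invariant and
so constant. All the degree variables may therefore be set to zero, leaving a polynomial in the
Casimir variable. -/
theorem exists_polynomial_of_degShift {q : Coef N} (hq : ∀ r, degShift N r q = q) :
    ∃ Q : Polynomial ℂ, Polynomial.aeval (MvPolynomial.X none : Coef N) Q = q := by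
  have h1 (r : Fin N) (x : Option (Fin N) → ℂ) (a : ℂ) :
      MvPolynomial.eval (Function.update x (some r) a) q = MvPolynomial.eval x q := by
    let P : Polynomial ℂ := MvPolynomial.aeval
      (Function.update (fun i => Polynomial.C (x i)) (some r) Polynomial.X) q
    have hP (t : ℂ) : P.eval t = MvPolynomial.eval (Function.update x (some r) t) q := by
      have : (Polynomial.aeval t).comp (MvPolynomial.aeval
          (Function.update (fun i => Polynomial.C (x i)) (some r) Polynomial.X))
          = (MvPolynomial.aeval (Function.update x (some r) t) : Coef N →ₐ[ℂ] ℂ) := by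
        refine MvPolynomial.algHom_ext fun i => ?_
        by_cases hi : i = some r
        · subst hi; simp
        · simp [hi]
      have h2 := congrArg (fun g : Coef N →ₐ[ℂ] ℂ => g q) this
      simpa [P, MvPolynomial.aeval_def, MvPolynomial.eval₂_id, Polynomial.coe_aeval_eq_eval] using h2
    have hshift (t : ℂ) : P.eval (t - 2) = P.eval t := by
      rw [hP, hP]
      conv_rhs => rw [← hq r]
      have : (MvPolynomial.aeval (Function.update x (some r) t) : Coef N →ₐ[ℂ] ℂ).comp
          (degShift N r) = MvPolynomial.aeval (Function.update x (some r) (t - 2)) := by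
        refine MvPolynomial.algHom_ext fun i => ?_
        by_cases hi : i = some r
        · subst hi; simp [degShift]
        · simp [degShift, hi]
      have h2 := congrArg (fun g : Coef N →ₐ[ℂ] ℂ => g q) this
      exact h2.symm
    have h3 := polynomial_eval_eq_of_shift hshift
    rw [← hP, h3, ← h3 (x (some r)), hP, Function.update_eq_self]
  -- The degree variables are set to zero one at a time, by induction on the set already treated.
  have h2 (x : Option (Fin N) → ℂ) (s : Finset (Fin N)) :
      MvPolynomial.eval (fun i => i.elim (x none) fun r => if r ∈ s then 0 else x (some r)) q
        = MvPolynomial.eval x q := by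
    induction s using Finset.induction_on with
    | empty =>
      congr 2
      funext i
      cases i <;> simp
    | insert r s hr ih =>
      rw [← ih, ← h1 r (fun i => i.elim (x none) fun t => if t ∈ s then 0 else x (some t)) 0]
      congr 2
      funext i
      rcases i with _ | t
      · simp
      · by_cases ht : t = r
        · subst ht; simp
        · simp [ht]
  refine ⟨MvPolynomial.aeval (fun i : Option (Fin N) => i.elim Polynomial.X fun _ => 0) q, ?_⟩
  refine MvPolynomial.funext fun x => ?_
  rw [← h2 x Finset.univ]
  have : ((MvPolynomial.aeval x : Coef N →ₐ[ℂ] ℂ).comp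
      (Polynomial.aeval (MvPolynomial.X none : Coef N))).comp
        (MvPolynomial.aeval (fun i : Option (Fin N) => i.elim Polynomial.X fun _ => 0))
      = MvPolynomial.aeval (fun i : Option (Fin N) => i.elim (x none) fun r =>
          if r ∈ (Finset.univ : Finset (Fin N)) then 0 else x (some r)) := by
    refine MvPolynomial.algHom_ext fun i => ?_
    cases i <;> simp
  exact congrArg (fun g : Coef N →ₐ[ℂ] ℂ => g q) this

/-! ## The symmetries of the model -/

/-- The semilinear symmetry of the model that shifts the weights. -/
noncomputable def modShift (r : Fin N) (F : Model N) : Model N := fun n =>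
  degShift N r (F (n - (Pi.single none 1 - Pi.single (some r) 2)))

/-- Translations of the lattice commute among themselves, so compatibility with the symmetry is a
condition on the coefficients alone. -/
theorem wShift_modShift (r : Fin N) (a : Lat N → Coef N) (w : Lat N)
    (ha : ∀ n, degShift N r (a (n - (Pi.single none 1 - Pi.single (some r) 2))) = a n)
    (F : Model N) : wShift a w (modShift r F) = modShift r (wShift a w F) := by
  funext n
  simp only [wShift_apply, modShift, map_mul, ha]
  rw [add_sub_right_comm]

/-- The translation lowers the coordinate at `none` by one, which changes the weight by `-2`.
Replacing `X (some r)` by `X (some r) - 2` changes it by `+2`. -/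
theorem degShift_hVal (k : ℂ) (r : Fin N) (n : Lat N) :
    degShift N r (hVal k (n - (Pi.single none 1 - Pi.single (some r) 2))) = hVal k n := by
  have h1 : ∀ z : ℂ, degShift N r (MvPolynomial.C z) = MvPolynomial.C z := fun z => by
    rw [← MvPolynomial.algebraMap_eq, AlgHom.commutes]
  have h2 : ∑ s, (MvPolynomial.C (if s = r then (2 : ℂ) else 0) : Coef N) = MvPolynomial.C 2 := by
    rw [← map_sum]
    simp
  simp only [hVal, map_sub, map_sum, h1]
  simp only [degShift, MvPolynomial.aeval_X, Finset.sum_sub_distrib, Option.some.injEq, h2]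
  simp only [Pi.sub_apply, Pi.single_eq_same, ne_eq, reduceCtorEq, not_false_eq_true,
    Pi.single_eq_of_ne, sub_zero, Int.cast_sub, Int.cast_one, mul_sub, mul_one, map_add, map_sub]
  ring

theorem degShift_gVal (r s : Fin N) (n : Lat N) :
    degShift N r (gVal s (n - (Pi.single none 1 - Pi.single (some r) 2))) = gVal s n := by
  have h1 : ∀ z : ℂ, degShift N r (MvPolynomial.C z) = MvPolynomial.C z := fun z => by
    rw [← MvPolynomial.algebraMap_eq, AlgHom.commutes]
  simp only [gVal, map_add, h1]
  by_cases hrs : s = r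
  · subst hrs
    simp [degShift]
  · simp [degShift, hrs]

/-! ### Casimir and central elements in the model -/

namespace IsModelHom

variable {k : ℂ} {L d : Matrix (Fin N) (Fin N) ℂ}
  {θ : U N →ₐ[ℂ] Module.End (Coef N) (Model N)}

/-- The symmetry is only semilinear over the coefficient ring, but it is complex linear. The
operators commuting with it therefore form a complex subalgebra, and the lifts lie in it. -/
theorem hom_modShift (hθ : IsModelHom k L d θ) (hcd : indexMat L * d = 1) (r : Fin N) (u : U N)
    (F : Model N) : θ u (modShift r F) = modShift r (θ u F) := by
  let S : Subalgebra ℂ (Module.End (Coef N) (Model N)) :=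
    { carrier := {T | ∀ F, T (modShift r F) = modShift r (T F)}
      mul_mem' := fun {S T} hS hT F => by
        rw [Module.End.mul_apply, hT, hS, Module.End.mul_apply]
      add_mem' := fun {S T} hS hT F => by
        rw [LinearMap.add_apply, hS, hT]
        funext n
        simp [modShift]
      algebraMap_mem' := fun a F => by
        rw [Module.algebraMap_end_apply, Module.algebraMap_end_apply]
        funext n
        simp [modShift] }
  have hone : ∀ n : Lat N, degShift N r ((fun _ => 1 : Lat N → Coef N)
      (n - (Pi.single none 1 - Pi.single (some r) 2))) = (fun _ => 1 : Lat N → Coef N) n :=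
    fun n => map_one _
  refine hom_mem_of_lifts_mem θ hθ.Z hcd S ?_ ?_ ?_ ?_ ?_ u F
  · rw [hθ.H]
    exact wShift_modShift r _ _ (degShift_hVal k r)
  · rw [hθ.P]
    exact wShift_modShift r _ _ hone
  · rw [hθ.M]
    refine wShift_modShift r _ _ fun n => ?_
    have h1 : ∀ z : ℂ, degShift N r (MvPolynomial.C z) = MvPolynomial.C z := fun z => by
      rw [← MvPolynomial.algebraMap_eq, AlgHom.commutes]
    simp only [mVal, map_mul, map_sub, map_pow, degShift_hVal, h1, map_ofNat]
    simp [degShift]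
  · intro s
    rw [hθ.Y]
    exact wShift_modShift r _ _ hone
  · intro s
    rw [hθ.D]
    refine wShift_modShift r _ _ fun n => ?_
    rw [sub_add_eq_add_sub, degShift_gVal]

/-- The scalar by which the Casimir element acts on the model. -/
noncomputable def casimirVal (L : Matrix (Fin N) (Fin N) ℂ) : Coef N :=
  MvPolynomial.C (indexMat L).det * (MvPolynomial.X none - MvPolynomial.C ((N : ℂ) * (N + 4) / 4))

theorem hom_casimir (hθ : IsModelHom k L d θ) (hL : L.IsSymm) (hd : d.IsSymm)
    (hcd : indexMat L * d = 1) (F : Model N) : θ (casimir N) F = casimirVal L • F := by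
  rw [Jacobi.hom_casimir θ hθ.Z (Matrix.IsSymm.smul hL _) hd hcd, hθ.H, hθ.M, hθ.P, modH_casimir]
  funext n
  simp only [LinearMap.smul_apply, LinearMap.sub_apply, Pi.smul_apply, Pi.sub_apply, wShift_apply,
    add_zero, Module.End.one_apply, MvPolynomial.smul_eq_C_mul, smul_eq_mul, casimirVal]
  ring

theorem hom_aeval_casimir (hθ : IsModelHom k L d θ) (hL : L.IsSymm) (hd : d.IsSymm)
    (hcd : indexMat L * d = 1) (Q : Polynomial ℂ) (F : Model N) :
    θ (Polynomial.aeval (casimir N) Q) F = Polynomial.aeval (casimirVal L) Q • F := by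
  induction Q using Polynomial.induction_on' with
  | add P Q hP hQ => rw [map_add, map_add, LinearMap.add_apply, hP, hQ, map_add, add_smul]
  | monomial n a =>
    rw [Polynomial.aeval_monomial, Polynomial.aeval_monomial, map_mul, AlgHom.commutes,
      Module.End.mul_apply, Module.algebraMap_end_apply, mul_smul, algebraMap_smul, map_pow]
    congr 1
    induction n with
    | zero => simp
    | succ n ih =>
      rw [pow_succ', Module.End.mul_apply, ih, hθ.hom_casimir hL hd hcd, smul_smul, pow_succ']

theorem det_indexMat_ne_zero (hcd : indexMat L * d = 1) : (indexMat L).det ≠ 0 := by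
  intro h0
  have := congrArg Matrix.det hcd
  rw [Matrix.det_mul, h0, zero_mul, Matrix.det_one] at this
  exact zero_ne_one this

/-- Every polynomial in the Casimir operator of `sl₂` is a polynomial in the Casimir element. -/
theorem exists_aeval_casimirVal (hcd : indexMat L * d = 1) (Q : Polynomial ℂ) :
    ∃ Q' : Polynomial ℂ, Polynomial.aeval (casimirVal L) Q'
      = Polynomial.aeval (MvPolynomial.X none : Coef N) Q := by
  -- The substituted polynomial inverts the affine map from `X none` to `casimirVal`, which is
  -- possible because the determinant is nonzero.
  refine ⟨Q.comp (Polynomial.C (indexMat L).det⁻¹ * Polynomial.X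
    + Polynomial.C ((N : ℂ) * (N + 4) / 4)), ?_⟩
  have h : Polynomial.aeval (casimirVal L) (Polynomial.C (indexMat L).det⁻¹ * Polynomial.X
      + Polynomial.C ((N : ℂ) * (N + 4) / 4)) = MvPolynomial.X none := by
    simp only [map_add, map_mul, Polynomial.aeval_C, Polynomial.aeval_X, MvPolynomial.algebraMap_eq,
      casimirVal]
    rw [← mul_assoc, ← map_mul, inv_mul_cancel₀ (det_indexMat_ne_zero hcd)]
    simp
  rw [Polynomial.aeval_comp, h]

theorem aeval_casimirVal_injective (hcd : indexMat L * d = 1) {Q : Polynomial ℂ}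
    (hQ : Polynomial.aeval (casimirVal L) Q = 0) : Q = 0 := by
  refine Polynomial.funext fun x => ?_
  -- The variables are evaluated at the complex number where `casimirVal` takes the prescribed value
  -- `x`.
  have h := congrArg (MvPolynomial.aeval fun _ : Option (Fin N) =>
    x / (indexMat L).det + (N : ℂ) * (N + 4) / 4) hQ
  rw [← Polynomial.aeval_algHom_apply] at h
  have hx : MvPolynomial.aeval (fun _ : Option (Fin N) =>
      x / (indexMat L).det + (N : ℂ) * (N + 4) / 4) (casimirVal L) = x := by
    simp only [casimirVal, map_mul, map_sub, MvPolynomial.aeval_X, ← MvPolynomial.algebraMap_eq,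
      AlgHom.commutes, Algebra.algebraMap_self, RingHom.id_apply]
    rw [add_sub_cancel_right, mul_div_cancel₀ _ (det_indexMat_ne_zero hcd)]
  rw [hx, map_zero, Polynomial.coe_aeval_eq_eval] at h
  rw [h, Polynomial.eval_zero]

/-- An invariant that is central modulo `slashIdeal` is a polynomial in the Casimir element. -/
theorem exists_sub_mem_slashIdeal (hθ : IsModelHom k L d θ) (hL : L.IsSymm) (hd : d.IsSymm)
    (hcd : indexMat L * d = 1) {z : U N} (hz : z ∈ invariants N)
    (hcomm : ∀ v ∈ invariants N, z * v - v * z ∈ slashIdeal k L) :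
    ∃ Q : Polynomial ℂ, z - Polynomial.aeval (casimir N) Q ∈ slashIdeal k L := by
  have hzv (v : U N) (hv : v ∈ invariants N) : θ z (θ v (vac N)) = θ v (θ z (vac N)) := by
    have := hθ.slashIdeal_vac hL hd hcd (hcomm v hv)
    rwa [map_sub, map_mul, map_mul, LinearMap.sub_apply, sub_eq_zero] at this
  -- `y_r D_r` is an invariant acting by `X (some r)` at the origin and by `X (some r) + n (some r)`
  -- at `n`. Commutation with `z` forces these to agree wherever `z · vac` is nonzero.
  have hdeg (r : Fin N) (n : Lat N) (hn : n (some r) ≠ 0) : θ z (vac N) n = 0 := by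
    have hmem : liftY r * liftD d r ∈ invariants N := by
      refine mem_invariants_of_commute ?_
      rw [← mul_assoc, tildeH_mul_liftY, add_mul, mul_assoc, tildeH_mul_liftD]
      noncomm_ring
    have h := hzv _ hmem
    rw [map_mul, hθ.Y, hθ.D, Module.End.mul_apply, modY_mul_modD_vac, map_smul,
      modY_mul_modD] at h
    have h1 := congrFun h n
    rw [Pi.smul_apply, wShift_apply, add_zero, smul_eq_mul, gVal, add_mul, left_eq_add,
      mul_eq_zero] at h1
    refine h1.resolve_left fun h2 => hn ?_
    rw [← MvPolynomial.C_0] at h2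
    exact_mod_cast MvPolynomial.C_injective _ _ h2
  -- Invariance of `z` preserves the eigenvalue of `H̃`; once the degree coordinates vanish, this
  -- forces the coordinate at `none` to vanish too.
  have hwt (n : Lat N) (hn : 2 * n none + ∑ r, n (some r) ≠ 0) : θ z (vac N) n = 0 := by
    have h0 : ι (tildeH (N := N)).1 * z = z * ι (tildeH (N := N)).1 :=
      (Subalgebra.mem_centralizer_iff ℂ).1 hz _ ⟨tildeH, rfl⟩
    have h := congrArg (fun u => θ u (vac N)) h0
    simp only [map_mul, Module.End.mul_apply, hθ.tildeH_eq hd hcd] at h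
    have h1 := congrFun h n
    have h2 : wShift (fun n : Lat N => MvPolynomial.C (k + 2 * n none + ∑ r, (n (some r) : ℂ))) 0
        (vac N) = (MvPolynomial.C k : Coef N) • vac N := by
      rw [vac, wShift_single, sub_zero, ← Pi.single_smul]
      simp
    rw [h2, map_smul, Pi.smul_apply, wShift_apply, add_zero, smul_eq_mul, ← sub_eq_zero, ← sub_mul,
      ← map_sub, mul_eq_zero] at h1
    refine h1.resolve_left fun h3 => hn ?_
    rw [← MvPolynomial.C_0] at h3
    have h4 := MvPolynomial.C_injective _ _ h3
    have h5 : ((2 * n none + ∑ r, n (some r) : ℤ) : ℂ) = 0 := by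
      push_cast
      linear_combination h4
    exact_mod_cast h5
  set q : Coef N := θ z (vac N) 0 with hq
  have hzq : θ z (vac N) = Pi.single 0 q := by
    funext n
    by_cases hn : n = 0
    · subst hn
      rw [Pi.single_eq_same]
    · rw [Pi.single_eq_of_ne hn]
      by_cases h1 : ∃ r, n (some r) ≠ 0
      · obtain ⟨r, hr⟩ := h1
        exact hdeg r n hr
      · push Not at h1
        refine hwt n fun h2 => hn ?_
        simp only [h1, Finset.sum_const_zero, add_zero] at h2
        funext i
        rcases i with _ | r
        · simpa using h2
        · exact h1 r
  have hshift (r : Fin N) : degShift N r q = q := by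
    -- The weight `2` of the raising operator balances two annihilation operators of weight `-1`,
    -- giving an invariant that leaves the origin.
    have hmem : liftP d * (liftD d r * liftD d r) ∈ invariants N := by
      refine mem_invariants_of_commute ?_
      rw [← mul_assoc, tildeH_mul_liftP, add_mul, mul_assoc (liftP d), ← mul_assoc (ι _),
        tildeH_mul_liftD, sub_mul, mul_assoc (liftD d r), tildeH_mul_liftD]
      simp only [mul_sub, smul_mul_assoc, mul_assoc]
      module
    obtain ⟨g, hg0, hg⟩ : ∃ g : Coef N, g ≠ 0 ∧ ∀ a : Coef N,
        θ (liftP d * (liftD d r * liftD d r)) (Pi.single 0 a)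
          = Pi.single (Pi.single none 1 - Pi.single (some r) 2) (g * a) := by
      -- The two annihilation operators contribute these weights in turn; the raising operator
      -- contributes the coefficient one.
      refine ⟨gVal r (0 - Pi.single (some r) 1 - Pi.single (some r) 1 + Pi.single (some r) 1)
        * gVal r (0 - Pi.single (some r) 1 + Pi.single (some r) 1),
        mul_ne_zero (gVal_ne_zero _ _) (gVal_ne_zero _ _), fun a => ?_⟩
      rw [map_mul, map_mul, hθ.P, hθ.D, Module.End.mul_apply, Module.End.mul_apply, modD, modP,
        wShift_single, wShift_single, wShift_single]
      congr 1
      · rw [show (2 : ℤ) = 1 + 1 from rfl, Pi.single_add]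
        abel
      · ring
    have hs (a : Coef N) : modShift r (Pi.single 0 a)
        = Pi.single (Pi.single none 1 - Pi.single (some r) 2) (degShift N r a) := by
      funext n
      rw [modShift, Pi.single_apply, Pi.single_apply]
      simp only [sub_eq_zero]
      split_ifs <;> simp
    have h := hzv _ hmem
    rw [hzq, vac, hg, hg, mul_one] at h
    -- The image of the vacuum is `g` times its translate under the symmetry, so `z` acts there by
    -- `degShift N r q`. Commutation with the invariant also gives `q`, and the nonzero factor `g`
    -- cancels.
    have h1 : (Pi.single (Pi.single none 1 - Pi.single (some r) 2) g : Model N)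
        = g • modShift r (vac N) := by
      rw [vac, hs, map_one, ← Pi.single_smul, smul_eq_mul, mul_one]
    rw [h1, map_smul, hθ.hom_modShift hcd, hzq, hs, ← Pi.single_smul, smul_eq_mul] at h
    exact mul_left_cancel₀ hg0 (Pi.single_injective (M := fun _ => Coef N) _ h)
  obtain ⟨Q, hQ⟩ := exists_polynomial_of_degShift hshift
  obtain ⟨Q', hQ'⟩ := exists_aeval_casimirVal hcd Q
  refine ⟨Q', hθ.mem_slashIdeal hL hd hcd ?_⟩
  rw [map_sub, LinearMap.sub_apply, hθ.hom_aeval_casimir hL hd hcd, hQ', hQ, hzq, vac,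
    ← Pi.single_smul, smul_eq_mul, mul_one, sub_self]

end IsModelHom

end Jacobi

/-! ### The centre of the algebra of invariant differential operators -/

theorem theorem4p1 (N : ℕ) (k : ℂ) (L : Matrix (Fin N) (Fin N) ℂ) (hL : L.IsSymm)
    (hLinv : IsUnit L) :
    ∃ hΩ : Jacobi.casimir N ∈ Subalgebra.center ℂ (Jacobi.U N),
      Subalgebra.center ℂ (Jacobi.IDO k L) = (Jacobi.centerToIDO k L).range ∧
      Subalgebra.center ℂ (Jacobi.IDO k L) =
        Algebra.adjoin ℂ {Jacobi.centerToIDO k L ⟨Jacobi.casimir N, hΩ⟩} ∧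
      Transcendental ℂ (Jacobi.centerToIDO k L ⟨Jacobi.casimir N, hΩ⟩) := by
  have hΩ := Jacobi.casimir_mem_center (N := N)
  refine ⟨hΩ, ?_⟩
  have hc : (Jacobi.indexMat L).IsSymm := Matrix.IsSymm.smul hL _
  have hunit : IsUnit (Jacobi.indexMat L).det := by
    rw [Jacobi.indexMat, Matrix.det_smul]
    exact ((isUnit_iff_ne_zero.2 Complex.two_pi_I_ne_zero).pow _).mul
      ((Matrix.isUnit_iff_isUnit_det L).1 hLinv)
  have hcd : Jacobi.indexMat L * (Jacobi.indexMat L)⁻¹ = 1 := Matrix.mul_nonsing_inv _ hunit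
  have hd : ((Jacobi.indexMat L)⁻¹).IsSymm := by
    rw [Matrix.IsSymm, Matrix.transpose_nonsing_inv, hc.eq]
  obtain ⟨θ, hθ⟩ := Jacobi.exists_isModelHom k hL hd hcd
  set ω := Jacobi.centerToIDO k L ⟨Jacobi.casimir N, hΩ⟩ with hω
  have haeval (Q : Polynomial ℂ) : Polynomial.aeval ω Q
      = Jacobi.centerToIDO k L (Polynomial.aeval ⟨Jacobi.casimir N, hΩ⟩ Q) := by
    rw [hω, Polynomial.aeval_algHom_apply]
  have hval (Q : Polynomial ℂ) : ((Polynomial.aeval (⟨Jacobi.casimir N, hΩ⟩ :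
      Subalgebra.center ℂ (Jacobi.U N)) Q : Subalgebra.center ℂ (Jacobi.U N)) : Jacobi.U N)
        = Polynomial.aeval (Jacobi.casimir N) Q :=
    (Polynomial.aeval_algHom_apply (Subalgebra.center ℂ (Jacobi.U N)).val _ Q).symm
  have h1 : Algebra.adjoin ℂ {ω} ≤ (Jacobi.centerToIDO k L).range := by
    rw [Algebra.adjoin_le_iff, Set.singleton_subset_iff]
    exact ⟨_, rfl⟩
  have h2 : (Jacobi.centerToIDO k L).range ≤ Subalgebra.center ℂ (Jacobi.IDO k L) := by
    rintro _ ⟨z, rfl⟩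
    rw [Subalgebra.mem_center_iff]
    intro b
    obtain ⟨v, rfl⟩ := Ideal.Quotient.mk_surjective b
    refine congrArg (Ideal.Quotient.mk (Jacobi.invIdeal k L)) (Subtype.ext
      (Subalgebra.mem_center_iff.1 z.2 v))
  -- Together with `h1` and `h2` this closes a cycle of inclusions, which yields both descriptions
  -- of the centre at once.
  have h3 : Subalgebra.center ℂ (Jacobi.IDO k L) ≤ Algebra.adjoin ℂ {ω} := by
    intro x hx
    obtain ⟨z, rfl⟩ := Ideal.Quotient.mk_surjective x
    obtain ⟨Q, hQ⟩ := hθ.exists_sub_mem_slashIdeal hL hd hcd z.2 fun v hv => by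
      have := Subalgebra.mem_center_iff.1 hx (Ideal.Quotient.mk _ ⟨v, hv⟩)
      rw [← map_mul, ← map_mul, eq_comm, Ideal.Quotient.mk_eq_mk_iff_sub_mem] at this
      exact this
    have hx' : Ideal.Quotient.mk (Jacobi.invIdeal k L) z = Polynomial.aeval ω Q := by
      rw [haeval]
      refine Ideal.Quotient.mk_eq_mk_iff_sub_mem _ _ |>.2 ?_
      change (z : Jacobi.U N) - ((Polynomial.aeval (⟨Jacobi.casimir N, hΩ⟩ :
        Subalgebra.center ℂ (Jacobi.U N)) Q : Subalgebra.center ℂ (Jacobi.U N)) : Jacobi.U N)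
          ∈ Jacobi.slashIdeal k L
      rwa [hval]
    rw [hx']
    exact Polynomial.aeval_mem_adjoin_singleton ℂ ω
  refine ⟨le_antisymm (h3.trans h1) h2, le_antisymm h3 (h1.trans h2), ?_⟩
  rw [transcendental_iff]
  intro Q hQ
  rw [haeval] at hQ
  -- An algebraic relation for the Casimir operator puts a polynomial in the Casimir element into
  -- the ideal. Applied to the vacuum, it becomes a relation for `casimirVal`, which is
  -- transcendental.
  have hmem : Polynomial.aeval (Jacobi.casimir N) Q ∈ Jacobi.slashIdeal k L := by
    rw [← hval]
    exact (Ideal.Quotient.eq_zero_iff_mem (I := Jacobi.invIdeal k L)).1 hQ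
  have h4 := hθ.slashIdeal_vac hL hd hcd hmem
  rw [hθ.hom_aeval_casimir hL hd hcd] at h4
  have h5 := congrFun h4 0
  rw [Pi.smul_apply, Jacobi.vac, Pi.single_eq_same, smul_eq_mul, mul_one] at h5
  exact Jacobi.IsModelHom.aeval_casimirVal_injective hcd h5
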